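/- Let $G$ be a permutation group on a finite set $\Omega$ with a cyclic regular normal subgroup $W=\langle w\rangle$ of order $n$ and a cyclic point stabilizer $A=\langle a\rangle$, so that $G=\langle a,w\rangle$. Permutations act on the right, and $\alpha$ is an integer with $w^a=a^{-1}wa=w^\alpha$. Identify $\Omega$ with $W$, the point fixed by $A$ corresponding to $1$, so that $\mathrm{Hol}(W)=W\rtimes\mathrm{Aut}(W)$ becomes a subgroup of $\mathrm{Sym}(\Omega)$ containing $G$. A subgroup $H\le G$ is relatively closed in $G$ if it is the largest subgroup of $G$ with the same set of orbits on $\Omega$ as $H$. A relatively closed subgroup $H$ of $G$ is second maximal if there is a subgroup $M$ such that $M$ is maximal among the relatively closed subgroups of $G$ properly contained in $G$, and $H$ is maximal among the relatively closed subgroups of $G$ properly contained in $M$. Write $\pi(m)$ for the set of prime divisors of $m$, $\mathrm{ord}_m(\alpha)$ for the multiplicative order of $\alpha$ modulo $m$, $(k,m)$ for the greatest common divisor, $\Omega(H)$ for the multiset of the lengths of the orbits of $H$, and $k\times m$ for an element $m$ of multiplicity $k$ in a multiset. Every second maximal relatively closed subgroup of $G$ is conjugate in $\mathrm{Hol}(W)$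 to exactly one of the following subgroups (where different parameters give different subgroups, up to the order of $s$ and $r$ in (2)): 1. $H_1=\langle a^s,w^r\rangle$, where $r\in\pi(n)$ and $s\in\pi(\mathrm{ord}_r(\alpha))$; 2. $H_2=\langle a,w^{sr}\rangle$, where $s,r\in\pi(n)$ and $sr$ divides $n$; 3. $H_3=\langle a^{\mathrm{ord}_s(\alpha)}w^r,w^{sr}\rangle$, where $r\in\pi(n)$, $s\in\pi(n)\cap\pi(\mathrm{ord}_r(\alpha))$ and $(\mathrm{ord}_r(\alpha),\mathrm{ord}_s(\alpha))=1$; 4. $H_4=\langle aw^r,w^{4r}\rangle$, where $r\in\pi(n)\setminus\{2\}$, provided $4$ divides $n$ and $\alpha\equiv-1\pmod 4$; 5. $H_5=\langle a^2,w^4\rangle$, provided $4$ divides $n$ and $\alpha\equiv-1\pmod 4$; 6. $H_6=\langle aw,w^8\rangle$, provided $8$ divides $n$ and $\alpha\equiv-1\pmod 8$. All the subgroups in (1)--(6) are second maximal relatively closed subgroups of $G$. Their orbit lengths are as follows: - $\Omega(H_1)=\Omega(H_3)=\left\{\!\!\left\{\frac nr,\ \frac{s(r-1)}{\mathrm{ord}_r(\alpha)}\times\frac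 nr\cdot\frac{\mathrm{ord}_r(\alpha)}{s}\right\}\!\!\right\}$; - $\Omega(H_2)=\left\{\!\!\left\{\frac n{r^2},\ \frac{r-1}{\mathrm{ord}_r(\alpha)}\times\frac n{r^2}\mathrm{ord}_r(\alpha),\ \frac{r(r-1)}{\mathrm{ord}_{r^2}(\alpha)}\times\frac n{r^2}\mathrm{ord}_{r^2}(\alpha)\right\}\!\!\right\}$ if $s=r$; - $\Omega(H_2)=\left\{\!\!\left\{\frac n{sr},\ \frac{r-1}{\mathrm{ord}_r(\alpha)}\times\frac n{sr}\mathrm{ord}_r(\alpha),\ \frac{s-1}{\mathrm{ord}_s(\alpha)}\times\frac n{sr}\mathrm{ord}_s(\alpha),\ \frac{(s-1)(r-1)}{\mathrm{ord}_{sr}(\alpha)}\times\frac n{sr}\mathrm{ord}_{sr}(\alpha)\right\}\!\!\right\}$ if $s\ne r$; - $\Omega(H_4)=\left\{\!\!\left\{2\times\frac n{2r},\ \frac{2(r-1)(2,\mathrm{ord}_r(\alpha))}{\mathrm{ord}_r(\alpha)}\times\frac n{2r}\cdot\frac{\mathrm{ord}_r(\alpha)}{(2,\mathrm{ord}_r(\alpha))}\right\}\!\!\right\}$;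 - $\Omega(H_5)=\Omega(H_6)=\left\{\!\!\left\{4\times\frac n4\right\}\!\!\right\}$. -/

import Mathlib

open Equiv MulAction

noncomputable section

/-- A permutation group is regular: for any two points exactly one of its elements maps the first
to the second. -/
def IsRegularGroup {Ω : Type*} (W : Subgroup (Perm Ω)) : Prop :=
  ∀ p q : Ω, ∃! g : Perm Ω, g ∈ W ∧ g p = q

/-- The set of orbits of a permutation group. -/
def orbitSets {Ω : Type*} (H : Subgroup (Perm Ω)) : Set (Set Ω) :=
  Set.range (fun p : Ω => orbit H p)

/-- The multiset of the lengths of the orbits of a permutation group on a finite set. -/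
def orbitLengths {Ω : Type*} [Finite Ω] (H : Subgroup (Perm Ω)) : Multiset ℕ :=
  (Set.toFinite (orbitSets H)).toFinset.val.map Set.ncard

/-- `H` is relatively closed in `G`: it is the largest subgroup of `G` having the orbits of `H`. -/
def IsRelClosed {Ω : Type*} (G H : Subgroup (Perm Ω)) : Prop :=
  IsGreatest {K : Subgroup (Perm Ω) | K ≤ G ∧ orbitSets K = orbitSets H} H

/-- `M` is maximal among the relatively closed subgroups of `G` properly contained in `L`. -/
def IsMaximalRelClosedIn {Ω : Type*} (G L M : Subgroup (Perm Ω)) : Prop :=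
  Maximal (fun K : Subgroup (Perm Ω) => IsRelClosed G K ∧ K < L) M

/-- `H` is a second maximal relatively closed subgroup of `G`: a maximal relatively closed subgroup
of a maximal (proper) relatively closed subgroup of `G`. -/
def IsSecondMaximalRelClosed {Ω : Type*} (G H : Subgroup (Perm Ω)) : Prop :=
  ∃ M : Subgroup (Perm Ω), IsMaximalRelClosedIn G G M ∧ IsMaximalRelClosedIn G M H

/-- The holomorph of a regular permutation group `W` as a group of permutations of `Ω`: the points
of `Ω` are identified with the elements of `W` by `v ↦ v ω`, and the elements of the holomorph are
the maps `v ↦ u * φ v` with `u` in `W` and `φ` an automorphism of `W`. -/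
def holomorph {Ω : Type*} (W : Subgroup (Perm Ω)) (ω : Ω) : Subgroup (Perm Ω) where
  carrier := {g | ∃ (φ : W ≃* W) (u : W), ∀ v : W,
    g ((v : Perm Ω) ω) = ((u * φ v : W) : Perm Ω) ω}
  one_mem' := ⟨MulEquiv.refl W, 1, fun v => by simp⟩
  mul_mem' := by
    rintro g h ⟨φ, u, hg⟩ ⟨ψ, t, hh⟩
    refine ⟨ψ.trans φ, u * φ t, fun v => ?_⟩
    rw [Perm.mul_apply, hh, hg]
    simp [mul_assoc]
  inv_mem' := by
    rintro g ⟨φ, u, hg⟩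
    refine ⟨φ.symm, φ.symm u⁻¹, fun v => ?_⟩
    rw [Perm.inv_eq_iff_eq, hg]
    simp

/-- `H` and `K` are conjugate by an element of `N`. -/
def AreConjugateIn {Ω : Type*} (N H K : Subgroup (Perm Ω)) : Prop :=
  ∃ g ∈ N, H.map (MulAut.conj g).toMonoidHom = K

/-- The multiplicative order of the integer `α` modulo `m` (used for `α` coprime to `m`). -/
def ordMod (m : ℕ) (α : ℤ) : ℕ := orderOf (α : ZMod m)

/-- Names of the members of the six families of subgroups, with their parameters `s` and `r`. -/
inductive FamilyMember where
  | fam1 (s r : ℕ)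
  | fam2 (s r : ℕ)
  | fam3 (s r : ℕ)
  | fam4 (r : ℕ)
  | fam5
  | fam6

namespace FamilyMember

/-- The conditions under which a member of a family is defined. -/
def Valid (n : ℕ) (α : ℤ) : FamilyMember → Prop
  | fam1 s r => r.Prime ∧ r ∣ n ∧ s.Prime ∧ s ∣ ordMod r α
  | fam2 s r => s.Prime ∧ s ∣ n ∧ r.Prime ∧ r ∣ n ∧ s * r ∣ n
  | fam3 s r => r.Prime ∧ r ∣ n ∧ s.Prime ∧ s ∣ n ∧ s ∣ ordMod r α ∧
      (ordMod r α).Coprime (ordMod s α)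
  | fam4 r => r.Prime ∧ r ∣ n ∧ r ≠ 2 ∧ 4 ∣ n ∧ α ≡ -1 [ZMOD 4]
  | fam5 => 4 ∣ n ∧ α ≡ -1 [ZMOD 4]
  | fam6 => 8 ∣ n ∧ α ≡ -1 [ZMOD 8]

/-- The pair `s, r` of the second family is unordered; this picks one order for it. -/
def Ordered : FamilyMember → Prop
  | fam2 s r => s ≤ r
  | _ => True

/-- The subgroups. Permutations act on the left here, so the permutation that first applies `a`
and then multiplies by `w ^ r`, which for right actions is written `a w ^ r`, is `w ^ r * a`. -/
def subgroup {Ω : Type*} (a w : Perm Ω) (α : ℤ) : FamilyMember → Subgroup (Perm Ω)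
  | fam1 s r => Subgroup.closure {a ^ s, w ^ r}
  | fam2 s r => Subgroup.closure {a, w ^ (s * r)}
  | fam3 s r => Subgroup.closure {w ^ r * a ^ ordMod s α, w ^ (s * r)}
  | fam4 r => Subgroup.closure {w ^ r * a, w ^ (4 * r)}
  | fam5 => Subgroup.closure {a ^ 2, w ^ 4}
  | fam6 => Subgroup.closure {w * a, w ^ 8}

/-- The asserted multisets of orbit lengths. Under `Valid`, with `α` coprime to `n`, all the
divisions of natural numbers below are exact. -/
def lengths (n : ℕ) (α : ℤ) : FamilyMember → Multiset ℕ
  | fam1 s r | fam3 s r =>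
      {n / r} + Multiset.replicate (s * (r - 1) / ordMod r α) (n / r * (ordMod r α / s))
  | fam2 s r =>
      if s = r then
        {n / r ^ 2} +
        Multiset.replicate ((r - 1) / ordMod r α) (n / r ^ 2 * ordMod r α) +
        Multiset.replicate (r * (r - 1) / ordMod (r ^ 2) α) (n / r ^ 2 * ordMod (r ^ 2) α)
      else
        {n / (s * r)} +
        Multiset.replicate ((r - 1) / ordMod r α) (n / (s * r) * ordMod r α) +
        Multiset.replicate ((s - 1) / ordMod s α) (n / (s * r) * ordMod s α) +
        Multiset.replicate ((s - 1) * (r - 1) / ordMod (s * r) α)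
          (n / (s * r) * ordMod (s * r) α)
  | fam4 r =>
      Multiset.replicate 2 (n / (2 * r)) +
      Multiset.replicate (2 * (r - 1) * Nat.gcd 2 (ordMod r α) / ordMod r α)
        (n / (2 * r) * (ordMod r α / Nat.gcd 2 (ordMod r α)))
  | fam5 | fam6 => Multiset.replicate 4 (n / 4)

end FamilyMember

end

/-! Identify `Ω` with ℤ/n through `x ↦ (w ^ x) ω`. Then `w` is x ↦ x + 1, `a` is x ↦ αx, G consists
of maps x ↦ α^t x + j, and the holomorph consists of all maps x ↦ ux + b with u a unit. Every
subgroup of G is ⟨w^c a^i, w^m⟩ with m ∣ n, and its orbits are the preimages of the orbits of the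
single map x ↦ α^i x + c on ℤ/m. The engine is the Hull–Dobell criterion (`exists_affIter_modEq`): x
↦ βx + c is one cycle on ℤ/d if every prime p ∣ d divides β − 1 but not c, and 4 ∣ d implies 4 ∣ β −
1.

A subgroup is relatively closed iff it contains every element of G that preserves each of its
orbits, so a proper closed subgroup is intransitive and violates Hull–Dobell. A violation at a prime
p gives a fixed residue class modulo p, hence containment in a conjugate of ⟨a, w^p⟩; a violation at
4 alone gives containment in a conjugate of ⟨wa, w^4⟩. These are the maximal closed subgroups M. One
level down, a closed subgroup properly inside M cannot have the orbits of M. A power of its affine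
generator that preserves the classes modulo r (or 4) acts on each class by an affine map again, and
every way in which Hull–Dobell can fail there puts the subgroup into a conjugate of a family member
below M (`liesInFamily_or_orbits_prime`, `liesInFamily_or_orbits_four`).

Conversely, the pair (m, i) is invariant under the holomorph (`hasIndices_conj`), and nested
subgroups with equal pairs coincide (`HasIndices.eq_of_le`). The pairs separate all members of the
families, except (2) from (3) when ord_s(α) = 1; there a fixed residue class modulo s decides. This
gives uniqueness, and also shows that nothing closed lies strictly between a member and a suitably
chosen M. Orbit lengths are n/m times the period of a point modulo m (`ncard_orbit`). -/

noncomputable section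

/-! ### Geometric sums and the Hull–Dobell criterion -/

/-- The sum `1 + β + ⋯ + β ^ (k - 1)`. -/
def geomSum (β : ℤ) (k : ℕ) : ℤ := ∑ l ∈ Finset.range k, β ^ l

@[simp] lemma geomSum_zero (β : ℤ) : geomSum β 0 = 0 := by simp [geomSum]

@[simp] lemma geomSum_one (β : ℤ) : geomSum β 1 = 1 := by simp [geomSum]

lemma geomSum_succ (β : ℤ) (k : ℕ) : geomSum β (k + 1) = geomSum β k + β ^ k :=
  Finset.sum_range_succ _ _

lemma sub_one_mul_geomSum (β : ℤ) (k : ℕ) : (β - 1) * geomSum β k = β ^ k - 1 :=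
  mul_geom_sum β k

lemma geomSum_add (β : ℤ) (k l : ℕ) : geomSum β (k + l) = geomSum β k + β ^ k * geomSum β l := by
  induction l with
  | zero => simp
  | succ l ih => rw [← add_assoc, geomSum_succ, ih, geomSum_succ]; ring

lemma geomSum_mul (β : ℤ) (k l : ℕ) :
    geomSum β (k * l) = geomSum β k * geomSum (β ^ k) l := by
  induction l with
  | zero => simp
  | succ l ih => rw [Nat.mul_succ, geomSum_add, ih, geomSum_succ]; ring

lemma geomSum_modEq {m β γ : ℤ} (h : β ≡ γ [ZMOD m]) (k : ℕ) :
    geomSum β k ≡ geomSum γ k [ZMOD m] := by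
  induction k with
  | zero => simp
  | succ k ih => rw [geomSum_succ, geomSum_succ]; exact ih.add (h.pow k)

lemma geomSum_one_left (k : ℕ) : geomSum 1 k = k := by simp [geomSum]

lemma geomSum_modEq_natCast {m β : ℤ} (h : m ∣ β - 1) (k : ℕ) :
    geomSum β k ≡ k [ZMOD m] := by
  simpa [geomSum_one_left] using geomSum_modEq (Int.modEq_iff_dvd.2 h).symm k

lemma geomSum_neg_one (k : ℕ) : geomSum (-1) k = (k % 2 : ℕ) := by
  induction k with
  | zero => simp
  | succ k ih =>
    rw [geomSum_succ, ih]
    rcases Nat.even_or_odd k with h | h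
    · rw [h.neg_one_pow]; have := Nat.even_iff.1 h; omega
    · rw [h.neg_one_pow]; have := Nat.odd_iff.1 h; omega

/-- The point is that the sum contains the prime p exactly once. With β = 1 + pb it is p + pb ·
p(p−1)/2 modulo p², and p divides (p−1)p/2 for odd p; for p = 2 the hypothesis 4 ∣ β − 1 replaces
this. -/
lemma exists_geomSum_prime_eq {p : ℕ} (hp : p.Prime) {β : ℤ} (hβ : (p : ℤ) ∣ β - 1)
    (h4 : p = 2 → (4 : ℤ) ∣ β - 1) : ∃ u : ℤ, geomSum β p = p * (1 + p * u) := by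
  obtain ⟨b, hb⟩ := hβ
  rcases hp.eq_two_or_odd' with rfl | hodd
  · obtain ⟨c, hc⟩ := h4 rfl
    refine ⟨c, ?_⟩
    simp [geomSum, Finset.sum_range_succ]; push_cast at *; linarith
  · have key : ∀ k : ℕ, ∃ v : ℤ, geomSum β k = k + p * b * (∑ i ∈ Finset.range k, (i : ℤ))
        + p ^ 2 * v := by
      have hpow : ∀ k : ℕ, ∃ v : ℤ, β ^ k = 1 + p * b * k + p ^ 2 * v := by
        intro k
        induction k with
        | zero => exact ⟨0, by simp⟩
        | succ k ih =>
          obtain ⟨v, hv⟩ := ih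
          refine ⟨v + v * p * b + b ^ 2 * k, ?_⟩
          rw [pow_succ, hv, show β = 1 + p * b by linarith]; push_cast; ring
      intro k
      induction k with
      | zero => exact ⟨0, by simp⟩
      | succ k ih =>
        obtain ⟨v, hv⟩ := ih
        obtain ⟨v', hv'⟩ := hpow k
        refine ⟨v + v', ?_⟩
        rw [geomSum_succ, hv, hv', Finset.sum_range_succ]; push_cast; ring
    obtain ⟨v, hv⟩ := key p
    obtain ⟨q, hq⟩ := hodd
    have hs : (∑ i ∈ Finset.range p, (i : ℤ)) = p * q := by
      have h := Finset.sum_range_id_mul_two p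
      have h' : (∑ i ∈ Finset.range p, (i : ℤ)) * 2 = p * (p - 1) := by
        have h2 : ((∑ i ∈ Finset.range p, i : ℕ) : ℤ) * 2 = ((p * (p - 1) : ℕ) : ℤ) := by
          rw [← h]; push_cast; ring
        rw [Nat.cast_mul, Nat.cast_sub hp.one_le] at h2
        push_cast at h2; exact h2
      have h3 : (p : ℤ) - 1 = 2 * q := by rw [hq]; push_cast; ring
      rw [h3] at h'; linarith
    refine ⟨b * q + v, ?_⟩
    rw [hv, hs]; ring

/-- The period of the sums `1 + β + ⋯ + β ^ (k - 1)` modulo `d`. -/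
lemma dvd_of_dvd_geomSum (d : ℕ) : ∀ (β : ℤ) (k : ℕ), 0 < d →
    (∀ p : ℕ, p.Prime → p ∣ d → (p : ℤ) ∣ β - 1) → (4 ∣ d → (4 : ℤ) ∣ β - 1) →
    (d : ℤ) ∣ geomSum β k → d ∣ k := by
  induction d using Nat.strong_induction_on with
  | _ d ih =>
    intro β k hd hp h4 hk
    by_cases h1 : d = 1
    · simp [h1]
    obtain ⟨p, pp, d', rfl⟩ := Nat.exists_prime_and_dvd h1
    have hpk : p ∣ k := by
      have h := geomSum_modEq_natCast (hp p pp (dvd_mul_right _ _)) k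
      have h2 : (p : ℤ) ∣ geomSum β k := dvd_trans (by push_cast; exact dvd_mul_right _ _) hk
      exact Int.natCast_dvd_natCast.1 ((Int.ModEq.dvd_iff h).1 h2)
    obtain ⟨k', rfl⟩ := hpk
    have hd' : 0 < d' := Nat.pos_of_mul_pos_left hd
    apply mul_dvd_mul_left
    have hsub : β - 1 ∣ β ^ p - 1 := sub_one_dvd_pow_sub_one β p
    refine ih d' (by nlinarith [pp.two_le]) (β ^ p) k' hd'
      (fun q hq hqd => (hp q hq (hqd.mul_left p)).trans hsub)
      (fun h => (h4 (h.mul_left p)).trans hsub) ?_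
    rw [geomSum_mul] at hk
    -- The factor `geomSum β p` of the sum uses up exactly one p and is otherwise prime to d': for a
    -- prime q ≠ p dividing d' it is ≡ p modulo q. The induction then runs on d' with β^p.
    have hcop : ∃ v : ℤ, geomSum β p = p * v ∧ IsCoprime (d' : ℤ) v := by
      have hpβ := hp p pp (dvd_mul_right _ _)
      have hdv : (p : ℤ) ∣ geomSum β p :=
        (Int.ModEq.dvd_iff (geomSum_modEq_natCast hpβ p)).2 dvd_rfl
      obtain ⟨v, hv⟩ := hdv
      refine ⟨v, hv, ?_⟩
      rw [Int.isCoprime_iff_gcd_eq_one]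
      by_contra hne
      obtain ⟨q, hq, hqg⟩ := Nat.exists_prime_and_dvd hne
      have hqd : q ∣ d' := by
        have := (Int.natCast_dvd_natCast.2 hqg).trans (Int.gcd_dvd_left _ _)
        exact Int.natCast_dvd_natCast.1 this
      have hqv : (q : ℤ) ∣ v := (Int.natCast_dvd_natCast.2 hqg).trans (Int.gcd_dvd_right _ _)
      have hqβ := hp q hq (hqd.mul_left p)
      by_cases hqp : q = p
      · subst hqp
        obtain ⟨u, hu⟩ := exists_geomSum_prime_eq hq hqβ (fun h2 => by
          subst h2; exact h4 (mul_dvd_mul_left 2 hqd))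
        have hq0 : (q : ℤ) ≠ 0 := by exact_mod_cast hq.ne_zero
        have hv2 : v = 1 + q * u := mul_left_cancel₀ hq0 (hv.symm.trans hu)
        have : (q : ℤ) ∣ 1 := by
          have := dvd_sub hqv (dvd_mul_right (q : ℤ) u)
          rwa [hv2, add_sub_cancel_right] at this
        exact hq.one_lt.ne' (by exact_mod_cast Int.eq_one_of_dvd_one (by positivity) this)
      · have h := (Int.ModEq.dvd_iff (geomSum_modEq_natCast hqβ p)).1
          (hv ▸ hqv.mul_left _)
        exact hqp ((Nat.prime_dvd_prime_iff_eq hq pp).1 (Int.natCast_dvd_natCast.1 h))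
    obtain ⟨v, hv, hco⟩ := hcop
    rw [hv, mul_assoc] at hk
    push_cast at hk
    have hp0 : (p : ℤ) ≠ 0 := by exact_mod_cast pp.ne_zero
    exact hco.dvd_of_dvd_mul_left ((mul_dvd_mul_iff_left hp0).1 hk)

/-- The `k`-th iterate of `x ↦ β x + c`. -/
def affIter (β c : ℤ) (k : ℕ) (x : ℤ) : ℤ := β ^ k * x + c * geomSum β k

/-- The displacement after k steps is the first displacement times a geometric sum, so transitivity
reduces to the values of `geomSum`. -/
lemma affIter_eq (β c : ℤ) (k : ℕ) (x : ℤ) :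
    affIter β c k x = x + ((β - 1) * x + c) * geomSum β k := by
  have := sub_one_mul_geomSum β k
  rw [affIter]; linear_combination -x * this

lemma affIter_add (β c : ℤ) (k l : ℕ) (x : ℤ) :
    affIter β c (k + l) x = affIter β c k (affIter β c l x) := by
  simp only [affIter, add_comm k l, geomSum_add]
  have h1 := sub_one_mul_geomSum β k
  have h2 := sub_one_mul_geomSum β l
  linear_combination c * geomSum β l * h1 - c * geomSum β k * h2

/-- The Hull–Dobell criterion. -/
lemma exists_affIter_modEq {d : ℕ} (hd : 0 < d) {β c : ℤ}
    (hβ : ∀ p : ℕ, p.Prime → p ∣ d → (p : ℤ) ∣ β - 1 ∧ ¬ (p : ℤ) ∣ c)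
    (h4 : 4 ∣ d → (4 : ℤ) ∣ β - 1) (x y : ℤ) : ∃ t, affIter β c t x ≡ y [ZMOD d] := by
  have : NeZero d := ⟨hd.ne'⟩
  have cop : ∀ z : ℤ, (∀ p : ℕ, p.Prime → p ∣ d → ¬ (p : ℤ) ∣ z) → IsCoprime (d : ℤ) z := by
    intro z hz
    rw [Int.isCoprime_iff_gcd_eq_one]
    by_contra hne
    obtain ⟨q, hq, hqg⟩ := Nat.exists_prime_and_dvd hne
    refine hz q hq ?_ ((Int.natCast_dvd_natCast.2 hqg).trans (Int.gcd_dvd_right _ _))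
    exact Int.natCast_dvd_natCast.1 ((Int.natCast_dvd_natCast.2 hqg).trans (Int.gcd_dvd_left _ _))
  have hβd : IsCoprime (d : ℤ) β := by
    refine cop β fun p hp hpd h => ?_
    have := (dvd_sub_right h).1 (hβ p hp hpd).1
    exact hp.one_lt.ne' (by exact_mod_cast Int.eq_one_of_dvd_one (by positivity) this)
  -- The first displacement is a unit modulo d; its inverse v below turns the target y into the
  -- value v(y − x) for the geometric sum.
  have hc : IsCoprime (d : ℤ) ((β - 1) * x + c) := by
    refine cop _ fun p hp hpd h => (hβ p hp hpd).2 ?_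
    exact (dvd_add_right ((hβ p hp hpd).1.mul_right x)).1 h
  have aux : ∀ s t : ℕ, s < t → t < d → ¬ geomSum β s ≡ geomSum β t [ZMOD d] := by
    intro s t hst htd h
    obtain ⟨l, rfl⟩ := Nat.exists_eq_add_of_lt hst
    rw [add_assoc, geomSum_add] at h
    have h := Int.modEq_iff_dvd.1 h
    rw [add_sub_cancel_left] at h
    have h := (hβd.pow_right (n := s)).dvd_of_dvd_mul_left h
    have h := dvd_of_dvd_geomSum d β (l + 1) hd (fun p hp hpd => (hβ p hp hpd).1) h4 h
    have := Nat.le_of_dvd (by omega) h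
    omega
  -- The sums have period d, so the first d of them are distinct and exhaust ℤ/d by counting.
  have inj : Function.Injective (fun t : Fin d => ((geomSum β t : ℤ) : ZMod d)) := by
    intro s t hst
    have hst : geomSum β s ≡ geomSum β t [ZMOD d] := (ZMod.intCast_eq_intCast_iff _ _ _).1 hst
    rcases lt_trichotomy (s : ℕ) t with h | h | h
    · exact absurd hst (aux s t h t.2)
    · exact Fin.ext h
    · exact absurd hst.symm (aux t s h s.2)
  have bij := (Fintype.bijective_iff_injective_and_card _).2 ⟨inj, by simp [ZMod.card]⟩
  obtain ⟨u, v, huv⟩ := hc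
  obtain ⟨t, ht⟩ := bij.2 ((v * (y - x) : ℤ) : ZMod d)
  refine ⟨t, ?_⟩
  have ht : geomSum β t ≡ v * (y - x) [ZMOD d] := (ZMod.intCast_eq_intCast_iff _ _ _).1 ht
  rw [affIter_eq]
  have h1 := (ht.mul_left ((β - 1) * x + c)).add_left x
  refine h1.trans (Int.modEq_iff_dvd.2 ⟨u * (y - x), ?_⟩)
  linear_combination (-(y - x)) * huv

/-! ### Affine coordinates and the subgroups of ⟨a, w⟩ -/

/-- The subgroup generated by `w ^ c * a ^ i` and `w ^ m`. -/
def metaSub {Ω : Type*} (a w : Perm Ω) (i : ℕ) (c : ℤ) (m : ℕ) : Subgroup (Perm Ω) :=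
  Subgroup.closure {w ^ c * a ^ i, w ^ m}

/-- The permutation `w` acts on `Ω` as a cycle of length `n`, and `a` as multiplication by `α`,
where `w ^ x` applied to `ω` has the coordinate `x`. -/
structure AffineFrame {Ω : Type*} (a w : Perm Ω) (ω : Ω) (n : ℕ) (α : ℤ) : Prop where
  pos : 0 < n
  surj : ∀ p, ∃ x : ℤ, (w ^ x) ω = p
  inj : ∀ x y : ℤ, (w ^ x) ω = (w ^ y) ω ↔ x ≡ y [ZMOD n]
  fix : a ω = ω
  comm : a * w = w ^ α * a
  cop : IsCoprime α n

/-- The permutation `g` is `x ↦ u x + b` in coordinates. -/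
def IsAffineMap {Ω : Type*} (w : Perm Ω) (ω : Ω) (g : Perm Ω) (u b : ℤ) : Prop :=
  ∀ x : ℤ, g ((w ^ x) ω) = (w ^ (u * x + b)) ω

namespace AffineFrame

variable {Ω : Type*} {a w : Perm Ω} {ω : Ω} {n : ℕ} {α : ℤ}

lemma pow_mul_zpow (F : AffineFrame a w ω n α) (t : ℕ) (j : ℤ) :
    a ^ t * w ^ j = w ^ (α ^ t * j) * a ^ t := by
  have h1 : ∀ j : ℤ, a * w ^ j = w ^ (α * j) * a := by
    intro j
    have h : a * w * a⁻¹ = w ^ α := by rw [F.comm]; group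
    have h2 : (a * w * a⁻¹) ^ j = a * w ^ j * a⁻¹ := conj_zpow
    rw [zpow_mul, ← h, h2]; group
  induction t generalizing j with
  | zero => simp
  | succ t ih =>
    rw [pow_succ, mul_assoc, h1, ← mul_assoc, ih, mul_assoc]
    congr 2; ring

lemma mul_apply (F : AffineFrame a w ω n α) (t : ℕ) (j x : ℤ) :
    (w ^ j * a ^ t) ((w ^ x) ω) = (w ^ (α ^ t * x + j)) ω := by
  have hfix : ∀ t : ℕ, (a ^ t) ω = ω := by
    intro t
    induction t with
    | zero => simp
    | succ t ih => rw [pow_succ, Perm.mul_apply, F.fix, ih]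
  rw [← Perm.mul_apply, mul_assoc, F.pow_mul_zpow, ← mul_assoc, Perm.mul_apply, hfix, ← zpow_add,
    add_comm]

lemma mul_eq (F : AffineFrame a w ω n α) (t t' : ℕ) (j j' : ℤ) :
    (w ^ j * a ^ t) * (w ^ j' * a ^ t') = w ^ (α ^ t * j' + j) * a ^ (t + t') := by
  rw [mul_assoc, ← mul_assoc (a ^ t), F.pow_mul_zpow, pow_add, add_comm, zpow_add]
  simp only [mul_assoc]

lemma pow_eq (F : AffineFrame a w ω n α) (i : ℕ) (c : ℤ) (k : ℕ) :
    (w ^ c * a ^ i) ^ k = w ^ (c * geomSum (α ^ i) k) * a ^ (i * k) := by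
  induction k with
  | zero => simp
  | succ k ih =>
    rw [pow_succ, ih, F.mul_eq, geomSum_succ]
    congr 2
    rw [← pow_mul]; ring

lemma ext_apply (F : AffineFrame a w ω n α) {g h : Perm Ω}
    (hgh : ∀ x : ℤ, g ((w ^ x) ω) = h ((w ^ x) ω)) : g = h := by
  ext p
  obtain ⟨x, rfl⟩ := F.surj p
  exact hgh x

lemma mul_eq_mul_iff (F : AffineFrame a w ω n α) (t t' : ℕ) (j j' : ℤ) :
    w ^ j * a ^ t = w ^ j' * a ^ t' ↔ j ≡ j' [ZMOD n] ∧ α ^ t ≡ α ^ t' [ZMOD n] := by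
  constructor
  · intro h
    have key : ∀ x : ℤ, α ^ t * x + j ≡ α ^ t' * x + j' [ZMOD n] := fun x => by
      rw [← F.inj, ← F.mul_apply, ← F.mul_apply, h]
    have h0 : j ≡ j' [ZMOD n] := by simpa using key 0
    refine ⟨h0, ?_⟩
    have h1 := key 1
    rw [mul_one, mul_one] at h1
    exact h0.add_right_cancel h1
  · rintro ⟨h1, h2⟩
    refine F.ext_apply fun x => ?_
    rw [F.mul_apply, F.mul_apply, F.inj]
    exact (h2.mul_right x).add h1

lemma mem_metaSub_iff_exists [Finite Ω] (F : AffineFrame a w ω n α) {i : ℕ} {c : ℤ} {m : ℕ}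
    {g : Perm Ω} : g ∈ metaSub a w i c m ↔
      ∃ (l : ℤ) (k : ℕ), g = w ^ (m * l + c * geomSum (α ^ i) k) * a ^ (i * k) := by
  constructor
  · intro hg
    -- In a finite group the generators generate as a monoid, so no inverses arise and k can be a
    -- natural number.
    rw [metaSub, ← Subgroup.mem_toSubmonoid, Subgroup.closure_toSubmonoid_of_finite] at hg
    induction hg using Submonoid.closure_induction with
    | mem x hx =>
      rcases hx with rfl | rfl
      · exact ⟨0, 1, by simp⟩
      · exact ⟨1, 0, by simp⟩
    | one => exact ⟨0, 0, by simp⟩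
    | mul x y _ _ hx hy =>
      obtain ⟨l, k, rfl⟩ := hx
      obtain ⟨l', k', rfl⟩ := hy
      refine ⟨l + α ^ (i * k) * l', k + k', ?_⟩
      rw [F.mul_eq, geomSum_add, ← pow_mul]
      congr 2 <;> ring
  · rintro ⟨l, k, rfl⟩
    rw [zpow_add, mul_assoc, ← F.pow_eq, zpow_mul]
    refine mul_mem (zpow_mem (Subgroup.subset_closure ?_) _)
      (pow_mem (Subgroup.subset_closure ?_) _) <;> simp

lemma mem_metaSub [Finite Ω] (F : AffineFrame a w ω n α) {i : ℕ} {c : ℤ} {m : ℕ} (hm : m ∣ n)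
    {j : ℤ} {t : ℕ} : w ^ j * a ^ t ∈ metaSub a w i c m ↔
      ∃ k : ℕ, α ^ t ≡ α ^ (i * k) [ZMOD n] ∧ j ≡ c * geomSum (α ^ i) k [ZMOD m] := by
  rw [F.mem_metaSub_iff_exists]
  constructor
  · rintro ⟨l, k, h⟩
    obtain ⟨h1, h2⟩ := (F.mul_eq_mul_iff _ _ _ _).1 h
    refine ⟨k, h2, (h1.of_dvd (Int.natCast_dvd_natCast.2 hm)).trans ?_⟩
    exact Int.modEq_iff_dvd.2 ⟨-l, by ring⟩
  · rintro ⟨k, h1, h2⟩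
    obtain ⟨l, hl⟩ := Int.modEq_iff_dvd.1 h2
    refine ⟨-l, k, (F.mul_eq_mul_iff _ _ _ _).2 ⟨?_, h1⟩⟩
    rw [show j = m * -l + c * geomSum (α ^ i) k by linear_combination -hl]

lemma closure_eq (a w : Perm Ω) : Subgroup.closure {a, w} = metaSub a w 1 0 1 := by
  simp [metaSub]

lemma mem_closure_iff [Finite Ω] (F : AffineFrame a w ω n α) {g : Perm Ω} :
    g ∈ Subgroup.closure {a, w} ↔ ∃ (j : ℤ) (t : ℕ), g = w ^ j * a ^ t := by
  rw [closure_eq, F.mem_metaSub_iff_exists]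
  constructor
  · rintro ⟨l, k, rfl⟩; exact ⟨_, _, rfl⟩
  · rintro ⟨j, t, rfl⟩; exact ⟨j, t, by simp⟩

lemma zpow_mul_pow_mem (a w : Perm Ω) (j : ℤ) (t : ℕ) : w ^ j * a ^ t ∈ Subgroup.closure {a, w} :=
  mul_mem (zpow_mem (Subgroup.subset_closure (by simp)) _)
    (pow_mem (Subgroup.subset_closure (by simp)) _)

lemma metaSub_le_closure (a w : Perm Ω) (i : ℕ) (c : ℤ) (m : ℕ) :
    metaSub a w i c m ≤ Subgroup.closure {a, w} := by
  rw [metaSub, Subgroup.closure_le]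
  rintro x (rfl | rfl)
  · exact zpow_mul_pow_mem a w c i
  · exact pow_mem (Subgroup.subset_closure (by simp)) _

/-- A subgroup of `⟨a, w⟩` is determined by what it contains among the `w ^ j * a ^ t`. -/
lemma le_of_forall [Finite Ω] (F : AffineFrame a w ω n α) {H K : Subgroup (Perm Ω)}
    (hH : H ≤ Subgroup.closure {a, w})
    (h : ∀ (j : ℤ) (t : ℕ), w ^ j * a ^ t ∈ H → w ^ j * a ^ t ∈ K) : H ≤ K := by
  intro g hg
  obtain ⟨j, t, rfl⟩ := F.mem_closure_iff.1 (hH hg)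
  exact h j t hg

lemma metaSub_le_metaSub [Finite Ω] (F : AffineFrame a w ω n α) {i i' : ℕ} {c c' : ℤ} {m m' : ℕ}
    (hm : m' ∣ m) (hn : m ∣ n) (k : ℕ) (hi : i = i' * k)
    (hc : c ≡ c' * geomSum (α ^ i') k [ZMOD m']) : metaSub a w i c m ≤ metaSub a w i' c' m' := by
  rw [metaSub, Subgroup.closure_le]
  rintro x (rfl | rfl)
  · exact (F.mem_metaSub (hm.trans hn)).2 ⟨k, by rw [hi], hc⟩
  · obtain ⟨q, rfl⟩ := hm
    rw [pow_mul]
    exact pow_mem (Subgroup.subset_closure (by simp)) _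

/-- Translations by m lie in the subgroup, so its orbits are unions of classes modulo m, and modulo
m only the iterates of the other generator act. -/
lemma orbit_metaSub [Finite Ω] (F : AffineFrame a w ω n α) {i : ℕ} {c : ℤ} {m : ℕ} (hm : m ∣ n)
    {x y : ℤ} : (w ^ y) ω ∈ orbit (metaSub a w i c m) ((w ^ x) ω) ↔
      ∃ k, y ≡ affIter (α ^ i) c k x [ZMOD m] := by
  constructor
  · rintro ⟨⟨g, hg⟩, h⟩
    obtain ⟨l, k, rfl⟩ := F.mem_metaSub_iff_exists.1 hg
    refine ⟨k, ?_⟩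
    have h : (w ^ (m * l + c * geomSum (α ^ i) k) * a ^ (i * k)) ((w ^ x) ω) = (w ^ y) ω := h
    rw [F.mul_apply, F.inj] at h
    have h := (h.symm.of_dvd (Int.natCast_dvd_natCast.2 hm))
    refine h.trans (Int.modEq_iff_dvd.2 ⟨-l, ?_⟩)
    rw [affIter, pow_mul]; ring
  · rintro ⟨k, hk⟩
    obtain ⟨l, hl⟩ := Int.modEq_iff_dvd.1 hk
    refine ⟨⟨_, F.mem_metaSub_iff_exists.2 ⟨-l, k, rfl⟩⟩, ?_⟩
    change (w ^ (m * -l + c * geomSum (α ^ i) k) * a ^ (i * k)) ((w ^ x) ω) = (w ^ y) ω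
    rw [F.mul_apply, pow_mul]
    congr 2
    rw [affIter] at hl; linear_combination hl

lemma zpow_eq_one_iff (F : AffineFrame a w ω n α) (j : ℤ) : w ^ j = 1 ↔ (n : ℤ) ∣ j := by
  have := F.mul_eq_mul_iff 0 0 j 0
  simp only [pow_zero, mul_one, zpow_zero] at this
  rw [this, and_iff_left (Int.ModEq.refl 1), Int.modEq_zero_iff_dvd]

/-- Every subgroup of `⟨a, w⟩` has the form `⟨w ^ c * a ^ i, w ^ m⟩`. -/
lemma exists_eq_metaSub [Finite Ω] (F : AffineFrame a w ω n α) {H : Subgroup (Perm Ω)}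
    (hH : H ≤ Subgroup.closure {a, w}) :
    ∃ (i : ℕ) (c : ℤ) (m : ℕ), m ∣ n ∧ H = metaSub a w i c m := by
  let D : AddSubgroup ℤ :=
    { carrier := {j | w ^ j ∈ H}
      zero_mem' := by simp
      add_mem' := fun {x y} hx hy => by
        simp only [Set.mem_ofPred_eq, zpow_add] at *; exact mul_mem hx hy
      neg_mem' := fun {x} hx => by
        simp only [Set.mem_ofPred_eq, zpow_neg] at *; exact inv_mem hx }
  obtain ⟨d, hd⟩ := Int.subgroup_cyclic D
  have hD : ∀ j : ℤ, w ^ j ∈ H ↔ ((d.natAbs : ℕ) : ℤ) ∣ j := fun j => by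
    rw [Int.natAbs_dvd, ← Int.mem_zmultiples_iff, AddSubgroup.zmultiples_eq_closure, ← hd]; rfl
  -- The least such t becomes the exponent i; it exists because a has finite order.
  have hex : ∃ t : ℕ, 0 < t ∧ ∃ j : ℤ, w ^ j * a ^ t ∈ H :=
    ⟨orderOf a, orderOf_pos a, 0, by simp [pow_orderOf_eq_one]⟩
  classical
  obtain ⟨hpos, c, hc⟩ := Nat.find_spec hex
  set i := Nat.find hex with hi
  have hdvd : d.natAbs ∣ n := by
    rw [← Int.natCast_dvd_natCast, ← hD, (F.zpow_eq_one_iff n).2 dvd_rfl]; exact one_mem H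
  refine ⟨i, c, d.natAbs, hdvd, le_antisymm (F.le_of_forall hH fun j t hjt => ?_) ?_⟩
  · have hq := pow_mem hc (t / i)
    rw [F.pow_eq] at hq
    have heq : w ^ j * a ^ t * (w ^ (c * geomSum (α ^ i) (t / i)) * a ^ (i * (t / i)))⁻¹ =
        w ^ (j - α ^ (t % i) * (c * geomSum (α ^ i) (t / i))) * a ^ (t % i) := by
      rw [mul_inv_eq_iff_eq_mul, F.mul_eq, Nat.mod_add_div]
      congr 2; ring
    have hmem := mul_mem hjt (inv_mem hq)
    rw [heq] at hmem
    -- Division with remainder: a nonzero remainder would contradict the minimality of i.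
    have h0 : t % i = 0 := by
      by_contra h0
      exact Nat.find_min hex (Nat.mod_lt t hpos) ⟨Nat.pos_of_ne_zero h0, _, hmem⟩
    rw [h0, pow_zero, pow_zero, mul_one, hD, one_mul] at hmem
    refine (F.mem_metaSub hdvd).2 ⟨t / i, ?_, (Int.modEq_iff_dvd.2 hmem).symm⟩
    rw [Nat.mul_div_cancel' (Nat.dvd_of_mod_eq_zero h0)]
  · rw [metaSub, Subgroup.closure_le]
    rintro x (rfl | rfl)
    · exact hc
    · rw [← zpow_natCast]; exact (hD _).2 dvd_rfl

lemma zpow_mul_pow_conj (F : AffineFrame a w ω n α) {g : Perm Ω} {u b : ℤ}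
    (hg : IsAffineMap w ω g u b) (j : ℤ) (t : ℕ) :
    g * (w ^ j * a ^ t) * g⁻¹ = w ^ (u * j + b * (1 - α ^ t)) * a ^ t := by
  rw [mul_inv_eq_iff_eq_mul]
  refine F.ext_apply fun x => ?_
  rw [Perm.mul_apply, F.mul_apply, hg, Perm.mul_apply, hg, F.mul_apply]
  congr 2; ring

/-- Conjugation leaves i and m alone, since a unit power of w^m generates the same group. The
freedom in u and b is what later brings c to the normal forms of the families. -/
lemma metaSub_conj [Finite Ω] (F : AffineFrame a w ω n α) {g : Perm Ω} {u b : ℤ}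
    (hg : IsAffineMap w ω g u b) (hu : IsCoprime u n) (i : ℕ) (c : ℤ) {m : ℕ} :
    (metaSub a w i c m).map (MulAut.conj g).toMonoidHom =
      metaSub a w i (u * c + b * (1 - α ^ i)) m := by
  have h1 : (MulAut.conj g).toMonoidHom (w ^ c * a ^ i) =
      w ^ (u * c + b * (1 - α ^ i)) * a ^ i := F.zpow_mul_pow_conj hg c i
  have h2 : (MulAut.conj g).toMonoidHom (w ^ m) = (w ^ m) ^ u := by
    have := F.zpow_mul_pow_conj hg m 0
    simp only [pow_zero, mul_one, sub_self, mul_zero, add_zero] at this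
    rw [← zpow_natCast, ← zpow_mul, mul_comm (m : ℤ), ← this]; rfl
  rw [metaSub, MonoidHom.map_closure, Set.image_pair, h1, h2, metaSub]
  apply le_antisymm <;> rw [Subgroup.closure_le]
  · rintro x (rfl | rfl)
    · exact Subgroup.subset_closure (by simp)
    · exact zpow_mem (Subgroup.subset_closure (by simp)) _
  · rintro x (rfl | rfl)
    · exact Subgroup.subset_closure (by simp)
    · obtain ⟨v, z, hvz⟩ := hu
      have : w ^ m = ((w ^ m) ^ u) ^ v := by
        rw [← zpow_natCast, ← zpow_mul, ← zpow_mul, ← mul_inv_eq_one, ← zpow_neg, ← zpow_add,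
          F.zpow_eq_one_iff]
        exact ⟨m * z, by linear_combination -(m : ℤ) * hvz⟩
      have hmem := zpow_mem (Subgroup.subset_closure (Set.mem_insert_of_mem
        (w ^ (u * c + b * (1 - α ^ i)) * a ^ i) (Set.mem_singleton ((w ^ m) ^ u)))) v
      rwa [← this] at hmem

lemma isRegularGroup (F : AffineFrame a w ω n α) : IsRegularGroup (Subgroup.zpowers w) := by
  intro p q
  obtain ⟨x, rfl⟩ := F.surj p
  obtain ⟨y, rfl⟩ := F.surj q
  refine ⟨w ^ (y - x), ⟨⟨_, rfl⟩, ?_⟩, ?_⟩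
  · rw [← Perm.mul_apply, ← zpow_add, sub_add_cancel]
  · rintro g ⟨⟨z, rfl⟩, h⟩
    dsimp only at h ⊢
    rw [← Perm.mul_apply, ← zpow_add, F.inj] at h
    rw [← mul_inv_eq_one, ← zpow_neg, ← zpow_add, F.zpow_eq_one_iff]
    obtain ⟨k, hk⟩ := Int.modEq_iff_dvd.1 h
    exact ⟨-k, by linear_combination -hk⟩

lemma exists_isAffineMap_of_mem_holomorph (F : AffineFrame a w ω n α) {g : Perm Ω}
    (hg : g ∈ holomorph (Subgroup.zpowers w) ω) :
    ∃ u b : ℤ, IsCoprime u n ∧ IsAffineMap w ω g u b := by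
  obtain ⟨φ, ⟨v, b, rfl⟩, h⟩ := hg
  let w' : Subgroup.zpowers w := ⟨w, Subgroup.mem_zpowers w⟩
  obtain ⟨u, hu⟩ := (φ w').2
  obtain ⟨u', hu'⟩ := (φ.symm w').2
  have hu1 : φ w' = w' ^ u := Subtype.ext (by rw [← hu]; rfl)
  have hu2 : φ.symm w' = w' ^ u' := Subtype.ext (by rw [← hu']; rfl)
  refine ⟨u, b, ?_, fun x => ?_⟩
  · have h1 : w' = w' ^ (u * u') := by
      conv_lhs => rw [← φ.apply_symm_apply w', hu2, map_zpow, hu1, ← zpow_mul]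
    have h2 : w ^ (u * u' - 1) = 1 := by
      have h3 := congrArg Subtype.val h1
      have h4 : w = w ^ (u * u') := h3
      rw [zpow_sub, ← h4]; simp
    obtain ⟨z, hz⟩ := (F.zpow_eq_one_iff _).1 h2
    exact ⟨u', -z, by linear_combination hz⟩
  · have h1 := h (w' ^ x)
    have h2 : φ (w' ^ x) = w' ^ (u * x) := by rw [map_zpow, hu1, zpow_mul]
    rw [h2] at h1
    have h3 : ((⟨w ^ b, ⟨b, rfl⟩⟩ * w' ^ (u * x) : Subgroup.zpowers w) : Perm Ω) =
        w ^ (u * x + b) := by rw [add_comm, zpow_add]; rfl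
    rw [← h3]; exact h1

lemma exists_mem_holomorph (F : AffineFrame a w ω n α) {u : ℤ} (hu : IsCoprime u n) (b : ℤ) :
    ∃ g ∈ holomorph (Subgroup.zpowers w) ω, IsAffineMap w ω g u b := by
  obtain ⟨v, z, hvz⟩ := hu
  let φ : Subgroup.zpowers w ≃* Subgroup.zpowers w :=
    { toFun := fun x => x ^ u
      invFun := fun x => x ^ v
      left_inv := by
        rintro ⟨_, x, rfl⟩
        apply Subtype.ext
        change ((w ^ x) ^ u) ^ v = w ^ x
        rw [← zpow_mul, ← zpow_mul, ← mul_inv_eq_one, ← zpow_neg, ← zpow_add, F.zpow_eq_one_iff]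
        exact ⟨-(x * z), by linear_combination x * hvz⟩
      right_inv := by
        rintro ⟨_, x, rfl⟩
        apply Subtype.ext
        change ((w ^ x) ^ v) ^ u = w ^ x
        rw [← zpow_mul, ← zpow_mul, ← mul_inv_eq_one, ← zpow_neg, ← zpow_add, F.zpow_eq_one_iff]
        exact ⟨-(x * z), by linear_combination x * hvz⟩
      map_mul' := by
        rintro ⟨_, x, rfl⟩ ⟨_, y, rfl⟩
        apply Subtype.ext
        change (w ^ x * w ^ y) ^ u = (w ^ x) ^ u * (w ^ y) ^ u
        rw [← zpow_add, ← zpow_mul, ← zpow_mul, ← zpow_mul, ← zpow_add, add_mul] }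
  let ev : Subgroup.zpowers w → Ω := fun v => (v : Perm Ω) ω
  have hev : Function.Bijective ev := by
    refine ⟨fun x y hxy => ?_, fun p => ?_⟩
    · exact Subtype.ext ((F.isRegularGroup ω (ev x)).unique ⟨x.2, rfl⟩ ⟨y.2, hxy.symm⟩)
    · obtain ⟨x, rfl⟩ := F.surj p
      exact ⟨⟨w ^ x, x, rfl⟩, rfl⟩
  let E := Equiv.ofBijective ev hev
  refine ⟨w ^ b * (E.permCongr φ.toEquiv), ⟨φ, ⟨w ^ b, b, rfl⟩, fun v => ?_⟩, fun x => ?_⟩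
  · have : (v : Perm Ω) ω = E v := rfl
    rw [this, Perm.mul_apply, Equiv.permCongr_apply, E.symm_apply_apply]
    rfl
  · have : (w ^ x) ω = E ⟨w ^ x, x, rfl⟩ := rfl
    rw [this, Perm.mul_apply, Equiv.permCongr_apply, E.symm_apply_apply]
    change (w ^ b) (((w ^ x) ^ u) ω) = _
    rw [← Perm.mul_apply, ← zpow_mul, ← zpow_add]
    congr 2; ring

lemma of_isRegularGroup [Finite Ω] {G W : Subgroup (Perm Ω)}
    (hWG : W ≤ G) (hWnormal : (W.subgroupOf G).Normal) (hWregular : IsRegularGroup W)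
    (hw : W = Subgroup.zpowers w) (hn : Nat.card W = n)
    (ha : stabilizer (Perm Ω) ω ⊓ G = Subgroup.zpowers a)
    (hα : a * w * a⁻¹ = w ^ α) : AffineFrame a w ω n α := by
  subst hw
  have hord : orderOf w = n := by rw [← hn, Nat.card_zpowers]
  have haG : a ∈ stabilizer (Perm Ω) ω ⊓ G := ha ▸ Subgroup.mem_zpowers a
  have hwG : w ∈ G := hWG (Subgroup.mem_zpowers w)
  have hfix : a ω = ω := haG.1
  have hz : ∀ x y : ℤ, w ^ x = w ^ y ↔ x ≡ y [ZMOD n] := fun x y => by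
    rw [zpow_eq_zpow_iff_modEq, hord]
  refine ⟨hord ▸ orderOf_pos w, fun p => ?_, fun x y => ?_, hfix, by rw [← hα]; group, ?_⟩
  · obtain ⟨g, ⟨⟨x, rfl⟩, h⟩, -⟩ := hWregular ω p
    exact ⟨x, h⟩
  · rw [← hz]
    refine ⟨fun h => ?_, fun h => by rw [h]⟩
    exact (hWregular ω ((w ^ y) ω)).unique ⟨⟨x, rfl⟩, h⟩ ⟨⟨y, rfl⟩, rfl⟩
  -- Conjugating w by a⁻¹ instead of a gives w^β, and β is an inverse of α modulo n.
  · have h := hWnormal.conj_mem ⟨w, hwG⟩ (Subgroup.mem_zpowers w) (⟨a, haG.2⟩⁻¹)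
    obtain ⟨β, hβ⟩ := h
    have hβ : w ^ β = a⁻¹ * w * a := by simpa using hβ
    have h1 : w ^ (α * β) = w ^ (1 : ℤ) := by
      rw [zpow_mul, ← hα, conj_zpow, hβ]; group
    obtain ⟨z, hz⟩ := Int.modEq_iff_dvd.1 ((hz _ _).1 h1)
    exact ⟨β, z, by linear_combination -hz⟩

end AffineFrame

/-! ### Relative closedness and conjugation -/

section Closed

variable {Ω : Type*}

lemma orbitSets_eq_iff {H K : Subgroup (Perm Ω)} :
    orbitSets K = orbitSets H ↔ ∀ x : Ω, orbit K x = orbit H x := by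
  constructor
  · intro h x
    have hx : orbit K x ∈ orbitSets H := h ▸ ⟨x, rfl⟩
    obtain ⟨y, hy⟩ := hx
    have hxy : x ∈ orbit H y := by
      have : x ∈ orbit K x := mem_orbit_self x
      rwa [← hy] at this
    rw [← hy]; exact (orbit_eq_iff.2 hxy).symm
  · intro h
    simp only [orbitSets, h]

/-- The elements of G that preserve every H-orbit form a group with the orbits of H, and it contains
every subgroup of G with these orbits. Closedness thus becomes a test on single elements. -/
lemma isRelClosed_iff {G H : Subgroup (Perm Ω)} :
    IsRelClosed G H ↔ H ≤ G ∧ ∀ g ∈ G, (∀ x, g x ∈ orbit H x) → g ∈ H := by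
  constructor
  · rintro ⟨⟨hHG, -⟩, hmax⟩
    refine ⟨hHG, fun g hg hgx => ?_⟩
    let K : Subgroup (Perm Ω) :=
      { carrier := {k | k ∈ G ∧ ∀ x, k x ∈ orbit H x}
        one_mem' := ⟨one_mem G, fun x => mem_orbit_self x⟩
        mul_mem' := fun {k l} hk hl => ⟨mul_mem hk.1 hl.1, fun x => by
          have h1 := hk.2 (l x)
          rw [orbit_eq_iff.2 (hl.2 x)] at h1
          exact h1⟩
        inv_mem' := fun {k} hk => ⟨inv_mem hk.1, fun x => by
          have h1 := hk.2 (k⁻¹ x)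
          rw [← Perm.mul_apply, mul_inv_cancel, Perm.one_apply] at h1
          exact mem_orbit_symm.1 h1⟩ }
    have hK : K ≤ H := by
      refine hmax ⟨fun k hk => hk.1, orbitSets_eq_iff.2 fun x => ?_⟩
      ext y
      constructor
      · rintro ⟨⟨k, hk⟩, rfl⟩; exact hk.2 x
      · rintro ⟨⟨h, hh⟩, rfl⟩
        exact ⟨⟨h, hHG hh, fun z => ⟨⟨h, hh⟩, rfl⟩⟩, rfl⟩
    exact hK ⟨hg, hgx⟩
  · rintro ⟨hHG, h⟩
    refine ⟨⟨hHG, rfl⟩, fun K hK k hk => h k (hK.1 hk) fun x => ?_⟩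
    rw [← orbitSets_eq_iff.1 hK.2 x]
    exact ⟨⟨k, hk⟩, rfl⟩

/-- The conjugate of a subgroup. -/
abbrev conjSubgroup (g : Perm Ω) (H : Subgroup (Perm Ω)) : Subgroup (Perm Ω) :=
  H.map (MulAut.conj g).toMonoidHom

lemma mem_conjSubgroup {g h : Perm Ω} {H : Subgroup (Perm Ω)} :
    h ∈ conjSubgroup g H ↔ g⁻¹ * h * g ∈ H := by
  constructor
  · rintro ⟨k, hk, rfl⟩
    simpa [mul_assoc] using hk
  · intro h'
    exact ⟨_, h', by simp [mul_assoc]⟩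

lemma conjSubgroup_inv_conjSubgroup (g : Perm Ω) (H : Subgroup (Perm Ω)) :
    conjSubgroup g⁻¹ (conjSubgroup g H) = H := by
  ext h; simp [mul_assoc]

lemma conjSubgroup_conjSubgroup_inv (g : Perm Ω) (H : Subgroup (Perm Ω)) :
    conjSubgroup g (conjSubgroup g⁻¹ H) = H := by
  ext h; simp [mul_assoc]

lemma conjSubgroup_mono (g : Perm Ω) {H K : Subgroup (Perm Ω)} (h : H ≤ K) :
    conjSubgroup g H ≤ conjSubgroup g K := Subgroup.map_mono h

lemma conjSubgroup_le_iff {g : Perm Ω} {H K : Subgroup (Perm Ω)} :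
    conjSubgroup g H ≤ K ↔ H ≤ conjSubgroup g⁻¹ K := by
  constructor <;> intro h
  · simpa only [conjSubgroup_inv_conjSubgroup] using conjSubgroup_mono g⁻¹ h
  · simpa only [conjSubgroup_conjSubgroup_inv] using conjSubgroup_mono g h

lemma conjSubgroup_lt_iff {g : Perm Ω} {H K : Subgroup (Perm Ω)} :
    conjSubgroup g H < K ↔ H < conjSubgroup g⁻¹ K := by
  have : K ≤ conjSubgroup g H ↔ conjSubgroup g⁻¹ K ≤ H := by
    rw [conjSubgroup_le_iff, inv_inv]
  rw [lt_iff_le_not_ge, lt_iff_le_not_ge, conjSubgroup_le_iff, this]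

lemma isRelClosed_conj {g : Perm Ω} {G H : Subgroup (Perm Ω)} (hg : conjSubgroup g G = G)
    (h : IsRelClosed G H) : IsRelClosed G (conjSubgroup g H) := by
  rw [isRelClosed_iff] at h ⊢
  refine ⟨hg ▸ conjSubgroup_mono g h.1, fun k hk hx => ?_⟩
  rw [mem_conjSubgroup]
  refine h.2 _ ?_ fun x => ?_
  · rwa [← hg, mem_conjSubgroup] at hk
  · obtain ⟨⟨l, hl⟩, hlx⟩ := hx (g x)
    have hlx : l (g x) = k (g x) := hlx
    exact ⟨⟨_, mem_conjSubgroup.1 hl⟩, by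
      change (g⁻¹ * l * g) x = (g⁻¹ * k * g) x
      simp [Perm.mul_apply, hlx]⟩

lemma conjSubgroup_inv_eq {g : Perm Ω} {G : Subgroup (Perm Ω)} (hg : conjSubgroup g G = G) :
    conjSubgroup g⁻¹ G = G := by
  conv_lhs => rw [← hg, conjSubgroup_inv_conjSubgroup]

lemma isMaximalRelClosedIn_conj {g : Perm Ω} {G L M : Subgroup (Perm Ω)}
    (hg : conjSubgroup g G = G) (h : IsMaximalRelClosedIn G L M) :
    IsMaximalRelClosedIn G (conjSubgroup g L) (conjSubgroup g M) := by
  obtain ⟨⟨h1, h2⟩, h3⟩ := h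
  refine ⟨⟨isRelClosed_conj hg h1, ?_⟩, fun K hK hMK => ?_⟩
  · rwa [conjSubgroup_lt_iff, conjSubgroup_inv_conjSubgroup]
  · have hK1 := isRelClosed_conj (conjSubgroup_inv_eq hg) hK.1
    have := h3 ⟨hK1, by rw [conjSubgroup_lt_iff, inv_inv]; exact hK.2⟩
      (conjSubgroup_le_iff.1 hMK)
    rwa [conjSubgroup_le_iff, inv_inv] at this

end Closed

/-! ### Indices, and closedness of the three shapes of subgroups -/

/-- The subgroup `L` of `⟨a, w⟩` meets `⟨w⟩` in `⟨w ^ d⟩`, and modulo `⟨w⟩` it is generated by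
`a ^ e`. -/
structure HasIndices {Ω : Type*} (a w : Perm Ω) (L : Subgroup (Perm Ω)) (d e : ℕ) : Prop where
  zpow_mem : ∀ j : ℤ, w ^ j ∈ L ↔ (d : ℤ) ∣ j
  exists_mem : ∀ t : ℕ, (∃ j : ℤ, w ^ j * a ^ t ∈ L) ↔ e ∣ t

lemma ordMod_pow_modEq {m : ℕ} {α : ℤ} (h : IsCoprime α m) (k l : ℕ) :
    α ^ k ≡ α ^ l [ZMOD m] ↔ k ≡ l [MOD ordMod m α] := by
  rw [← ZMod.intCast_eq_intCast_iff]
  obtain ⟨v, hv⟩ := (ZMod.coe_int_isUnit_iff_isCoprime α m).2 h.symm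
  rw [ordMod, ← hv, orderOf_units, ← pow_eq_pow_iff_modEq]
  push_cast
  rw [← hv, ← Units.val_pow_eq_pow_val, ← Units.val_pow_eq_pow_val, Units.ext_iff]

lemma ordMod_dvd_iff {m : ℕ} {α : ℤ} (h : IsCoprime α m) (k : ℕ) :
    ordMod m α ∣ k ↔ (m : ℤ) ∣ α ^ k - 1 := by
  have := ordMod_pow_modEq h k 0
  rw [pow_zero, Nat.modEq_zero_iff_dvd] at this
  rw [← this, Int.modEq_comm, Int.modEq_iff_dvd]

lemma ordMod_pos {m : ℕ} (hm : 0 < m) {α : ℤ} (h : IsCoprime α m) : 0 < ordMod m α := by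
  rcases Nat.eq_zero_or_pos (ordMod m α) with h0 | h0
  · have : NeZero m := ⟨hm.ne'⟩
    obtain ⟨v, hv⟩ := (ZMod.coe_int_isUnit_iff_isCoprime α m).2 h.symm
    rw [ordMod, ← hv, orderOf_units] at h0
    exact absurd h0 (orderOf_pos v).ne'
  · exact h0

namespace HasIndices

variable {Ω : Type*} {a w : Perm Ω} {ω : Ω} {n : ℕ} {α : ℤ}
  {L L' : Subgroup (Perm Ω)} {d d' e e' : ℕ}

lemma dvd_of_le (h : HasIndices a w L d e) (h' : HasIndices a w L' d' e') (hL : L ≤ L') :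
    d' ∣ d ∧ e' ∣ e := by
  constructor
  · exact Int.natCast_dvd_natCast.1 ((h'.zpow_mem d).1 (hL ((h.zpow_mem d).2 dvd_rfl)))
  · obtain ⟨j, hj⟩ := (h.exists_mem e).2 dvd_rfl
    exact (h'.exists_mem e).1 ⟨j, hL hj⟩

/-- Nested subgroups with the same intersection with ⟨w⟩ and the same image modulo ⟨w⟩ are equal.
Maximality arguments thereby reduce to divisibility of indices. -/
lemma eq_of_le [Finite Ω] (F : AffineFrame a w ω n α) (h : HasIndices a w L d e) (h' : HasIndices a w L' d e)
    (hL : L ≤ L') (hL' : L' ≤ Subgroup.closure {a, w}) : L = L' := by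
  refine le_antisymm hL (F.le_of_forall hL' fun j t hjt => ?_)
  obtain ⟨j', hj'⟩ := (h.exists_mem t).2 ((h'.exists_mem t).1 ⟨j, hjt⟩)
  have h1 := mul_mem hjt (inv_mem (hL hj'))
  have h2 : w ^ j * a ^ t * (w ^ j' * a ^ t)⁻¹ = w ^ (j - j') := by
    rw [zpow_sub]; group
  rw [h2, h'.zpow_mem, ← h.zpow_mem] at h1
  have h3 := mul_mem h1 hj'
  rwa [← mul_assoc, ← zpow_add, sub_add_cancel] at h3

end HasIndices

namespace AffineFrame

variable {Ω : Type*} {a w : Perm Ω} {ω : Ω} {n : ℕ} {α : ℤ}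

lemma hasIndices_conj (F : AffineFrame a w ω n α) {L : Subgroup (Perm Ω)} {d e : ℕ}
    (h : HasIndices a w L d e) {g : Perm Ω} (hg : g ∈ holomorph (Subgroup.zpowers w) ω) :
    HasIndices a w (conjSubgroup g L) d e := by
  obtain ⟨u, b, hu, hgub⟩ := F.exists_isAffineMap_of_mem_holomorph (inv_mem hg)
  have key : ∀ (j : ℤ) (t : ℕ), w ^ j * a ^ t ∈ conjSubgroup g L ↔
      w ^ (u * j + b * (1 - α ^ t)) * a ^ t ∈ L := fun j t => by
    rw [mem_conjSubgroup, ← F.zpow_mul_pow_conj hgub, inv_inv]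
  have hdn : (d : ℤ) ∣ n := (h.zpow_mem n).1 (by
    rw [(F.zpow_eq_one_iff n).2 dvd_rfl]; exact one_mem L)
  have hud : IsCoprime u d := hu.of_isCoprime_of_dvd_right hdn
  constructor
  · intro j
    have := key j 0
    simp only [pow_zero, mul_one, sub_self, mul_zero, add_zero, h.zpow_mem] at this
    rw [this]
    exact ⟨fun h => hud.symm.dvd_of_dvd_mul_left h, fun h => h.mul_left u⟩
  · intro t
    simp only [key]
    rw [← h.exists_mem]
    constructor
    · rintro ⟨j, hj⟩; exact ⟨_, hj⟩
    · rintro ⟨j, hj⟩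
      obtain ⟨v, z, hvz⟩ := hu
      -- The preimage of j under j ↦ uj + b(1 − α^t), with v the inverse of u modulo n.
      refine ⟨v * (j - b * (1 - α ^ t)), ?_⟩
      have : w ^ (u * (v * (j - b * (1 - α ^ t))) + b * (1 - α ^ t)) * a ^ t = w ^ j * a ^ t := by
        rw [F.mul_eq_mul_iff]
        refine ⟨Int.modEq_iff_dvd.2 ⟨z * (j - b * (1 - α ^ t)), ?_⟩, rfl⟩
        linear_combination -(j - b * (1 - α ^ t)) * hvz
      rwa [this]

lemma conjSubgroup_closure [Finite Ω] (F : AffineFrame a w ω n α) {g : Perm Ω}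
    (hg : g ∈ holomorph (Subgroup.zpowers w) ω) :
    conjSubgroup g (Subgroup.closure {a, w}) = Subgroup.closure {a, w} := by
  have key : ∀ g ∈ holomorph (Subgroup.zpowers w) ω,
      conjSubgroup g (Subgroup.closure {a, w}) ≤ Subgroup.closure {a, w} := by
    intro g hg
    obtain ⟨u, b, hu, hgub⟩ := F.exists_isAffineMap_of_mem_holomorph hg
    rw [conjSubgroup, closure_eq, F.metaSub_conj hgub hu, ← closure_eq]
    exact metaSub_le_closure _ _ _ _ _
  refine le_antisymm (key g hg) ?_
  have := key g⁻¹ (inv_mem hg)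
  rwa [conjSubgroup_le_iff, inv_inv] at this

lemma isCoprime_of_dvd (F : AffineFrame a w ω n α) {m : ℕ} (hm : m ∣ n) : IsCoprime α m :=
  F.cop.of_isCoprime_of_dvd_right (Int.natCast_dvd_natCast.2 hm)

lemma pow_modEq_of_dvd (F : AffineFrame a w ω n α) {m : ℕ} (hm : m ∣ n) {k l : ℕ}
    (h : α ^ k ≡ α ^ l [ZMOD n]) : k ≡ l [MOD ordMod m α] :=
  (ordMod_pow_modEq (F.isCoprime_of_dvd hm) k l).1 (h.of_dvd (Int.natCast_dvd_natCast.2 hm))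

/-- Closedness in `⟨a, w⟩`, in coordinates. -/
lemma isRelClosed_metaSub [Finite Ω] (F : AffineFrame a w ω n α) {i : ℕ} {c : ℤ} {m : ℕ} (hm : m ∣ n)
    (h : ∀ (j : ℤ) (t : ℕ), (∀ x : ℤ, ∃ k, α ^ t * x + j ≡ affIter (α ^ i) c k x [ZMOD m]) →
      w ^ j * a ^ t ∈ metaSub a w i c m) :
    IsRelClosed (Subgroup.closure {a, w}) (metaSub a w i c m) := by
  rw [isRelClosed_iff]
  refine ⟨metaSub_le_closure _ _ _ _ _, fun g hg hx => ?_⟩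
  obtain ⟨j, t, rfl⟩ := F.mem_closure_iff.1 hg
  refine h j t fun x => ?_
  rw [← F.orbit_metaSub hm, ← F.mul_apply]
  exact hx _

/-- The permutation a^t determines t only modulo its order; since s divides ord_m(α), the condition
s ∣ t is nevertheless well defined. -/
lemma mem_metaSub_zero [Finite Ω] (F : AffineFrame a w ω n α) {s m : ℕ} (hm : m ∣ n)
    (hs : s ∣ ordMod m α) (j : ℤ) (t : ℕ) :
    w ^ j * a ^ t ∈ metaSub a w s 0 m ↔ (m : ℤ) ∣ j ∧ s ∣ t := by
  simp only [F.mem_metaSub hm, zero_mul, Int.modEq_zero_iff_dvd]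
  constructor
  · rintro ⟨k, hk, hj⟩
    refine ⟨hj, ?_⟩
    have := (F.pow_modEq_of_dvd hm hk).of_dvd hs
    exact (Nat.ModEq.dvd_iff this dvd_rfl).2 (dvd_mul_right s k)
  · rintro ⟨hj, k, rfl⟩
    exact ⟨k, rfl, hj⟩

lemma hasIndices_metaSub_zero [Finite Ω] (F : AffineFrame a w ω n α) {s m : ℕ} (hm : m ∣ n)
    (hs : s ∣ ordMod m α) : HasIndices a w (metaSub a w s 0 m) m s := by
  constructor
  · intro j
    simpa using F.mem_metaSub_zero hm hs j 0
  · intro t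
    simp only [F.mem_metaSub_zero hm hs]
    exact ⟨fun ⟨_, h⟩ => h.2, fun h => ⟨0, dvd_zero _, h⟩⟩

/-- Two points suffice: preserving the orbit of 0 forces m ∣ j, and then preserving the orbit of 1
forces α^t into the powers of α^s modulo m. -/
lemma isRelClosed_metaSub_zero [Finite Ω] (F : AffineFrame a w ω n α) {s m : ℕ} (hm : m ∣ n)
    (hs : s ∣ ordMod m α) : IsRelClosed (Subgroup.closure {a, w}) (metaSub a w s 0 m) := by
  refine F.isRelClosed_metaSub hm fun j t h => ?_
  rw [F.mem_metaSub_zero hm hs]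
  obtain ⟨k, hk⟩ := h 0
  have hj : (m : ℤ) ∣ j := by simpa [affIter, Int.modEq_zero_iff_dvd] using hk
  refine ⟨hj, ?_⟩
  obtain ⟨k, hk⟩ := h 1
  have hk : α ^ t ≡ α ^ (s * k) [ZMOD m] := by
    rw [pow_mul]
    have h0 : α ^ t * 1 + j ≡ α ^ t * 1 + 0 [ZMOD m] :=
      (Int.modEq_zero_iff_dvd.2 hj).add_left _
    simpa [affIter] using h0.symm.trans hk
  have := ((ordMod_pow_modEq (F.isCoprime_of_dvd hm) _ _).1 hk).of_dvd hs
  exact (Nat.ModEq.dvd_iff this dvd_rfl).2 (dvd_mul_right s k)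

lemma ordMod_four {α : ℤ} (h : α ≡ -1 [ZMOD 4]) : ordMod 4 α = 2 := by
  have : (α : ZMod 4) = ((-1 : ℤ) : ZMod 4) := (ZMod.intCast_eq_intCast_iff _ _ 4).2 h
  rw [ordMod, this]
  refine orderOf_eq_prime ?_ ?_ <;> decide

lemma mod_two_eq (F : AffineFrame a w ω n α) (h4 : 4 ∣ n) (hα : α ≡ -1 [ZMOD 4]) {k l : ℕ}
    (h : α ^ k ≡ α ^ l [ZMOD n]) : k % 2 = l % 2 := by
  have := F.pow_modEq_of_dvd h4 h
  rwa [ordMod_four hα] at this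

/-- On multiples of c, α acts as −1 modulo m, because α + 1 divides α^k − (−1)^k. Geometric sums
then alternate between 0 and 1. -/
lemma mul_pow_modEq {c m : ℤ} (hc : m ∣ c * (α + 1)) (k : ℕ) :
    c * α ^ k ≡ c * (-1) ^ k [ZMOD m] := by
  obtain ⟨q, hq⟩ := sub_dvd_pow_sub_pow α (-1) k
  refine (Int.modEq_iff_dvd.2 ?_).symm
  rw [← mul_sub, hq, ← mul_assoc]
  exact Dvd.dvd.mul_right (by simpa using hc) _

lemma mul_geomSum_modEq {c m : ℤ} (hc : m ∣ c * (α + 1)) (k : ℕ) :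
    c * geomSum α k ≡ c * (k % 2 : ℕ) [ZMOD m] := by
  rw [← geomSum_neg_one]
  induction k with
  | zero => simp
  | succ k ih =>
    rw [geomSum_succ, geomSum_succ, mul_add, mul_add]
    exact ih.add (mul_pow_modEq hc k)

/-- The parity of t depends only on a^t because ord_4(α) = 2; membership ties j to this parity. -/
lemma mem_metaSub_one [Finite Ω] (F : AffineFrame a w ω n α) {c : ℤ} {m : ℕ} (h4 : 4 ∣ n)
    (hα : α ≡ -1 [ZMOD 4]) (hm : m ∣ n) (hc : (m : ℤ) ∣ c * (α + 1)) (j : ℤ) (t : ℕ) :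
    w ^ j * a ^ t ∈ metaSub a w 1 c m ↔ j ≡ c * (t % 2 : ℕ) [ZMOD m] := by
  simp only [F.mem_metaSub hm, pow_one, one_mul]
  constructor
  · rintro ⟨k, hk, hj⟩
    rw [F.mod_two_eq h4 hα hk]
    exact hj.trans (mul_geomSum_modEq hc k)
  · intro h
    exact ⟨t, rfl, h.trans (mul_geomSum_modEq hc t).symm⟩

lemma hasIndices_metaSub_one [Finite Ω] (F : AffineFrame a w ω n α) {c : ℤ} {m : ℕ} (h4 : 4 ∣ n)
    (hα : α ≡ -1 [ZMOD 4]) (hm : m ∣ n) (hc : (m : ℤ) ∣ c * (α + 1)) :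
    HasIndices a w (metaSub a w 1 c m) m 1 := by
  constructor
  · intro j
    simpa [Int.modEq_zero_iff_dvd] using F.mem_metaSub_one h4 hα hm hc j 0
  · intro t
    simp only [F.mem_metaSub_one h4 hα hm hc, one_dvd, iff_true]
    exact ⟨_, rfl⟩

/-- Modulo m, the points 0 and c form one orbit. An element preserving it has j ∈ {0, c} and ±c + j
∈ {0, c}; if j disagreed with the parity of t, then m would divide c or 2c. -/
lemma isRelClosed_metaSub_one [Finite Ω] (F : AffineFrame a w ω n α) {c : ℤ} {m : ℕ} (h4 : 4 ∣ n)
    (hα : α ≡ -1 [ZMOD 4]) (hm : m ∣ n) (hc : (m : ℤ) ∣ c * (α + 1)) (h2 : ¬ (m : ℤ) ∣ 2 * c) :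
    IsRelClosed (Subgroup.closure {a, w}) (metaSub a w 1 c m) := by
  refine F.isRelClosed_metaSub hm fun j t h => ?_
  rw [F.mem_metaSub_one h4 hα hm hc]
  have h0 : j ≡ 0 [ZMOD m] ∨ j ≡ c [ZMOD m] := by
    obtain ⟨k, hk⟩ := h 0
    have hk : j ≡ c * (k % 2 : ℕ) [ZMOD m] := by
      refine Int.ModEq.trans ?_ (mul_geomSum_modEq hc k)
      simpa [affIter] using hk
    rcases Nat.mod_two_eq_zero_or_one k with h | h
    · left; simpa [h] using hk
    · right; simpa [h] using hk
  have h1 : c * (-1) ^ t + j ≡ 0 [ZMOD m] ∨ c * (-1) ^ t + j ≡ c [ZMOD m] := by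
    obtain ⟨k, hk⟩ := h c
    have hk : c * (-1) ^ t + j ≡ c * (-1) ^ k + c * (k % 2 : ℕ) [ZMOD m] := by
      rw [affIter, pow_one, mul_comm (α ^ t), mul_comm (α ^ k)] at hk
      exact (((mul_pow_modEq hc t).symm.add_right j).trans hk).trans ((mul_pow_modEq hc k).add (mul_geomSum_modEq hc k))
    rcases Nat.even_or_odd k with h | h
    · right; simpa [h.neg_one_pow, Nat.even_iff.1 h] using hk
    · left; simpa [h.neg_one_pow, Nat.odd_iff.1 h] using hk
  rw [Int.modEq_iff_dvd, Int.modEq_iff_dvd] at h0 h1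
  have hne : ∀ z : ℤ, (m : ℤ) ∣ z → z = 2 * c ∨ z = -(2 * c) ∨ z = c ∨ z = -c → False := by
    rintro z hz (rfl | rfl | rfl | rfl)
    · exact h2 hz
    · exact h2 ((dvd_neg).1 hz)
    · exact h2 (hz.mul_left 2)
    · exact h2 ((dvd_neg.1 hz).mul_left 2)
  rw [Int.modEq_iff_dvd]
  rcases Nat.even_or_odd t with h | h
  · rw [h.neg_one_pow] at h1
    rw [Nat.even_iff.1 h]
    rcases h0 with h0 | h0
    · simpa using h0
    · exfalso
      rcases h1 with h1 | h1
      · refine hne _ (dvd_sub h1 h0) ?_; right; left; ring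
      · refine hne _ (dvd_sub h1 h0) ?_; right; right; right; ring
  · rw [h.neg_one_pow] at h1
    rw [Nat.odd_iff.1 h]
    rcases h0 with h0 | h0
    · exfalso
      rcases h1 with h1 | h1
      · refine hne _ (dvd_sub h1 h0) ?_; right; right; left; ring
      · refine hne _ (dvd_sub h1 h0) ?_; left; ring
    · simpa using h0

end AffineFrame

namespace AffineFrame

variable {Ω : Type*} {a w : Perm Ω} {ω : Ω} {n : ℕ} {α : ℤ}

lemma mul_geomSum_pow_modEq (F : AffineFrame a w ω n α) {s : ℕ} (hs : s ∣ n) (r : ℤ) (k : ℕ) :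
    r * geomSum (α ^ ordMod s α) k ≡ r * k [ZMOD (s * r)] := by
  have h : (s : ℤ) ∣ α ^ ordMod s α - 1 := (ordMod_dvd_iff (F.isCoprime_of_dvd hs) _).1 dvd_rfl
  rw [mul_comm (s : ℤ)]
  exact (geomSum_modEq_natCast h k).mul_left'

/-- Modulo s the generator is translation by r, modulo r it is multiplication by a power of α.
Coprimality of the orders lets ord_s(α) be cancelled, so t' is known modulo ord_r(α), hence modulo
s, and this fixes j modulo sr. -/
lemma mem_metaSub_ordMod [Finite Ω] (F : AffineFrame a w ω n α) {s r : ℕ} (hsr : s * r ∣ n)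
    (hs : s ∣ ordMod r α) (hcop : (ordMod r α).Coprime (ordMod s α)) (j : ℤ) (t : ℕ) :
    w ^ j * a ^ t ∈ metaSub a w (ordMod s α) r (s * r) ↔
      ∃ t', t = ordMod s α * t' ∧ j ≡ r * t' [ZMOD (s * r)] := by
  have hsn : s ∣ n := (dvd_mul_right s r).trans hsr
  have hrn : r ∣ n := (dvd_mul_left r s).trans hsr
  rw [F.mem_metaSub hsr]
  push_cast
  constructor
  · rintro ⟨k, hk, hj⟩
    have h1 := F.pow_modEq_of_dvd hsn hk
    obtain ⟨t', rfl⟩ := (Nat.ModEq.dvd_iff h1 dvd_rfl).2 (dvd_mul_right _ k)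
    have h2 := (F.pow_modEq_of_dvd hrn hk).cancel_left_of_coprime hcop
    refine ⟨t', rfl, (hj.trans (F.mul_geomSum_pow_modEq hsn r k)).trans ?_⟩
    rw [mul_comm (s : ℤ)]
    exact ((Int.natCast_modEq_iff.2 (h2.of_dvd hs)).symm).mul_left'
  · rintro ⟨t', rfl, hj⟩
    exact ⟨t', rfl, hj.trans (F.mul_geomSum_pow_modEq hsn r t').symm⟩

lemma hasIndices_metaSub_ordMod [Finite Ω] (F : AffineFrame a w ω n α) {s r : ℕ} (hsr : s * r ∣ n)
    (hs : s ∣ ordMod r α) (hcop : (ordMod r α).Coprime (ordMod s α)) :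
    HasIndices a w (metaSub a w (ordMod s α) r (s * r)) (s * r) (ordMod s α) := by
  have hs0 : 0 < ordMod s α := by
    refine ordMod_pos (Nat.pos_of_ne_zero ?_)
      (F.isCoprime_of_dvd ((dvd_mul_right s r).trans hsr))
    rintro rfl
    rw [zero_mul, zero_dvd_iff] at hsr
    exact F.pos.ne' hsr
  constructor
  · intro j
    have := F.mem_metaSub_ordMod hsr hs hcop j 0
    rw [pow_zero, mul_one] at this
    rw [this]
    push_cast
    constructor
    · rintro ⟨t', h0, hj⟩
      obtain rfl : t' = 0 := by simpa [hs0.ne'] using h0.symm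
      simpa [Int.modEq_zero_iff_dvd] using hj
    · intro h
      exact ⟨0, by simp, by simpa [Int.modEq_zero_iff_dvd] using h⟩
  · intro t
    simp only [F.mem_metaSub_ordMod hsr hs hcop]
    constructor
    · rintro ⟨j, t', rfl, -⟩; exact dvd_mul_right _ _
    · rintro ⟨t', rfl⟩; exact ⟨_, t', rfl, rfl⟩

/-- The test uses two points that are both 1 modulo r, but 0 and 1 modulo s. Being equal modulo r,
they are moved by iterates whose numbers agree modulo ord_r(α), hence modulo s; so both are
translated alike modulo s, which forces α^t ≡ 1 modulo s. -/
lemma isRelClosed_metaSub_ordMod [Finite Ω] (F : AffineFrame a w ω n α) {s r : ℕ} (hsr : s * r ∣ n)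
    (hs : s ∣ ordMod r α) (hcop : (ordMod r α).Coprime (ordMod s α)) (hco : s.Coprime r) :
    IsRelClosed (Subgroup.closure {a, w}) (metaSub a w (ordMod s α) r (s * r)) := by
  have hsn : s ∣ n := (dvd_mul_right s r).trans hsr
  have hrn : r ∣ n := (dvd_mul_left r s).trans hsr
  refine F.isRelClosed_metaSub hsr fun j t h => ?_
  rw [F.mem_metaSub_ordMod hsr hs hcop]
  push_cast at h
  have hrmul : ∀ z : ℤ, (r : ℤ) * z ≡ 0 [ZMOD r] := fun z =>
    Int.modEq_zero_iff_dvd.2 (dvd_mul_right _ _)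
  have hone : ∀ k : ℕ, (α ^ ordMod s α) ^ k ≡ 1 [ZMOD s] := fun k => by
    have h : (s : ℤ) ∣ α ^ ordMod s α - 1 := (ordMod_dvd_iff (F.isCoprime_of_dvd hsn) _).1 dvd_rfl
    simpa using (Int.modEq_iff_dvd.2 h).symm.pow k
  have hjr : j ≡ 0 [ZMOD r] := by
    obtain ⟨k, hk⟩ := h 0
    have hk := hk.of_mul_left (s : ℤ)
    rw [affIter, mul_zero, mul_zero, zero_add, zero_add] at hk
    exact hk.trans (hrmul _)
  have hmods : ∀ x : ℤ, x ≡ 1 [ZMOD r] → ∃ k : ℕ, t ≡ ordMod s α * k [MOD ordMod r α] ∧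
      α ^ t * x + j ≡ x + r * k [ZMOD s] := by
    intro x hx
    obtain ⟨k, hk⟩ := h x
    refine ⟨k, ?_, ?_⟩
    · rw [← ordMod_pow_modEq (F.isCoprime_of_dvd hrn), pow_mul]
      have h1 := (((hx.mul_left (α ^ t)).add hjr).symm.trans (hk.of_mul_left (s : ℤ))).trans
        ((hx.mul_left _).add (hrmul _))
      simpa using h1
    · have h1 := hk.of_mul_right (r : ℤ)
      refine h1.trans (Int.ModEq.add ?_ ?_)
      · simpa using (hone k).mul_right x
      · exact (F.mul_geomSum_pow_modEq hsn r k).of_mul_right (r : ℤ)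
  obtain ⟨u, v, huv⟩ := Nat.isCoprime_iff_coprime.2 hco
  -- By the Bézout relation us + vr = 1, this point is 0 modulo s and 1 modulo r.
  obtain ⟨k, hk1, hk2⟩ := hmods (u * s) (Int.modEq_iff_dvd.2 ⟨v, by linear_combination -huv⟩)
  obtain ⟨l, hl1, hl2⟩ := hmods 1 rfl
  have hkl : k ≡ l [MOD ordMod r α] := (hk1.symm.trans hl1).cancel_left_of_coprime hcop
  have hx0 : u * s ≡ 0 [ZMOD s] := Int.modEq_zero_iff_dvd.2 (dvd_mul_left _ _)
  have hjs : j ≡ r * k [ZMOD s] := by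
    have h1 := (((hx0.mul_left (α ^ t)).add_right j).symm.trans hk2).trans (hx0.add_right _)
    simpa using h1
  have hαt : α ^ t ≡ 1 [ZMOD s] := by
    have hkl' : (k : ℤ) ≡ l [ZMOD s] := Int.natCast_modEq_iff.2 (hkl.of_dvd hs)
    have h1 : α ^ t + j ≡ 1 + j [ZMOD s] := by
      rw [mul_one] at hl2
      exact hl2.trans ((hjs.trans (hkl'.mul_left _)).symm.add_left 1)
    exact h1.add_right_cancel' j
  have hdvd : ordMod s α ∣ t :=
    (ordMod_dvd_iff (F.isCoprime_of_dvd hsn) t).2 (Int.modEq_iff_dvd.1 hαt.symm)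
  obtain ⟨t', rfl⟩ := hdvd
  have ht' : t' ≡ k [MOD s] := (hk1.cancel_left_of_coprime hcop).of_dvd hs
  refine ⟨t', rfl, ?_⟩
  rw [← Int.modEq_and_modEq_iff_modEq_mul (by simpa using hco)]
  exact ⟨hjs.trans ((Int.natCast_modEq_iff.2 ht').symm.mul_left _), hjr.trans (hrmul _).symm⟩

/-- Elements of the larger group fix the class of b modulo s, whereas the generator w^r a^ord_s(α)
is modulo s the translation by r, which has no fixed class. -/
lemma not_metaSub_ordMod_le [Finite Ω] (F : AffineFrame a w ω n α) {s r m : ℕ} (hs : s ∣ m) (hm : m ∣ n)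
    (hsr : ¬ s ∣ r) (b : ℤ) :
    ¬ metaSub a w (ordMod s α) r (s * r) ≤ metaSub a w 1 (b * (1 - α)) m := by
  intro h
  have h1 : w ^ (r : ℤ) * a ^ ordMod s α ∈ metaSub a w 1 (b * (1 - α)) m :=
    h (Subgroup.subset_closure (by simp))
  rw [F.mem_metaSub hm] at h1
  obtain ⟨k, hk1, hk2⟩ := h1
  have hk1 := hk1.of_dvd (Int.natCast_dvd_natCast.2 (hs.trans hm))
  have hk2 := hk2.of_dvd (Int.natCast_dvd_natCast.2 hs)
  have hc := F.isCoprime_of_dvd (hs.trans hm)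
  have hz : (s : ℤ) ∣ α ^ k - 1 := by
    have h3 := (Int.modEq_iff_dvd.2 ((ordMod_dvd_iff hc _).1 dvd_rfl)).trans hk1
    exact Int.modEq_iff_dvd.1 (by simpa using h3)
  have h4 : b * (1 - α) * geomSum (α ^ 1) k = -(b * (α ^ k - 1)) := by
    have := sub_one_mul_geomSum α k
    rw [pow_one]; linear_combination -b * this
  rw [h4] at hk2
  have := (Int.ModEq.dvd_iff hk2).2 ((hz.mul_left b).neg_right)
  exact hsr (Int.natCast_dvd_natCast.1 this)

end AffineFrame

/-! ### The six families: indices, closedness and pairwise non-conjugacy -/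

namespace FamilyMember

/-- The exponent `i` in `⟨w ^ c * a ^ i, w ^ m⟩`. -/
def exponent (α : ℤ) : FamilyMember → ℕ
  | fam1 s _ => s
  | fam2 _ _ => 1
  | fam3 s _ => ordMod s α
  | fam4 _ => 1
  | fam5 => 2
  | fam6 => 1

/-- The exponent `c` in `⟨w ^ c * a ^ i, w ^ m⟩`. -/
def shift : FamilyMember → ℤ
  | fam1 _ _ => 0
  | fam2 _ _ => 0
  | fam3 _ r => r
  | fam4 r => r
  | fam5 => 0
  | fam6 => 1

/-- The exponent `m` in `⟨w ^ c * a ^ i, w ^ m⟩`. -/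
def modulus : FamilyMember → ℕ
  | fam1 _ r => r
  | fam2 s r => s * r
  | fam3 s r => s * r
  | fam4 r => 4 * r
  | fam5 => 4
  | fam6 => 8

lemma subgroup_eq {Ω : Type*} (a w : Perm Ω) (α : ℤ) (i : FamilyMember) :
    i.subgroup a w α = metaSub a w (i.exponent α) i.shift i.modulus := by
  cases i <;> simp [subgroup, metaSub, exponent, shift, modulus]

end FamilyMember

/-- By Fermat, s divides r − 1. In the third family this gives s ≠ r and makes the pair (s, r)
recoverable from the product sr. -/
lemma lt_of_dvd_ordMod {s r : ℕ} {α : ℤ} (hr : r.Prime)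
    (hαr : IsCoprime α r) (h : s ∣ ordMod r α) : s < r := by
  have : Fact r.Prime := ⟨hr⟩
  have h1 : ordMod r α ∣ r - 1 := by
    rw [ordMod_dvd_iff hαr]
    exact Int.modEq_iff_dvd.1 (Int.ModEq.pow_card_sub_one_eq_one hr hαr).symm
  have := Nat.le_of_dvd (Nat.sub_pos_of_lt hr.one_lt) (h.trans h1)
  have := hr.one_lt
  omega

namespace AffineFrame

variable {Ω : Type*} {a w : Perm Ω} {ω : Ω} {n : ℕ} {α : ℤ}

lemma modulus_dvd (F : AffineFrame a w ω n α) {i : FamilyMember} (hi : i.Valid n α) :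
    i.modulus ∣ n := by
  cases i with
  | fam1 s r => exact hi.2.1
  | fam2 s r => exact hi.2.2.2.2
  | fam3 s r =>
    obtain ⟨hr, hrn, hs, hsn, hsr, -⟩ := hi
    have := lt_of_dvd_ordMod hr (F.isCoprime_of_dvd hrn) hsr
    exact Nat.Coprime.mul_dvd_of_dvd_of_dvd ((Nat.coprime_primes hs hr).2 this.ne) hsn hrn
  | fam4 r =>
    obtain ⟨hr, hrn, hr2, h4, -⟩ := hi
    refine Nat.Coprime.mul_dvd_of_dvd_of_dvd ?_ h4 hrn
    rw [show 4 = 2 ^ 2 by norm_num]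
    exact Nat.Coprime.pow_left 2 ((Nat.coprime_primes Nat.prime_two hr).2 (Ne.symm hr2))
  | fam5 => exact hi.1
  | fam6 => exact hi.1

lemma family_lt (F : AffineFrame a w ω n α) {s r : ℕ} (hi : (FamilyMember.fam3 s r).Valid n α) :
    s < r :=
  lt_of_dvd_ordMod hi.1 (F.isCoprime_of_dvd hi.2.1) hi.2.2.2.2.1

lemma family_spec [Finite Ω] (F : AffineFrame a w ω n α) {i : FamilyMember} (hi : i.Valid n α) :
    HasIndices a w (i.subgroup a w α) i.modulus (i.exponent α) ∧
      IsRelClosed (Subgroup.closure {a, w}) (i.subgroup a w α) := by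
  have hm := F.modulus_dvd hi
  rw [FamilyMember.subgroup_eq]
  cases i with
  | fam1 s r =>
    exact ⟨F.hasIndices_metaSub_zero hm hi.2.2.2, F.isRelClosed_metaSub_zero hm hi.2.2.2⟩
  | fam2 s r =>
    exact ⟨F.hasIndices_metaSub_zero hm (one_dvd _), F.isRelClosed_metaSub_zero hm (one_dvd _)⟩
  | fam3 s r =>
    have hlt := F.family_lt hi
    obtain ⟨hr, hrn, hs, hsn, hsr, hco⟩ := hi
    exact ⟨F.hasIndices_metaSub_ordMod hm hsr hco,
      F.isRelClosed_metaSub_ordMod hm hsr hco ((Nat.coprime_primes hs hr).2 hlt.ne)⟩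
  | fam4 r =>
    obtain ⟨hr, hrn, hr2, h4, hα⟩ := hi
    have hc : ((4 * r : ℕ) : ℤ) ∣ r * (α + 1) := by
      obtain ⟨q, hq⟩ := Int.modEq_iff_dvd.1 hα
      exact ⟨-q, by push_cast; linear_combination -(r : ℤ) * hq⟩
    refine ⟨F.hasIndices_metaSub_one h4 hα hm hc, F.isRelClosed_metaSub_one h4 hα hm hc ?_⟩
    intro h
    have h : ((4 * r : ℕ) : ℤ) ∣ ((2 * r : ℕ) : ℤ) := by push_cast; exact h
    have := Nat.le_of_dvd (Nat.mul_pos two_pos hr.pos) (Int.natCast_dvd_natCast.1 h)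
    have := hr.pos
    omega
  | fam5 =>
    have hs : 2 ∣ ordMod 4 α := by rw [ordMod_four hi.2]
    exact ⟨F.hasIndices_metaSub_zero hm hs, F.isRelClosed_metaSub_zero hm hs⟩
  | fam6 =>
    have h4 : 4 ∣ n := Dvd.dvd.trans (by norm_num) hi.1
    have hα : α ≡ -1 [ZMOD 4] := hi.2.of_dvd (by norm_num)
    have hc : ((8 : ℕ) : ℤ) ∣ 1 * (α + 1) := by
      obtain ⟨q, hq⟩ := Int.modEq_iff_dvd.1 hi.2
      exact ⟨-q, by push_cast; linear_combination -hq⟩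
    exact ⟨F.hasIndices_metaSub_one h4 hα hm hc, F.isRelClosed_metaSub_one h4 hα hm hc (by decide)⟩

/-- A member of the third family has no fixed residue class modulo `s`, so that it lies in no
conjugate of a member of the second family with modulus divisible by `s`. -/
lemma not_fam3_le_conj_fam2 [Finite Ω] (F : AffineFrame a w ω n α) {s r s' r' : ℕ}
    (hi : (FamilyMember.fam3 s r).Valid n α) (hm : s' * r' ∣ n) (hs : s ∣ s' * r')
    {g : Perm Ω} (hg : g ∈ holomorph (Subgroup.zpowers w) ω) :
    ¬ (FamilyMember.fam3 s r).subgroup a w α ≤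
      conjSubgroup g ((FamilyMember.fam2 s' r').subgroup a w α) := by
  have hlt := F.family_lt hi
  obtain ⟨u, b, hu, hgub⟩ := F.exists_isAffineMap_of_mem_holomorph hg
  have h := F.not_metaSub_ordMod_le hs hm
    (fun h => hlt.ne ((Nat.prime_dvd_prime_iff_eq hi.2.2.1 hi.1).1 h)) b
  rw [FamilyMember.subgroup_eq, FamilyMember.subgroup_eq, conjSubgroup, F.metaSub_conj hgub hu]
  simpa [FamilyMember.shift, FamilyMember.exponent, FamilyMember.modulus] using h

end AffineFrame

lemma not_prime_mul_prime {p q : ℕ} (hp : p.Prime) (hq : q.Prime) : ¬ (p * q).Prime :=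
  Nat.not_prime_mul hp.ne_one hq.ne_one

lemma not_prime_four_mul (p : ℕ) : ¬ (4 * p).Prime := fun hp =>
  Nat.not_prime_mul (a := 2) (b := 2 * p) (by norm_num) (by omega) (by convert hp using 1; ring)

/-- One of the primes would be 2, and the other would be 2t. This separates the moduli 4r, and also
8 = 4 · 2, from products of two primes. -/
lemma mul_ne_four_mul {p q t : ℕ} (hp : p.Prime) (hq : q.Prime) (ht : t.Prime) :
    p * q ≠ 4 * t := fun hpq => by
  have h2p : ∀ {p q : ℕ}, q.Prime → p * q = 4 * t → p ≠ 2 := by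
    rintro p q hq hpq rfl
    have h3 : q = 2 * t := by omega
    exact not_prime_mul_prime Nat.prime_two ht (h3 ▸ hq)
  have h3 : 2 ∣ p * q := hpq ▸ Dvd.intro (2 * t) (by ring)
  rcases (Nat.prime_two.dvd_mul).1 h3 with h5 | h5
  · exact h2p hq hpq ((Nat.prime_dvd_prime_iff_eq Nat.prime_two hp).1 h5).symm
  · exact h2p hp (by rw [mul_comm, hpq]) ((Nat.prime_dvd_prime_iff_eq Nat.prime_two hq).1 h5).symm

lemma primes_eq_of_mul_eq_mul {s r s' r' : ℕ} (hs : s.Prime) (hs' : s'.Prime)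
    (hr' : r'.Prime) (h : s * r = s' * r') (hsr : s ≤ r) (hsr' : s' ≤ r') : s = s' ∧ r = r' := by
  have h1 : s ∣ s' * r' := h ▸ dvd_mul_right s r
  rcases (hs.dvd_mul).1 h1 with h2 | h2
  · obtain rfl := (Nat.prime_dvd_prime_iff_eq hs hs').1 h2
    exact ⟨rfl, Nat.eq_of_mul_eq_mul_left hs.pos h⟩
  · obtain rfl := (Nat.prime_dvd_prime_iff_eq hs hr').1 h2
    rw [mul_comm] at h
    obtain rfl := Nat.eq_of_mul_eq_mul_right hs.pos h
    exact ⟨le_antisymm hsr hsr', le_antisymm hsr' hsr⟩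

namespace AffineFrame

variable {Ω : Type*} {a w : Perm Ω} {ω : Ω} {n : ℕ} {α : ℤ}

/-- Modulus and exponent are conjugacy invariants. They leave only one coincidence, between the
second and the third family when ord_s(α) = 1. -/
lemma family_injective [Finite Ω] (F : AffineFrame a w ω n α) {i j : FamilyMember} (hi : i.Valid n α)
    (hj : j.Valid n α) (hi' : i.Ordered) (hj' : j.Ordered) {g : Perm Ω}
    (hg : g ∈ holomorph (Subgroup.zpowers w) ω)
    (h : i.subgroup a w α = conjSubgroup g (j.subgroup a w α)) : i = j := by
  wlog hij : i.ctorIdx ≤ j.ctorIdx generalizing i j g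
  · exact (this hj hi hj' hi' (inv_mem hg) (by rw [h, conjSubgroup_inv_conjSubgroup])
      (Nat.le_of_not_le hij)).symm
  have hI := (F.family_spec hi).1
  have hJ := F.hasIndices_conj (F.family_spec hj).1 hg
  have hm := Nat.dvd_antisymm (hJ.dvd_of_le hI h.ge).1 (hI.dvd_of_le hJ h.le).1
  have he := Nat.dvd_antisymm (hJ.dvd_of_le hI h.ge).2 (hI.dvd_of_le hJ h.le).2
  have hmi := F.modulus_dvd hi
  rcases i with ⟨s, r⟩ | ⟨s, r⟩ | ⟨s, r⟩ | ⟨r⟩ | _ | _ <;>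
    rcases j with ⟨s', r'⟩ | ⟨s', r'⟩ | ⟨s', r'⟩ | ⟨r'⟩ | _ | _ <;>
    first
    | exact absurd (Nat.ble_eq_true_of_le hij) Bool.false_ne_true
    | skip
  all_goals change _ = _ at hm he
  all_goals simp only [FamilyMember.modulus, FamilyMember.exponent] at hm he hmi
  · rw [hm, he]
  · exact absurd (hm ▸ hi.1) (not_prime_mul_prime hj.1 hj.2.2.1)
  · exact absurd (hm ▸ hi.1) (not_prime_mul_prime hj.2.2.1 hj.1)
  · exact absurd (hm ▸ hi.1) (not_prime_four_mul r')
  · exact absurd (hm ▸ hi.1) (by norm_num)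
  · exact absurd (hm ▸ hi.1) (by norm_num)
  · obtain ⟨rfl, rfl⟩ := primes_eq_of_mul_eq_mul hi.1 hj.1 hj.2.2.1 hm hi' hj'
    rfl
  -- The indices can agree here; the third family has no fixed residue class modulo s', the second
  -- has one.
  · refine absurd ?_ (F.not_fam3_le_conj_fam2 hj hmi (hm ▸ dvd_mul_right s' r') (inv_mem hg))
    rw [h, conjSubgroup_inv_conjSubgroup]
  · exact absurd hm (mul_ne_four_mul hi.1 hi.2.2.1 hj.1)
  · omega
  · exact absurd hm (mul_ne_four_mul (t := 2) hi.1 hi.2.2.1 Nat.prime_two)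
  · obtain ⟨rfl, rfl⟩ := primes_eq_of_mul_eq_mul hi.2.2.1 hj.2.2.1 hj.1 hm (F.family_lt hi).le
      (F.family_lt hj).le
    rfl
  · exact absurd hm (mul_ne_four_mul hi.2.2.1 hi.1 hj.1)
  · have := primes_eq_of_mul_eq_mul (s' := 2) (r' := 2) hi.2.2.1 Nat.prime_two Nat.prime_two hm
      (F.family_lt hi).le le_rfl
    have := F.family_lt hi
    omega
  · exact absurd hm (mul_ne_four_mul (t := 2) hi.2.2.1 hi.1 Nat.prime_two)
  · rw [Nat.eq_of_mul_eq_mul_left (by norm_num) hm]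
  · omega
  · exact absurd (by omega : r = 2) hi.2.2.1
  · rfl
  · omega
  · rfl

end AffineFrame

/-! ### Failure of Hull–Dobell for the whole group -/

/-- The residue b is a fixed point of x ↦ βx + c modulo p; it exists exactly in the case in which
the Hull–Dobell condition at p is violated. -/
lemma exists_modEq_mul_one_sub {p : ℕ} (hp : p.Prime) {β c : ℤ}
    (h : (p : ℤ) ∣ c ∨ ¬ (p : ℤ) ∣ β - 1) : ∃ b, c ≡ b * (1 - β) [ZMOD p] := by
  rcases h with h | h
  · exact ⟨0, by simpa [Int.modEq_zero_iff_dvd] using h⟩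
  · obtain ⟨u, v, huv⟩ := (Nat.prime_iff_prime_int.1 hp).irreducible.coprime_iff_not_dvd.2 h
    exact ⟨-(c * v), Int.modEq_iff_dvd.2 ⟨-(c * u), by linear_combination c * huv⟩⟩

lemma exists_mul_modEq_one {p : ℕ} (hp : p.Prime) {k : ℤ} (h : ¬ (p : ℤ) ∣ k) :
    ∃ v, v * k ≡ 1 [ZMOD p] := by
  obtain ⟨u, v, huv⟩ := (Nat.prime_iff_prime_int.1 hp).irreducible.coprime_iff_not_dvd.2 h
  exact ⟨v, Int.modEq_iff_dvd.2 ⟨u, by linear_combination -huv⟩⟩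

lemma exists_modEq_and_modEq {p q : ℤ} (h : IsCoprime p q) (x y : ℤ) :
    ∃ z, z ≡ x [ZMOD p] ∧ z ≡ y [ZMOD q] := by
  obtain ⟨u, v, huv⟩ := h
  exact ⟨x * v * q + y * u * p,
    Int.modEq_iff_dvd.2 ⟨(x - y) * u, by linear_combination (-x) * huv⟩,
    Int.modEq_iff_dvd.2 ⟨(y - x) * v, by linear_combination (-y) * huv⟩⟩

lemma exists_isCoprime_modEq {p n : ℕ} (hp : p.Prime) (hn : 0 < n) (hpn : p ∣ n) {z : ℤ}
    (hz : ¬ (p : ℤ) ∣ z) : ∃ u : ℤ, IsCoprime u n ∧ u ≡ z [ZMOD p] := by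
  have : NeZero n := ⟨hn.ne'⟩
  have : Fact p.Prime := ⟨hp⟩
  have hz0 : (z : ZMod p) ≠ 0 := by rwa [Ne, ZMod.intCast_zmod_eq_zero_iff_dvd]
  obtain ⟨u, hu⟩ := ZMod.unitsMap_surjective hpn (Units.mk0 _ hz0)
  refine ⟨(u : ZMod n).val, Nat.isCoprime_iff_coprime.2 (ZMod.val_coe_unit_coprime u), ?_⟩
  have h := congrArg Units.val hu
  rw [ZMod.unitsMap_val, Units.val_mk0] at h
  rw [← ZMod.intCast_eq_intCast_iff, ← h, Int.cast_natCast, ZMod.cast_eq_val]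

lemma exists_mul_natModEq {i o : ℕ} (ho : 0 < o) (h : i.Coprime o) (k : ℕ) :
    ∃ t, i * t ≡ k [MOD o] := by
  obtain ⟨u, v, huv⟩ := Nat.isCoprime_iff_coprime.2 h
  have hnn : 0 ≤ (u * k) % o := Int.emod_nonneg _ (by exact_mod_cast ho.ne')
  refine ⟨((u * k) % o).toNat, ?_⟩
  rw [← Int.natCast_modEq_iff]
  push_cast
  rw [Int.toNat_of_nonneg hnn]
  refine ((Int.mod_modEq (u * k) o).mul_left i).trans (Int.modEq_iff_dvd.2 ⟨k * v, ?_⟩)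
  linear_combination -(k : ℤ) * huv

lemma affIter_mul (β c : ℤ) (k l : ℕ) (x : ℤ) :
    affIter β c (k * l) x = affIter (β ^ k) (c * geomSum β k) l x := by
  simp only [affIter, geomSum_mul, pow_mul]; ring

lemma geomSum_modEq_one_of_odd {m α : ℤ} (h : m ∣ α + 1) {i : ℕ} (hi : i % 2 = 1) :
    geomSum (α ^ 1) i ≡ 1 [ZMOD m] := by
  have := AffineFrame.mul_geomSum_modEq (c := 1) (by simpa using h) i
  simpa [hi] using this

lemma mul_one_sub_mul_geomSum (b α : ℤ) (k : ℕ) :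
    b * (1 - α ^ 1) * geomSum (α ^ 1) k = b * (1 - α ^ k) := by
  have := sub_one_mul_geomSum α k
  rw [pow_one]; linear_combination -b * this

/-- Modulo 4 one has 1 − α ≡ 2, so conjugation by a translation reaches both odd residues, while the
geometric sum is 1 for odd i. -/
lemma exists_odd_modEq {α c r : ℤ} {i : ℕ} (hα : α ≡ -1 [ZMOD 4]) (hi : i % 2 = 1)
    (hc : ¬ (2 : ℤ) ∣ c) (hr : ¬ (2 : ℤ) ∣ r) :
    ∃ b, c ≡ (r + b * (1 - α ^ 1)) * geomSum (α ^ 1) i [ZMOD 4] := by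
  have h1 : (4 : ℤ) ∣ α + 1 := by
    have := Int.modEq_iff_dvd.1 hα.symm; simpa using this
  have h2 := geomSum_modEq_one_of_odd h1 hi
  rw [pow_one] at h2 ⊢
  have h3 : c - r ≡ 0 [ZMOD 4] ∨ c - r ≡ 2 [ZMOD 4] := by simp only [Int.ModEq]; omega
  rcases h3 with h3 | h3
  · refine ⟨0, ?_⟩
    have := (h2.mul_left r).symm
    rw [zero_mul, add_zero]
    refine Int.ModEq.trans ?_ this
    rw [mul_one]; simp only [Int.ModEq] at h3 ⊢; omega
  · refine ⟨1, ?_⟩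
    have := (h2.mul_left (r + 1 * (1 - α))).symm
    refine Int.ModEq.trans ?_ this
    rw [mul_one]; simp only [Int.ModEq] at h3 ⊢; omega

namespace AffineFrame

variable {Ω : Type*} {a w : Perm Ω} {ω : Ω} {n : ℕ} {α : ℤ}

lemma not_two_dvd (F : AffineFrame a w ω n α) (h : 2 ∣ n) : ¬ (2 : ℤ) ∣ α := by
  intro h2
  have h1 := F.isCoprime_of_dvd h
  exact absurd (h1.isUnit_of_dvd' h2 dvd_rfl) (by decide)

lemma modEq_neg_one_and_odd (F : AffineFrame a w ω n α) (h4 : 4 ∣ n) {i : ℕ}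
    (hi : ¬ (4 : ℤ) ∣ α ^ i - 1) : α ≡ -1 [ZMOD 4] ∧ i % 2 = 1 := by
  have h2 := F.not_two_dvd (Dvd.dvd.trans (by norm_num) h4)
  have h : α ≡ 1 [ZMOD 4] ∨ α ≡ -1 [ZMOD 4] := by simp only [Int.ModEq]; omega
  rcases h with h | h
  · exact absurd (Int.modEq_iff_dvd.1 (by simpa using h.pow i : α ^ i ≡ 1 [ZMOD 4]).symm) hi
  · refine ⟨h, ?_⟩
    by_contra hodd
    have he : Even i := Nat.even_iff.2 (by omega)
    have := h.pow i
    rw [he.neg_one_pow] at this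
    exact hi (Int.modEq_iff_dvd.1 this.symm)

variable [Finite Ω]

lemma metaSub_le_metaSub_prime (F : AffineFrame a w ω n α) {i : ℕ} {c : ℤ} {m r : ℕ} (hm : m ∣ n)
    (hr : r ∣ m) (hc : (r : ℤ) ∣ c) : metaSub a w i c m ≤ metaSub a w 1 0 r :=
  F.metaSub_le_metaSub hr hm i (by simp) (by simpa [Int.modEq_zero_iff_dvd] using hc)

/-- Every intransitive subgroup of `⟨a, w⟩` lies in a conjugate of one of the subgroups
`⟨a, w ^ p⟩` and `⟨w * a, w ^ 4⟩`. -/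
lemma le_maximal_or_transitive (F : AffineFrame a w ω n α) (i : ℕ) (c : ℤ) {m : ℕ} (hm : m ∣ n) :
    (∃ p : ℕ, p.Prime ∧ p ∣ n ∧ ∃ b, metaSub a w i c m ≤ metaSub a w 1 (b * (1 - α ^ 1)) p) ∨
    (4 ∣ n ∧ α ≡ -1 [ZMOD 4] ∧ ∃ b, metaSub a w i c m ≤ metaSub a w 1 (1 + b * (1 - α ^ 1)) 4) ∨
    ∀ x y, ∃ k, affIter (α ^ i) c k x ≡ y [ZMOD m] := by
  -- The cases are the possible violations of Hull–Dobell for x ↦ α^i x + c modulo m: at a prime, or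
  -- only at 4.
  by_cases h1 : ∃ p : ℕ, p.Prime ∧ p ∣ m ∧ ((p : ℤ) ∣ c ∨ ¬ (p : ℤ) ∣ α ^ i - 1)
  · left
    obtain ⟨p, hp, hpm, hc⟩ := h1
    obtain ⟨b, hb⟩ := exists_modEq_mul_one_sub hp hc
    refine ⟨p, hp, hpm.trans hm, b, F.metaSub_le_metaSub hpm hm i (by simp) ?_⟩
    rwa [mul_one_sub_mul_geomSum]
  right
  push Not at h1
  by_cases h4 : 4 ∣ m → (4 : ℤ) ∣ α ^ i - 1
  · right
    exact exists_affIter_modEq (Nat.pos_of_dvd_of_pos hm F.pos)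
      (fun p hp hpm => (h1 p hp hpm).symm) h4
  · left
    push Not at h4
    obtain ⟨h4m, h4⟩ := h4
    obtain ⟨hα, hi⟩ := F.modEq_neg_one_and_odd (h4m.trans hm) h4
    obtain ⟨b, hb⟩ := exists_odd_modEq (r := 1) hα hi
      (h1 2 Nat.prime_two (Dvd.dvd.trans (by norm_num) h4m)).1 (by norm_num)
    exact ⟨h4m.trans hm, hα, b, F.metaSub_le_metaSub h4m hm i (by simp) hb⟩

end AffineFrame

/-! ### Failure of Hull–Dobell inside a maximal closed subgroup -/

/-- The subgroup `H` lies in a conjugate of a member of one of the families which is contained in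
`M` and whose indices differ from `d` and `1`. -/
def LiesInFamily {Ω : Type*} (a w : Perm Ω) (n : ℕ) (α : ℤ) (M : Subgroup (Perm Ω)) (d : ℕ)
    (H : Subgroup (Perm Ω)) : Prop :=
  ∃ f : FamilyMember, f.Valid n α ∧ ¬ (f.modulus = d ∧ f.exponent α = 1) ∧
    ∃ u b : ℤ, IsCoprime u n ∧
      H ≤ metaSub a w (f.exponent α) (u * f.shift + b * (1 - α ^ f.exponent α)) f.modulus ∧
      metaSub a w (f.exponent α) (u * f.shift + b * (1 - α ^ f.exponent α)) f.modulus ≤ M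

namespace AffineFrame

variable {Ω : Type*} [Finite Ω] {a w : Perm Ω} {ω : Ω} {n : ℕ} {α : ℤ}

/-- Inside ⟨a, w^r⟩ the orbits agree with those of the big group if i is prime to o = ord_r(α), so
that all classes α^k x modulo r are reached, and if the o-th iterate, which preserves classes modulo
r, is transitive on each class. The first can fail by family 1. Hull–Dobell for the o-th iterate can
fail at primes already bad for α^i and c' (family 2), at 4 (family 4, or family 2 if r = 2), at
primes dividing o (family 3), or at r itself (family 2 with s = r). -/
lemma liesInFamily_or_orbits_prime (F : AffineFrame a w ω n α) {r : ℕ} (hr : r.Prime) {i : ℕ}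
    {c : ℤ} {m : ℕ} (hm : m ∣ n) (hrm : r ∣ m) (hrc : (r : ℤ) ∣ c) :
    LiesInFamily a w n α (metaSub a w 1 0 r) r (metaSub a w i c m) ∨
      ∀ (x : ℤ) (k : ℕ) (z : ℤ), ∃ t, affIter (α ^ i) c t x ≡ α ^ k * x + r * z [ZMOD m] := by
  obtain ⟨m', rfl⟩ := hrm
  obtain ⟨c', rfl⟩ := hrc
  have hrn : r ∣ n := (dvd_mul_right r m').trans hm
  have hm'0 : 0 < m' := Nat.pos_of_mul_pos_left (Nat.pos_of_dvd_of_pos hm F.pos)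
  have hcr := F.isCoprime_of_dvd hrn
  have hor : 0 < ordMod r α := ordMod_pos hr.pos hcr
  -- On the multiples rz the generator acts as z ↦ α^i z + c'. A bad prime p gives a fixed residue b
  -- of this map, hence the fixed class rb modulo pr.
  by_cases h1 : ∃ p : ℕ, p.Prime ∧ p ∣ m' ∧ ((p : ℤ) ∣ c' ∨ ¬ (p : ℤ) ∣ α ^ i - 1)
  · left
    obtain ⟨p, hp, hpm, hc⟩ := h1
    obtain ⟨b, hb⟩ := exists_modEq_mul_one_sub hp hc
    have hprm : p * r ∣ r * m' := by rw [mul_comm p]; exact mul_dvd_mul_left r hpm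
    refine ⟨.fam2 p r, ⟨hp, (hpm.mul_left r).trans hm, hr, hrn, hprm.trans hm⟩,
      fun h => not_prime_mul_prime hp hr (Eq.mpr (congrArg Nat.Prime h.1) hr), 1, r * b, isCoprime_one_left,
      F.metaSub_le_metaSub hprm hm i (by simp [FamilyMember.exponent]) ?_,
      F.metaSub_le_metaSub_prime (hprm.trans hm) (dvd_mul_left r p) ?_⟩
    · change r * c' ≡ (1 * 0 + r * b * (1 - α ^ 1)) * geomSum (α ^ 1) i [ZMOD ((p * r : ℕ) : ℤ)]
      rw [mul_zero, zero_add, mul_one_sub_mul_geomSum, mul_assoc]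
      push_cast
      rw [mul_comm (p : ℤ)]
      exact hb.mul_left'
    · change (r : ℤ) ∣ 1 * 0 + r * b * (1 - α ^ 1)
      exact ⟨b * (1 - α ^ 1), by ring⟩
  push Not at h1
  by_cases h4 : 4 ∣ m' → (4 : ℤ) ∣ α ^ i - 1
  swap
  · left
    push Not at h4
    obtain ⟨h4m, h4⟩ := h4
    have h4n : 4 ∣ n := (h4m.mul_left r).trans hm
    obtain ⟨hα, hi⟩ := F.modEq_neg_one_and_odd h4n h4
    have hc' := (h1 2 Nat.prime_two (Dvd.dvd.trans (by norm_num) h4m)).1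
    -- For r = 2, since α^i ≡ −1 modulo 4 and c' is odd, 1 is a fixed residue of x ↦ α^i x + 2c'
    -- modulo 4.
    by_cases hr2 : r = 2
    · subst hr2
      refine ⟨.fam2 2 2, ⟨hr, hrn, hr, hrn, h4n⟩,
        fun h => by simp [FamilyMember.modulus] at h, 1, 1, isCoprime_one_left,
        F.metaSub_le_metaSub (h4m.mul_left 2) hm i (by simp [FamilyMember.exponent]) ?_,
        F.metaSub_le_metaSub_prime h4n (dvd_mul_left 2 2) ?_⟩
      · change 2 * c' ≡ (1 * 0 + 1 * (1 - α ^ 1)) * geomSum (α ^ 1) i [ZMOD 4]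
        rw [mul_zero, zero_add, mul_one_sub_mul_geomSum]
        have h5 := hα.pow i
        rw [(Nat.odd_iff.2 hi).neg_one_pow] at h5
        push_cast at hc'
        simp only [Int.ModEq] at h5 ⊢
        omega
      · change (2 : ℤ) ∣ 1 * 0 + 1 * (1 - α ^ 1)
        rw [pow_one]
        simp only [Int.ModEq] at hα
        omega
    · have hrodd : ¬ (2 : ℤ) ∣ r := fun h => hr2
        ((Nat.prime_dvd_prime_iff_eq Nat.prime_two hr).1 (Int.natCast_dvd_natCast.1 h)).symm
      obtain ⟨b, hb⟩ := exists_odd_modEq (r := 1) hα hi hc' (by norm_num)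
      have hprm : 4 * r ∣ r * m' := by rw [mul_comm 4]; exact mul_dvd_mul_left r h4m
      refine ⟨.fam4 r, ⟨hr, hrn, hr2, h4n, hα⟩,
        fun h => not_prime_four_mul r (Eq.mpr (congrArg Nat.Prime h.1) hr), 1, r * b, isCoprime_one_left,
        F.metaSub_le_metaSub hprm hm i (by simp [FamilyMember.exponent]) ?_,
        F.metaSub_le_metaSub_prime (hprm.trans hm) (dvd_mul_left r 4) ?_⟩
      · change r * c' ≡ (1 * r + r * b * (1 - α ^ 1)) * geomSum (α ^ 1) i [ZMOD ((4 * r : ℕ) : ℤ)]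
        push_cast
        rw [mul_comm (4 : ℤ), show (1 * r + r * b * (1 - α ^ 1)) * geomSum (α ^ 1) i =
          r * ((1 + b * (1 - α ^ 1)) * geomSum (α ^ 1) i) by ring]
        exact hb.mul_left'
      · change (r : ℤ) ∣ 1 * r + r * b * (1 - α ^ 1)
        exact ⟨1 + b * (1 - α ^ 1), by ring⟩
  by_cases h2 : i.Coprime (ordMod r α)
  swap
  · left
    obtain ⟨s, hs, hsi, hso⟩ := Nat.Prime.not_coprime_iff_dvd.1 h2
    obtain ⟨k, rfl⟩ := hsi
    refine ⟨.fam1 s r, ⟨hr, hrn, hs, hso⟩, fun h => hs.ne_one h.2, 1, 0, isCoprime_one_left,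
      F.metaSub_le_metaSub (dvd_mul_right r m') hm k rfl ?_,
      F.metaSub_le_metaSub_prime hrn dvd_rfl ?_⟩
    · change r * c' ≡ (1 * 0 + 0 * (1 - α ^ s)) * geomSum (α ^ s) k [ZMOD r]
      simp [Int.modEq_zero_iff_dvd]
    · change (r : ℤ) ∣ 1 * 0 + 0 * (1 - α ^ s)
      simp
  by_cases h3 : ∃ p : ℕ, p.Prime ∧ p ∣ m' ∧ p ≠ r ∧ p ∣ ordMod r α
  · left
    obtain ⟨p, hp, hpm, hpr, hpo⟩ := h3
    have hpn : p ∣ n := (hpm.mul_left r).trans hm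
    have hop : ordMod p α ∣ i :=
      (ordMod_dvd_iff (F.isCoprime_of_dvd hpn) i).2 (h1 p hp hpm).2
    obtain ⟨k, hk⟩ := hop
    have hpk : ¬ (p : ℤ) ∣ k := fun h => by
      have h5 : p ∣ i := hk ▸ (Int.natCast_dvd_natCast.1 h).mul_left _
      exact hp.one_lt.ne' (Nat.eq_one_of_dvd_coprimes h2 h5 hpo)
    -- The generator must be the k-th power of a conjugate of w^r a^ord_p(α), where i = ord_p(α) k.
    -- Modulo p this asks for a unit u with uk ≡ c'; so u lifts c'v.
    obtain ⟨v, hv⟩ := exists_mul_modEq_one hp hpk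
    have hcv : ¬ (p : ℤ) ∣ c' * v := fun h => by
      rcases (Nat.prime_iff_prime_int.1 hp).dvd_or_dvd h with h | h
      · exact (h1 p hp hpm).1 h
      · have h5 := (Int.ModEq.dvd_iff hv).1 (h.mul_right k)
        exact hp.one_lt.ne' (by exact_mod_cast Int.eq_one_of_dvd_one (by positivity) h5)
    obtain ⟨u, hu, hup⟩ := exists_isCoprime_modEq hp F.pos hpn hcv
    have hprm : p * r ∣ r * m' := by rw [mul_comm p]; exact mul_dvd_mul_left r hpm
    refine ⟨.fam3 p r, ⟨hr, hrn, hp, hpn, hpo, ?_⟩,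
      fun h => not_prime_mul_prime hp hr (Eq.mpr (congrArg Nat.Prime h.1) hr), u, 0, hu,
      F.metaSub_le_metaSub hprm hm k hk ?_,
      F.metaSub_le_metaSub_prime (hprm.trans hm) (dvd_mul_left r p) ?_⟩
    · exact (Nat.Coprime.coprime_dvd_left (hk ▸ dvd_mul_right _ k) h2).symm
    · change r * c' ≡ (u * r + 0 * (1 - α ^ ordMod p α)) * geomSum (α ^ ordMod p α) k
        [ZMOD ((p * r : ℕ) : ℤ)]
      push_cast
      rw [zero_mul, add_zero, mul_assoc]
      refine Int.ModEq.trans ?_ ((F.mul_geomSum_pow_modEq hpn r k).mul_left u).symm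
      rw [mul_comm (p : ℤ), ← mul_assoc, mul_comm u, mul_assoc]
      refine Int.ModEq.mul_left' ?_
      have h5 := hv.mul_left c'
      rw [mul_one, ← mul_assoc] at h5
      exact ((hup.mul_right (k : ℤ)).trans h5).symm
    · change (r : ℤ) ∣ u * r + 0 * (1 - α ^ ordMod p α)
      exact ⟨u, by ring⟩
  push Not at h3
  have hone : r ∣ m' → ordMod r α = 1 := fun h => by
    have h5 : ordMod r α ∣ i := (ordMod_dvd_iff hcr i).2 (h1 r hr h).2
    exact Nat.eq_one_of_dvd_coprimes h2 h5 dvd_rfl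
  -- Here x₀ is a fixed residue of the generator modulo r².
  by_cases h5 : r ∣ m' ∧ ∃ x₀, (r * r : ℤ) ∣ x₀ * (α ^ i - 1) + r * c'
  · left
    obtain ⟨hrm', x₀, hx₀⟩ := h5
    have hprm : r * r ∣ r * m' := mul_dvd_mul_left r hrm'
    refine ⟨.fam2 r r, ⟨hr, hrn, hr, hrn, hprm.trans hm⟩,
      fun h => not_prime_mul_prime hr hr (Eq.mpr (congrArg Nat.Prime h.1) hr), 1, x₀, isCoprime_one_left,
      F.metaSub_le_metaSub hprm hm i (by simp [FamilyMember.exponent]) ?_,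
      F.metaSub_le_metaSub_prime (hprm.trans hm) (dvd_mul_left r r) ?_⟩
    · change r * c' ≡ (1 * 0 + x₀ * (1 - α ^ 1)) * geomSum (α ^ 1) i [ZMOD ((r * r : ℕ) : ℤ)]
      rw [mul_zero, zero_add, mul_one_sub_mul_geomSum]
      push_cast
      obtain ⟨q, hq⟩ := hx₀
      exact Int.modEq_iff_dvd.2 ⟨-q, by linear_combination -hq⟩
    · change (r : ℤ) ∣ 1 * 0 + x₀ * (1 - α ^ 1)
      have h6 := (ordMod_dvd_iff hcr 1).1 (by rw [hone hrm'])
      rw [mul_zero, zero_add]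
      exact Dvd.dvd.mul_left (by rw [← neg_sub]; exact h6.neg_right) x₀
  right
  intro x k z
  obtain ⟨t₀, ht₀⟩ := exists_mul_natModEq hor h2 k
  set o := ordMod r α with ho
  -- After t₀ steps the point x is in the right class modulo r; what remains is to move inside this
  -- class.
  have hx₁ : affIter (α ^ i) (r * c') t₀ x ≡ α ^ k * x + r * z [ZMOD r] := by
    refine Int.ModEq.add ?_ ?_
    · rw [← pow_mul]
      exact ((ordMod_pow_modEq hcr _ _).2 ht₀).mul_right x
    · exact (Int.modEq_zero_iff_dvd.2 ⟨c' * geomSum (α ^ i) t₀, by ring⟩).trans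
        (Int.modEq_zero_iff_dvd.2 (dvd_mul_right _ _)).symm
  set x₁ := affIter (α ^ i) (r * c') t₀ x with hx₁def
  obtain ⟨z₁, hz₁⟩ := Int.modEq_iff_dvd.1 hx₁
  have hβo : (r : ℤ) ∣ (α ^ i) ^ o - 1 := by
    rw [← pow_mul]
    exact (ordMod_dvd_iff hcr _).1 (dvd_mul_left _ _)
  obtain ⟨q, hq⟩ := hβo
  have hsub : α ^ i - 1 ∣ (α ^ i) ^ o - 1 := sub_one_dvd_pow_sub_one _ _
  -- In the coordinate z of x₁ + rz the o-th iterate has multiplier (α^i)^o = 1 + rq and translation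
  -- part x₁q + c'(1 + α^i + ⋯). At a prime p ≠ r, p divides q and the translation part is ≡ c'o
  -- modulo p; at p = r one has o = 1.
  have hHD : ∀ p : ℕ, p.Prime → p ∣ m' → (p : ℤ) ∣ (α ^ i) ^ o - 1 ∧
      ¬ (p : ℤ) ∣ x₁ * q + c' * geomSum (α ^ i) o := by
    intro p hp hpm
    refine ⟨(h1 p hp hpm).2.trans hsub, fun h => ?_⟩
    by_cases hpr : p = r
    · subst hpr
      have ho1 : o = 1 := hone hpm
      rw [ho1, geomSum_one, mul_one] at h
      rw [ho1, pow_one] at hq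
      refine h5 ⟨hpm, x₁, ?_⟩
      rw [hq, show x₁ * (p * q) + p * c' = p * (x₁ * q + c') by ring]
      exact mul_dvd_mul_left _ h
    · have hpp := Nat.prime_iff_prime_int.1 hp
      have hpq : (p : ℤ) ∣ q := by
        have h6 : (p : ℤ) ∣ r * q := hq ▸ (h1 p hp hpm).2.trans hsub
        rcases hpp.dvd_or_dvd h6 with h6 | h6
        · exact absurd ((Nat.prime_dvd_prime_iff_eq hp hr).1 (Int.natCast_dvd_natCast.1 h6)) hpr
        · exact h6
      have h6 := (dvd_add_right (hpq.mul_left x₁)).1 h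
      rcases hpp.dvd_or_dvd h6 with h6 | h6
      · exact (h1 p hp hpm).1 h6
      · have h7 := (Int.ModEq.dvd_iff (geomSum_modEq_natCast (h1 p hp hpm).2 o)).1 h6
        exact h3 p hp hpm hpr (Int.natCast_dvd_natCast.1 h7)
  obtain ⟨t, ht⟩ := exists_affIter_modEq hm'0 hHD (fun h => (h4 h).trans hsub) 0 z₁
  refine ⟨o * t + t₀, ?_⟩
  rw [affIter_add, ← hx₁def, affIter_mul, affIter_eq]
  have h6 : α ^ k * x + r * z = x₁ + r * z₁ := by linear_combination hz₁
  have h7 : (((α ^ i) ^ o - 1) * x₁ + r * c' * geomSum (α ^ i) o) * geomSum ((α ^ i) ^ o) t =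
      r * affIter ((α ^ i) ^ o) (x₁ * q + c' * geomSum (α ^ i) o) t 0 := by
    rw [affIter, hq]; ring
  rw [h6, h7]
  push_cast
  exact ht.mul_left'.add_left x₁

/-- The hypothesis on c says that w^c a^i lies in ⟨wa, w^4⟩. For even i this gives family 5. For odd
i, β = α^i is −1 modulo 4, and the square of the generator preserves classes modulo 4; Hull–Dobell
on a class can fail only at an odd prime (family 4) or at 2, which needs 8 ∣ m and 8 ∣ β + 1 (family
6). -/
lemma liesInFamily_or_orbits_four (F : AffineFrame a w ω n α) (hα : α ≡ -1 [ZMOD 4]) {i : ℕ}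
    {c : ℤ} {m : ℕ} (hm : m ∣ n) (h4m : 4 ∣ m) (hc : c ≡ (i % 2 : ℕ) [ZMOD 4]) :
    LiesInFamily a w n α (metaSub a w 1 1 4) 4 (metaSub a w i c m) ∨
      ∀ (x : ℤ) (k : ℕ) (z : ℤ), ∃ t, affIter (α ^ i) c t x ≡
        affIter α 1 k x + 4 * z [ZMOD m] := by
  have h4n : 4 ∣ n := h4m.trans hm
  have hαodd := F.not_two_dvd (Dvd.dvd.trans (by norm_num) h4n)
  rcases Nat.mod_two_eq_zero_or_one i with hi | hi
  · left
    refine ⟨.fam5, ⟨h4n, hα⟩, fun h => by simp [FamilyMember.exponent] at h, 1, 0,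
      isCoprime_one_left, F.metaSub_le_metaSub h4m hm (i / 2) ?_ ?_,
      F.metaSub_le_metaSub dvd_rfl h4n 2 (by simp [FamilyMember.exponent]) ?_⟩
    · simp only [FamilyMember.exponent]; omega
    · change c ≡ (1 * 0 + 0 * (1 - α ^ 2)) * geomSum (α ^ 2) (i / 2) [ZMOD 4]
      simpa [hi] using hc
    · change 1 * 0 + 0 * (1 - α ^ 2) ≡ 1 * geomSum (α ^ 1) 2 [ZMOD 4]
      simp only [geomSum, Finset.sum_range_succ, Finset.sum_range_zero, pow_one, pow_zero]
      simp only [Int.ModEq] at hα ⊢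
      omega
  rw [hi] at hc
  have hβ : α ^ i ≡ -1 [ZMOD 4] := by
    have := hα.pow i
    rwa [(Nat.odd_iff.2 hi).neg_one_pow] at this
  have hle : ∀ {c' : ℤ} {m' : ℕ}, 4 ∣ m' → m' ∣ n → c' ≡ 1 [ZMOD 4] →
      metaSub a w 1 c' m' ≤ metaSub a w 1 1 4 := fun h h' h'' =>
    F.metaSub_le_metaSub h h' 1 rfl (by simpa using h'')
  have h41 : (4 : ℤ) ∣ α + 1 := by
    have := Int.modEq_iff_dvd.1 hα.symm; simpa using this
  by_cases h1 : ∃ p : ℕ, p.Prime ∧ p ≠ 2 ∧ p ∣ m ∧ ((p : ℤ) ∣ c ∨ ¬ (p : ℤ) ∣ α ^ i - 1)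
  · left
    obtain ⟨p, hp, hp2, hpm, hpc⟩ := h1
    obtain ⟨b₁, hb₁⟩ := exists_modEq_mul_one_sub hp hpc
    have hpodd : ¬ (2 : ℤ) ∣ p := fun h => hp2
      ((Nat.prime_dvd_prime_iff_eq Nat.prime_two hp).1 (Int.natCast_dvd_natCast.1 h)).symm
    obtain ⟨b₂, hb₂⟩ := exists_odd_modEq (c := c) (r := p) hα hi
      (by push_cast at hc; simp only [Int.ModEq] at hc; omega) hpodd
    have hcop4 : Nat.Coprime 4 p := by
      rw [show 4 = 2 ^ 2 by norm_num]
      exact Nat.Coprime.pow_left 2 ((Nat.coprime_primes Nat.prime_two hp).2 (Ne.symm hp2))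
    -- One translation b must serve modulo p (fixed residue) and modulo 4 (matching odd residues).
    obtain ⟨b, hb, hb'⟩ := exists_modEq_and_modEq (Nat.isCoprime_iff_coprime.2 hcop4.symm) b₁ b₂
    have hprm : 4 * p ∣ m := Nat.Coprime.mul_dvd_of_dvd_of_dvd hcop4 h4m hpm
    have e4 : c ≡ (p + b * (1 - α ^ 1)) * geomSum (α ^ 1) i [ZMOD 4] :=
      hb₂.trans (((hb'.symm.mul_right _).add_left _).mul_right _)
    refine ⟨.fam4 p, ⟨hp, hpm.trans hm, hp2, h4n, hα⟩, fun h => ?_, 1, b, isCoprime_one_left,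
      F.metaSub_le_metaSub hprm hm i (by simp [FamilyMember.exponent]) ?_,
      hle (dvd_mul_right 4 p) (hprm.trans hm) ?_⟩
    · have h5 : 4 * p = 4 := h.1
      exact hp.one_lt.ne' (by omega)
    · change c ≡ (1 * p + b * (1 - α ^ 1)) * geomSum (α ^ 1) i [ZMOD ((4 * p : ℕ) : ℤ)]
      push_cast
      rw [one_mul, ← Int.modEq_and_modEq_iff_modEq_mul (by simpa using hcop4)]
      refine ⟨e4, ?_⟩
      rw [add_mul, mul_one_sub_mul_geomSum]
      have h5 : (p : ℤ) * geomSum (α ^ 1) i ≡ 0 [ZMOD p] :=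
        Int.modEq_zero_iff_dvd.2 (dvd_mul_right _ _)
      have h6 := h5.add (hb.mul_right (1 - α ^ i))
      rw [zero_add] at h6
      exact hb₁.trans h6.symm
    · change 1 * (p : ℤ) + b * (1 - α ^ 1) ≡ 1 [ZMOD 4]
      have h5 := e4.trans ((geomSum_modEq_one_of_odd h41 hi).mul_left _)
      rw [mul_one] at h5
      rw [one_mul]
      exact h5.symm.trans (by simpa using hc)
  push Not at h1
  by_cases h8 : 8 ∣ m ∧ (8 : ℤ) ∣ α ^ i + 1
  · left
    obtain ⟨h8m, h8⟩ := h8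
    -- Odd squares are 1 modulo 8, so α^i ≡ α for odd i.
    have hα8 : α ≡ -1 [ZMOD 8] := by
      have hsq : α ^ 2 ≡ 1 [ZMOD 8] := by
        have h5 : α ≡ 3 [ZMOD 8] ∨ α ≡ -1 [ZMOD 8] := by simp only [Int.ModEq] at hα ⊢; omega
        rcases h5 with h5 | h5 <;> exact (h5.pow 2).trans (by decide)
      have h5 : α ^ i ≡ α [ZMOD 8] := by
        conv_lhs => rw [← Nat.div_add_mod i 2, hi, pow_add, pow_mul]
        simpa using (hsq.pow (i / 2)).mul_right α
      refine h5.symm.trans (Int.modEq_iff_dvd.2 ?_)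
      rw [← neg_add', dvd_neg, add_comm]; exact h8
    have h81 : (8 : ℤ) ∣ α + 1 := by
      have := Int.modEq_iff_dvd.1 hα8.symm; simpa using this
    have hg := geomSum_modEq_one_of_odd h81 hi
    have hb : ∃ b : ℤ, c ≡ 1 + b * (1 - α) [ZMOD 8] ∧ 1 + b * (1 - α) ≡ 1 [ZMOD 4] := by
      have h5 : c ≡ 1 [ZMOD 8] ∨ c ≡ 5 [ZMOD 8] := by
        push_cast at hc; simp only [Int.ModEq] at hc ⊢; omega
      rcases h5 with h5 | h5
      · exact ⟨0, by simpa using h5, by simp⟩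
      -- Since 1 − α ≡ 2 modulo 8, b = 2 changes 1 into 5.
      · refine ⟨2, ?_, ?_⟩ <;> simp only [Int.ModEq] at h5 hα8 ⊢ <;> omega
    obtain ⟨b, hb, hb4⟩ := hb
    refine ⟨.fam6, ⟨h8m.trans hm, hα8⟩, fun h => by simp [FamilyMember.modulus] at h, 1, b,
      isCoprime_one_left, F.metaSub_le_metaSub h8m hm i (by simp [FamilyMember.exponent]) ?_,
      hle (m' := 8) (by norm_num) (h8m.trans hm) ?_⟩
    · change c ≡ (1 * 1 + b * (1 - α ^ 1)) * geomSum (α ^ 1) i [ZMOD 8]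
      have h5 := hg.mul_left (1 * 1 + b * (1 - α ^ 1))
      rw [mul_one] at h5
      refine Int.ModEq.trans ?_ h5.symm
      simpa using hb
    · change 1 * 1 + b * (1 - α ^ 1) ≡ 1 [ZMOD 4]
      simpa using hb4
  right
  intro x k z
  have hx₁ : affIter (α ^ i) c k x ≡ affIter α 1 k x + 4 * z [ZMOD 4] := by
    have h5 : affIter α 1 k x + 4 * z ≡ affIter α 1 k x + 0 [ZMOD 4] :=
      (Int.modEq_zero_iff_dvd.2 (dvd_mul_right 4 z)).add_left _
    rw [add_zero] at h5
    have h6 := hβ.trans hα.symm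
    exact Int.ModEq.trans (((h6.pow k).mul_right x).add
      (Int.ModEq.mul (by simpa using hc) (geomSum_modEq h6 k))) h5.symm
  obtain ⟨m', rfl⟩ := h4m
  set x₁ := affIter (α ^ i) c k x with hx₁def
  obtain ⟨z₁, hz₁⟩ := Int.modEq_iff_dvd.1 hx₁
  obtain ⟨q, hq⟩ : (4 : ℤ) ∣ α ^ i + 1 := by
    have := Int.modEq_iff_dvd.1 hβ.symm; simpa using this
  have hm'0 : 0 < m' := Nat.pos_of_mul_pos_left (Nat.pos_of_dvd_of_pos hm F.pos)
  have hsub : α ^ i - 1 ∣ (α ^ i) ^ 2 - 1 := sub_one_dvd_pow_sub_one _ _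
  have h4β : (4 : ℤ) ∣ (α ^ i) ^ 2 - 1 := by
    have h5 := hβ.pow 2
    exact Int.modEq_iff_dvd.1 (by simpa using h5.symm)
  -- With β = α^i and β + 1 = 4q, the square moves x₁ by (β + 1)((β − 1)x₁ + c), whose quotient by 4
  -- is the translation part. At 2 the factor (β − 1)x₁ + c is odd, and q is odd since 8 ∣ m.
  have hHD : ∀ p : ℕ, p.Prime → p ∣ m' → (p : ℤ) ∣ (α ^ i) ^ 2 - 1 ∧
      ¬ (p : ℤ) ∣ q * ((α ^ i - 1) * x₁ + c) := by
    intro p hp hpm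
    have hpp := Nat.prime_iff_prime_int.1 hp
    by_cases hp2 : p = 2
    · subst hp2
      refine ⟨Dvd.dvd.trans (by norm_num) h4β, fun h => ?_⟩
      have h8m : 8 ∣ 4 * m' := mul_dvd_mul_left 4 hpm
      have hq2 : ¬ (2 : ℤ) ∣ q := fun h5 => h8 ⟨h8m, hq ▸ mul_dvd_mul_left 4 h5⟩
      rcases hpp.dvd_or_dvd h with h | h
      · exact hq2 h
      · have h5 : (2 : ℤ) ∣ (α ^ i - 1) * x₁ := Dvd.dvd.mul_right (by omega) x₁
        have h6 := (dvd_add_right h5).1 h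
        push_cast at hc
        simp only [Int.ModEq] at hc
        omega
    · obtain ⟨h5, h6⟩ := h1 p hp hp2 (hpm.mul_left 4)
      refine ⟨h6.trans hsub, fun h => ?_⟩
      rcases hpp.dvd_or_dvd h with h | h
      · have h7 : (p : ℤ) ∣ α ^ i + 1 := hq ▸ h.mul_left 4
        have h8 : (p : ℤ) ∣ ((2 : ℕ) : ℤ) := by
          rw [show ((2 : ℕ) : ℤ) = (α ^ i + 1) - (α ^ i - 1) by push_cast; ring]
          exact dvd_sub h7 h6
        exact hp2 ((Nat.prime_dvd_prime_iff_eq hp Nat.prime_two).1 (Int.natCast_dvd_natCast.1 h8))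
      · exact h5 ((dvd_add_right (h6.mul_right x₁)).1 h)
  obtain ⟨t, ht⟩ := exists_affIter_modEq hm'0 hHD (fun _ => h4β) 0 z₁
  refine ⟨2 * t + k, ?_⟩
  rw [affIter_add, ← hx₁def, affIter_mul, affIter_eq]
  have h6 : affIter α 1 k x + 4 * z = x₁ + 4 * z₁ := by linear_combination hz₁
  have h7 : (((α ^ i) ^ 2 - 1) * x₁ + c * geomSum (α ^ i) 2) * geomSum ((α ^ i) ^ 2) t =
      4 * affIter ((α ^ i) ^ 2) (q * ((α ^ i - 1) * x₁ + c)) t 0 := by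
    rw [affIter]
    simp only [geomSum, Finset.sum_range_succ, Finset.sum_range_zero, pow_one, pow_zero]
    linear_combination ((α ^ i - 1) * x₁ + c) *
      (∑ l ∈ Finset.range t, ((α ^ i) ^ 2) ^ l) * hq
  rw [h6, h7]
  push_cast
  exact ht.mul_left'.add_left x₁

end AffineFrame

/-! ### Maximal and second maximal relatively closed subgroups -/

lemma conjSubgroup_conjSubgroup {Ω : Type*} (g h : Perm Ω) (H : Subgroup (Perm Ω)) :
    conjSubgroup g (conjSubgroup h H) = conjSubgroup (g * h) H := by
  ext k; simp only [mem_conjSubgroup, mul_inv_rev, mul_assoc]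

lemma conjSubgroup_one {Ω : Type*} (H : Subgroup (Perm Ω)) : conjSubgroup 1 H = H := by
  ext k; simp

/-- The representatives `⟨a, w ^ r⟩` and `⟨w * a, w ^ 4⟩` of the maximal relatively closed subgroups
of `⟨a, w⟩`, with the modulus `d` of their translations. -/
def IsMaximalRepresentative {Ω : Type*} (a w : Perm Ω) (n : ℕ) (α : ℤ) (M : Subgroup (Perm Ω))
    (d : ℕ) : Prop :=
  (d.Prime ∧ d ∣ n ∧ M = metaSub a w 1 0 d) ∨
    (4 ∣ n ∧ α ≡ -1 [ZMOD 4] ∧ M = metaSub a w 1 1 4 ∧ d = 4)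

namespace AffineFrame

variable {Ω : Type*} [Finite Ω] {a w : Perm Ω} {ω : Ω} {n : ℕ} {α : ℤ}

lemma isMaximalRepresentative_spec (F : AffineFrame a w ω n α) {M : Subgroup (Perm Ω)} {d : ℕ}
    (h : IsMaximalRepresentative a w n α M d) :
    HasIndices a w M d 1 ∧ IsRelClosed (Subgroup.closure {a, w}) M ∧
      M < Subgroup.closure {a, w} := by
  have key : HasIndices a w M d 1 ∧ IsRelClosed (Subgroup.closure {a, w}) M ∧ d ≠ 1 := by
    rcases h with ⟨hd, hdn, rfl⟩ | ⟨h4, hα, rfl, rfl⟩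
    · exact ⟨F.hasIndices_metaSub_zero hdn (one_dvd _),
        F.isRelClosed_metaSub_zero hdn (one_dvd _), hd.ne_one⟩
    · have hc : ((4 : ℕ) : ℤ) ∣ 1 * (α + 1) := by
        have := Int.modEq_iff_dvd.1 hα.symm; simpa using this
      exact ⟨F.hasIndices_metaSub_one h4 hα h4 hc,
        F.isRelClosed_metaSub_one h4 hα h4 hc (by decide), by norm_num⟩
  obtain ⟨h1, h2, h3⟩ := key
  refine ⟨h1, h2, lt_of_le_of_ne (isRelClosed_iff.1 h2).1 fun h => h3 ?_⟩
  have hw : w ^ (1 : ℤ) ∈ M := by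
    rw [h, zpow_one]; exact Subgroup.subset_closure (by simp)
  exact Nat.dvd_one.1 (by exact_mod_cast (h1.zpow_mem 1).1 hw)

lemma metaSub_conj_one (F : AffineFrame a w ω n α) (i : ℕ) (c : ℤ) (m : ℕ) {u : ℤ}
    (hu : IsCoprime u n) (b : ℤ) : ∃ g ∈ holomorph (Subgroup.zpowers w) ω,
      conjSubgroup g (metaSub a w i c m) = metaSub a w i (u * c + b * (1 - α ^ i)) m := by
  obtain ⟨g, hg, hgub⟩ := F.exists_mem_holomorph hu b
  exact ⟨g, hg, F.metaSub_conj hgub hu i c⟩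

lemma le_conj_isMaximalRepresentative (F : AffineFrame a w ω n α) {K : Subgroup (Perm Ω)}
    (hK : IsRelClosed (Subgroup.closure {a, w}) K) (hKG : K < Subgroup.closure {a, w}) :
    ∃ M d, IsMaximalRepresentative a w n α M d ∧
      ∃ g ∈ holomorph (Subgroup.zpowers w) ω, K ≤ conjSubgroup g M := by
  obtain ⟨i, c, m, hm, rfl⟩ := F.exists_eq_metaSub hKG.le
  rcases F.le_maximal_or_transitive i c hm with ⟨p, hp, hpn, b, h⟩ | ⟨h4, hα, b, h⟩ | h
  · obtain ⟨g, hg, hgM⟩ := F.metaSub_conj_one 1 0 p isCoprime_one_left b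
    exact ⟨_, p, Or.inl ⟨hp, hpn, rfl⟩, g, hg, by rw [hgM]; simpa using h⟩
  · obtain ⟨g, hg, hgM⟩ := F.metaSub_conj_one 1 1 4 isCoprime_one_left b
    exact ⟨_, 4, Or.inr ⟨h4, hα, rfl, rfl⟩, g, hg, by rw [hgM]; simpa using h⟩
  · exfalso
    refine hKG.not_ge fun g hg => (isRelClosed_iff.1 hK).2 g hg fun p => ?_
    obtain ⟨x, rfl⟩ := F.surj p
    obtain ⟨y, hy⟩ := F.surj (g ((w ^ x) ω))
    rw [← hy, F.orbit_metaSub hm]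
    obtain ⟨k, hk⟩ := h x y
    exact ⟨k, hk.symm⟩

/-- A closed K above M lies in a conjugate of a representative M'. The moduli satisfy d' ∣ d, which
forces d' = d unless d' = 2 and d = 4; equal indices then collapse the chain. -/
lemma isMaximalRelClosedIn_of_isMaximalRepresentative (F : AffineFrame a w ω n α)
    {M : Subgroup (Perm Ω)} {d : ℕ} (h : IsMaximalRepresentative a w n α M d) :
    IsMaximalRelClosedIn (Subgroup.closure {a, w}) (Subgroup.closure {a, w}) M := by
  obtain ⟨h1, h2, h3⟩ := F.isMaximalRepresentative_spec h
  refine ⟨⟨h2, h3⟩, fun K hK hMK => ?_⟩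
  obtain ⟨M', d', h', g, hg, hKM'⟩ := F.le_conj_isMaximalRepresentative hK.1 hK.2
  obtain ⟨h1', h2', h3'⟩ := F.isMaximalRepresentative_spec h'
  have hi := F.hasIndices_conj h1' hg
  have hle : M ≤ conjSubgroup g M' := hMK.trans hKM'
  have hdd := (h1.dvd_of_le hi hle).1
  have hd : d' = d := by
    rcases h with ⟨hd, hdn, rfl⟩ | ⟨h4, hα, rfl, rfl⟩ <;>
      rcases h' with ⟨hd', hdn', rfl⟩ | ⟨h4', hα', rfl, rfl⟩
    · exact (Nat.prime_dvd_prime_iff_eq hd' hd).1 hdd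
    · exact absurd ((Nat.dvd_prime hd).1 hdd) (by
        rintro (h | h)
        · omega
        · exact absurd (h ▸ hd) (by norm_num))
    -- The permutation wa exchanges even and odd coordinates, whereas every conjugate of ⟨a, w²⟩
    -- preserves parity.
    · exfalso
      obtain rfl : d' = 2 := by
        have : d' ∣ 2 ^ 2 := hdd
        exact (Nat.prime_dvd_prime_iff_eq hd' Nat.prime_two).1 (hd'.dvd_of_dvd_pow this)
      obtain ⟨u, b, hu, hgub⟩ := F.exists_isAffineMap_of_mem_holomorph (inv_mem hg)
      have hwa : w ^ (1 : ℤ) * a ^ 1 ∈ conjSubgroup g (metaSub a w 1 0 2) :=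
        hle (Subgroup.subset_closure (by simp))
      have hwa' := mem_conjSubgroup.1 hwa
      have hc := F.zpow_mul_pow_conj hgub 1 1
      rw [inv_inv] at hc
      rw [hc, F.mem_metaSub_zero hdn' (one_dvd _), pow_one] at hwa'
      have hu2 := hu.of_isCoprime_of_dvd_right (Int.natCast_dvd_natCast.2 hdn')
      have hα2 : (2 : ℤ) ∣ 1 - α := by simp only [Int.ModEq] at hα; omega
      have := (dvd_add_left (hα2.mul_left b)).1 hwa'.1
      rw [mul_one] at this
      exact absurd (hu2.isUnit_of_dvd' this dvd_rfl) (by decide)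
    · rfl
  subst hd
  rw [h1.eq_of_le F hi hle]
  · exact hKM'
  · rw [← F.conjSubgroup_closure hg]
    exact conjSubgroup_mono g h3'.le

lemma exists_eq_conj_of_isMaximalRelClosedIn (F : AffineFrame a w ω n α) {M : Subgroup (Perm Ω)}
    (hM : IsMaximalRelClosedIn (Subgroup.closure {a, w}) (Subgroup.closure {a, w}) M) :
    ∃ M' d, IsMaximalRepresentative a w n α M' d ∧
      ∃ g ∈ holomorph (Subgroup.zpowers w) ω, M = conjSubgroup g M' := by
  obtain ⟨M', d, h, g, hg, hle⟩ := F.le_conj_isMaximalRepresentative hM.1.1 hM.1.2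
  obtain ⟨-, h2, h3⟩ := F.isMaximalRepresentative_spec h
  have hG := F.conjSubgroup_closure hg
  refine ⟨M', d, h, g, hg, le_antisymm hle (hM.2 ⟨isRelClosed_conj hG h2, ?_⟩ hle)⟩
  rwa [conjSubgroup_lt_iff, conjSubgroup_inv_eq hG]

/-- If K had the orbits of M, closedness would give K = M; so Hull–Dobell fails for K on some class.
The family member obtained is properly below M because its indices differ from (d, 1). -/
lemma exists_family_of_lt (F : AffineFrame a w ω n α) {M K : Subgroup (Perm Ω)} {d : ℕ}
    (h : IsMaximalRepresentative a w n α M d) (hK : IsRelClosed (Subgroup.closure {a, w}) K)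
    (hKM : K < M) : ∃ f : FamilyMember, f.Valid n α ∧ ¬ (f.modulus = d ∧ f.exponent α = 1) ∧
      ∃ g ∈ holomorph (Subgroup.zpowers w) ω, K ≤ conjSubgroup g (f.subgroup a w α) ∧
        conjSubgroup g (f.subgroup a w α) < M := by
  obtain ⟨h1, h2, h3⟩ := F.isMaximalRepresentative_spec h
  have key : LiesInFamily a w n α M d K := by
    obtain ⟨i, c, m, hm, rfl⟩ := F.exists_eq_metaSub (isRelClosed_iff.1 hK).1
    have hwm : w ^ ((m : ℕ) : ℤ) ∈ M :=
      hKM.le (by rw [zpow_natCast]; exact Subgroup.subset_closure (by simp))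
    have hdm : d ∣ m := Int.natCast_dvd_natCast.1 ((h1.zpow_mem m).1 hwm)
    have hca : w ^ c * a ^ i ∈ M := hKM.le (Subgroup.subset_closure (by simp))
    rcases h with ⟨hd, hdn, rfl⟩ | ⟨h4, hα, rfl, rfl⟩
    · refine (F.liesInFamily_or_orbits_prime hd hm hdm
        ((F.mem_metaSub_zero hdn (one_dvd _) c i).1 hca).1).resolve_right fun horb => ?_
      refine hKM.not_ge fun g hg => (isRelClosed_iff.1 hK).2 g (h3.le hg) fun p => ?_
      obtain ⟨x, rfl⟩ := F.surj p
      obtain ⟨y, hy⟩ := F.surj (g ((w ^ x) ω))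
      have hy' : (w ^ y) ω ∈ orbit (metaSub a w 1 0 d) ((w ^ x) ω) := ⟨⟨g, hg⟩, hy.symm⟩
      obtain ⟨k, hk⟩ := (F.orbit_metaSub hdn).1 hy'
      rw [← hy, F.orbit_metaSub hm]
      obtain ⟨z, hz⟩ := Int.modEq_iff_dvd.1 hk
      obtain ⟨t, ht⟩ := horb x k (-z)
      refine ⟨t, ?_⟩
      have e : y = α ^ k * x + d * -z := by
        rw [affIter, pow_one] at hz; linear_combination -hz
      rw [e]; exact ht.symm
    · have hc : ((4 : ℕ) : ℤ) ∣ 1 * (α + 1) := by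
        have := Int.modEq_iff_dvd.1 hα.symm; simpa using this
      have hci := (F.mem_metaSub_one h4 hα h4 hc c i).1 hca
      rw [one_mul] at hci
      refine (F.liesInFamily_or_orbits_four hα hm hdm hci).resolve_right fun horb => ?_
      refine hKM.not_ge fun g hg => (isRelClosed_iff.1 hK).2 g (h3.le hg) fun p => ?_
      obtain ⟨x, rfl⟩ := F.surj p
      obtain ⟨y, hy⟩ := F.surj (g ((w ^ x) ω))
      have hy' : (w ^ y) ω ∈ orbit (metaSub a w 1 1 4) ((w ^ x) ω) := ⟨⟨g, hg⟩, hy.symm⟩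
      obtain ⟨k, hk⟩ := (F.orbit_metaSub h4).1 hy'
      rw [← hy, F.orbit_metaSub hm]
      obtain ⟨z, hz⟩ := Int.modEq_iff_dvd.1 hk
      obtain ⟨t, ht⟩ := horb x k (-z)
      refine ⟨t, ?_⟩
      have e : y = affIter α 1 k x + 4 * -z := by
        rw [pow_one] at hz; push_cast at hz; linear_combination -hz
      rw [e]; exact ht.symm
  obtain ⟨f, hf, hne, u, b, hu, hle, hleM⟩ := key
  obtain ⟨g, hg, hgf⟩ := F.metaSub_conj_one (f.exponent α) f.shift f.modulus hu b
  rw [← hgf, ← FamilyMember.subgroup_eq] at hle hleM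
  refine ⟨f, hf, hne, g, hg, hle, lt_of_le_of_ne hleM fun he => hne ?_⟩
  have hi := F.hasIndices_conj (F.family_spec hf).1 hg
  exact ⟨Nat.dvd_antisymm (h1.dvd_of_le hi he.ge).1 (hi.dvd_of_le h1 he.le).1,
    Nat.dvd_antisymm (h1.dvd_of_le hi he.ge).2 (hi.dvd_of_le h1 he.le).2⟩

lemma exists_family_of_isSecondMaximalRelClosed (F : AffineFrame a w ω n α)
    {H : Subgroup (Perm Ω)} (hH : IsSecondMaximalRelClosed (Subgroup.closure {a, w}) H) :
    ∃ f : FamilyMember, f.Valid n α ∧ f.Ordered ∧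
      ∃ g ∈ holomorph (Subgroup.zpowers w) ω, f.subgroup a w α = conjSubgroup g H := by
  obtain ⟨M, hM, hHM⟩ := hH
  obtain ⟨M', d, h, g, hg, rfl⟩ := F.exists_eq_conj_of_isMaximalRelClosedIn hM
  have hG := F.conjSubgroup_closure (inv_mem hg)
  have hH' := isMaximalRelClosedIn_conj hG hHM
  rw [conjSubgroup_inv_conjSubgroup] at hH'
  obtain ⟨f, hf, -, g', hg', hle, hlt⟩ := F.exists_family_of_lt h hH'.1.1 hH'.1.2
  have heq := le_antisymm hle (hH'.2
    ⟨isRelClosed_conj (F.conjSubgroup_closure hg') (F.family_spec hf).2, hlt⟩ hle)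
  have hconj : f.subgroup a w α = conjSubgroup (g'⁻¹ * g⁻¹) H := by
    rw [← conjSubgroup_conjSubgroup, heq, conjSubgroup_inv_conjSubgroup]
  have hmem := mul_mem (inv_mem hg') (inv_mem hg)
  by_cases ho : f.Ordered
  · exact ⟨f, hf, ho, _, hmem, hconj⟩
  · cases f with
    | fam2 s r =>
      refine ⟨.fam2 r s, ⟨hf.2.2.1, hf.2.2.2.1, hf.1, hf.2.1, ?_⟩, (not_le.1 ho).le, _, hmem, ?_⟩
      · rw [mul_comm]; exact hf.2.2.2.2
      · rw [← hconj, FamilyMember.subgroup, FamilyMember.subgroup, mul_comm]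
    | _ => exact absurd trivial ho

/-- A maximal relatively closed subgroup above a conjugate of a member of a family. -/
lemma exists_isMaximalRepresentative_gt (F : AffineFrame a w ω n α) {f : FamilyMember}
    (hf : f.Valid n α) : ∃ M d, IsMaximalRepresentative a w n α M d ∧
      (∃ g ∈ holomorph (Subgroup.zpowers w) ω, conjSubgroup g (f.subgroup a w α) < M) ∧
      ∀ f' : FamilyMember, f'.Valid n α → ¬ (f'.modulus = d ∧ f'.exponent α = 1) → d ∣ f'.modulus →
        f'.modulus ∣ f.modulus → f'.exponent α ∣ f.exponent α →
        (∃ g ∈ holomorph (Subgroup.zpowers w) ω,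
          f.subgroup a w α ≤ conjSubgroup g (f'.subgroup a w α)) →
        f'.modulus = f.modulus ∧ f'.exponent α = f.exponent α := by
  have hlt' : ∀ {M : Subgroup (Perm Ω)} {d : ℕ}, IsMaximalRepresentative a w n α M d →
      ∀ g ∈ holomorph (Subgroup.zpowers w) ω, conjSubgroup g (f.subgroup a w α) ≤ M →
        ¬ (f.modulus = d ∧ f.exponent α = 1) → conjSubgroup g (f.subgroup a w α) < M := by
    intro M d hM g hg hle hne
    refine lt_of_le_of_ne hle fun he => hne ?_
    have h1 := (F.isMaximalRepresentative_spec hM).1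
    have hi := F.hasIndices_conj (F.family_spec hf).1 hg
    exact ⟨Nat.dvd_antisymm (h1.dvd_of_le hi he.ge).1 (hi.dvd_of_le h1 he.le).1,
      Nat.dvd_antisymm (h1.dvd_of_le hi he.ge).2 (hi.dvd_of_le h1 he.le).2⟩
  have hlt : ∀ {M : Subgroup (Perm Ω)} {d : ℕ}, IsMaximalRepresentative a w n α M d →
      f.subgroup a w α ≤ M → ¬ (f.modulus = d ∧ f.exponent α = 1) →
        ∃ g ∈ holomorph (Subgroup.zpowers w) ω, conjSubgroup g (f.subgroup a w α) < M :=
    fun hM hle hne => ⟨1, one_mem _, hlt' hM 1 (one_mem _) (by rwa [conjSubgroup_one]) hne⟩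
  have hm := F.modulus_dvd hf
  -- There is room for only one prime between d and the modulus of f, so f' has the indices of M or
  -- those of f.
  have hmul : ∀ {s r m : ℕ}, s.Prime → 0 < r → r ∣ m → m ∣ s * r → m = r ∨ m = s * r := by
    rintro s r _ hs hr ⟨q, rfl⟩ hq
    rw [mul_comm s] at hq
    rcases (Nat.dvd_prime hs).1 (Nat.dvd_of_mul_dvd_mul_left hr hq) with rfl | rfl
    · left; rw [mul_one]
    · right; rw [mul_comm]
  cases f with
  | fam1 s r =>
    have hM : IsMaximalRepresentative a w n α (metaSub a w 1 0 r) r := Or.inl ⟨hf.1, hf.2.1, rfl⟩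
    refine ⟨_, r, hM, hlt hM ?_ fun h => hf.2.2.1.ne_one h.2, fun f' hf' hne hd hmod hexp _ => ?_⟩
    · rw [FamilyMember.subgroup_eq]
      exact F.metaSub_le_metaSub_prime hm dvd_rfl (dvd_zero _)
    · have he : f'.modulus = r := Nat.dvd_antisymm hmod hd
      refine ⟨he, ?_⟩
      rcases (Nat.dvd_prime hf.2.2.1).1 hexp with h | h
      · exact absurd ⟨he, h⟩ hne
      · exact h
  | fam2 s r =>
    have hM : IsMaximalRepresentative a w n α (metaSub a w 1 0 r) r :=
      Or.inl ⟨hf.2.2.1, hf.2.2.2.1, rfl⟩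
    refine ⟨_, r, hM, hlt hM ?_ fun h => not_prime_mul_prime hf.1 hf.2.2.1
      (Eq.mpr (congrArg Nat.Prime h.1) hf.2.2.1), fun f' hf' hne hd hmod hexp _ => ?_⟩
    · rw [FamilyMember.subgroup_eq]
      exact F.metaSub_le_metaSub_prime hm (dvd_mul_left r s) (dvd_zero _)
    · have he : f'.exponent α = 1 := Nat.dvd_one.1 hexp
      refine ⟨(hmul hf.1 hf.2.2.1.pos hd hmod).resolve_left fun h => hne ⟨h, he⟩, he⟩
  | fam3 s r =>
    have hM : IsMaximalRepresentative a w n α (metaSub a w 1 0 r) r :=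
      Or.inl ⟨hf.1, hf.2.1, rfl⟩
    refine ⟨_, r, hM, hlt hM ?_ fun h => not_prime_mul_prime hf.2.2.1 hf.1
      (Eq.mpr (congrArg Nat.Prime h.1) hf.1), ?_⟩
    · rw [FamilyMember.subgroup_eq]
      exact F.metaSub_le_metaSub_prime hm (dvd_mul_left r s) dvd_rfl
    · rintro f' hf' hne hd hmod hexp ⟨g, hg, hle⟩
      rcases hmul hf.2.2.1 hf.1.pos hd hmod with he | he
      · exfalso
        rcases f' with ⟨s', r'⟩ | ⟨s', r'⟩ | ⟨s', r'⟩ | ⟨r'⟩ | _ | _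
        -- Here s' would divide both ord_r(α) and ord_s(α), which are coprime.
        · obtain rfl : r' = r := he
          have h1 : s' ∣ ordMod s α := hexp
          exact hf'.2.2.1.one_lt.ne' (Nat.eq_one_of_dvd_coprimes hf.2.2.2.2.2 hf'.2.2.2 h1)
        · exact not_prime_mul_prime hf'.1 hf'.2.2.1 (Eq.mpr (congrArg Nat.Prime he) hf.1)
        · exact not_prime_mul_prime hf'.2.2.1 hf'.1 (Eq.mpr (congrArg Nat.Prime he) hf.1)
        · exact not_prime_four_mul r' (Eq.mpr (congrArg Nat.Prime he) hf.1)
        · exact absurd (Eq.mpr (congrArg Nat.Prime he) hf.1) (by decide)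
        · exact absurd (Eq.mpr (congrArg Nat.Prime he) hf.1) (by decide)
      · have hlt := F.family_lt hf
        rcases f' with ⟨s', r'⟩ | ⟨s', r'⟩ | ⟨s', r'⟩ | ⟨r'⟩ | _ | _
        · exact absurd (Eq.mpr (congrArg Nat.Prime he.symm) hf'.1)
            (not_prime_mul_prime hf.2.2.1 hf.1)
        · exact absurd hle (F.not_fam3_le_conj_fam2 hf (F.modulus_dvd hf')
            (Dvd.intro r (Eq.symm he)) hg)
        · obtain ⟨rfl, rfl⟩ := primes_eq_of_mul_eq_mul hf'.2.2.1 hf.2.2.1 hf.1 he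
            (F.family_lt hf').le hlt.le
          exact ⟨rfl, rfl⟩
        · exact absurd (Eq.symm he) (mul_ne_four_mul hf.2.2.1 hf.1 hf'.1)
        · have h2 := primes_eq_of_mul_eq_mul (s' := 2) (r' := 2) hf.2.2.1 Nat.prime_two
            Nat.prime_two (Eq.symm he) hlt.le le_rfl
          omega
        · exact absurd (Eq.symm he) (mul_ne_four_mul (t := 2) hf.2.2.1 hf.1 Nat.prime_two)
  | fam4 r =>
    obtain ⟨hr, hrn, hr2, h4, hα⟩ := id hf
    -- With ⟨wa, w^4⟩ as M only the prime r separates the moduli 4 and 4r. As r may be 3 modulo 4, a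
    -- conjugation is needed to reach M.
    have hM : IsMaximalRepresentative a w n α (metaSub a w 1 1 4) 4 :=
      Or.inr ⟨h4, hα, rfl, rfl⟩
    have hrodd : ¬ (2 : ℤ) ∣ r := fun h => hr2
      ((Nat.prime_dvd_prime_iff_eq Nat.prime_two hr).1 (Int.natCast_dvd_natCast.1 h)).symm
    obtain ⟨b, hb⟩ := exists_odd_modEq (c := r) (r := 1) (i := 1) hα rfl hrodd (by norm_num)
    obtain ⟨g, hg, hgM⟩ := F.metaSub_conj_one 1 1 4 isCoprime_one_left b
    have hle : (FamilyMember.fam4 r).subgroup a w α ≤ conjSubgroup g (metaSub a w 1 1 4) := by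
      rw [hgM, FamilyMember.subgroup_eq]
      exact F.metaSub_le_metaSub (dvd_mul_right 4 r) hm 1 rfl (by rw [one_mul]; exact hb)
    refine ⟨_, 4, hM, ⟨g⁻¹, inv_mem hg, hlt' hM g⁻¹ (inv_mem hg) ?_ fun h => ?_⟩,
      fun f' hf' hne hd hmod hexp _ => ?_⟩
    · rwa [conjSubgroup_le_iff, inv_inv]
    · have h5 : 4 * r = 4 := h.1
      exact hr.one_lt.ne' (by omega)
    · have he : f'.exponent α = 1 := Nat.dvd_one.1 hexp
      have hmod' : f'.modulus ∣ r * 4 := by rw [mul_comm]; exact hmod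
      refine ⟨?_, he⟩
      have := (hmul hr (by norm_num) hd hmod').resolve_left fun h => hne ⟨h, he⟩
      rw [this, mul_comm]; rfl
  | fam5 =>
    have hM : IsMaximalRepresentative a w n α (metaSub a w 1 1 4) 4 :=
      Or.inr ⟨hf.1, hf.2, rfl, rfl⟩
    refine ⟨_, 4, hM, hlt hM ?_ fun h => absurd h.2 (Nat.succ_ne_self 1),
      fun f' hf' hne hd hmod hexp _ => ?_⟩
    · rw [FamilyMember.subgroup_eq]
      refine F.metaSub_le_metaSub dvd_rfl hf.1 2 rfl ?_
      change 0 ≡ 1 * geomSum (α ^ 1) 2 [ZMOD 4]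
      have hα := hf.2
      simp only [geomSum, Finset.sum_range_succ, Finset.sum_range_zero, pow_one, pow_zero]
      simp only [Int.ModEq] at hα ⊢
      omega
    · have he : f'.modulus = 4 := Nat.dvd_antisymm hmod hd
      refine ⟨he, ?_⟩
      rcases (Nat.dvd_prime Nat.prime_two).1 hexp with h | h
      · exact absurd ⟨he, h⟩ hne
      · exact h
  | fam6 =>
    have hM : IsMaximalRepresentative a w n α (metaSub a w 1 1 4) 4 :=
      Or.inr ⟨Dvd.dvd.trans (by norm_num) hf.1, hf.2.of_dvd (by norm_num), rfl, rfl⟩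
    refine ⟨_, 4, hM, hlt hM ?_ fun h => absurd h.1 (by decide),
      fun f' hf' hne hd hmod hexp _ => ?_⟩
    · rw [FamilyMember.subgroup_eq]
      exact F.metaSub_le_metaSub (m := 8) (by norm_num) hf.1 1 rfl
        (by simp [FamilyMember.shift])
    · have he : f'.exponent α = 1 := Nat.dvd_one.1 hexp
      exact ⟨(hmul Nat.prime_two (by norm_num) hd hmod).resolve_left fun h => hne ⟨h, he⟩, he⟩

/-- A closed K between the member and M lies in a conjugate of some member below M. The choice of M
forces that member to have the same indices, so all inclusions are equalities. -/
lemma isSecondMaximalRelClosed_family (F : AffineFrame a w ω n α) {f : FamilyMember}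
    (hf : f.Valid n α) :
    IsSecondMaximalRelClosed (Subgroup.closure {a, w}) (f.subgroup a w α) := by
  obtain ⟨M, d, hM, ⟨g₀, hg₀, hlt⟩, hunique⟩ := F.exists_isMaximalRepresentative_gt hf
  have hG := F.conjSubgroup_closure (inv_mem hg₀)
  have hMs := F.isMaximalRepresentative_spec hM
  have hmax := F.isMaximalRelClosedIn_of_isMaximalRepresentative hM
  suffices h : IsMaximalRelClosedIn (Subgroup.closure {a, w}) M
      (conjSubgroup g₀ (f.subgroup a w α)) by
    refine ⟨conjSubgroup g₀⁻¹ M, ?_, ?_⟩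
    · simpa only [hG] using isMaximalRelClosedIn_conj hG hmax
    · simpa only [conjSubgroup_inv_conjSubgroup] using isMaximalRelClosedIn_conj hG h
  refine ⟨⟨isRelClosed_conj (F.conjSubgroup_closure hg₀) (F.family_spec hf).2, hlt⟩,
    fun K hK hle => ?_⟩
  obtain ⟨f', hf', hne, g, hg, hKg, hgM⟩ := F.exists_family_of_lt hM hK.1 hK.2
  have h1 := F.hasIndices_conj (F.family_spec hf).1 hg₀
  have h1' := F.hasIndices_conj (F.family_spec hf').1 hg
  have hle' := hle.trans hKg
  obtain ⟨hm, he⟩ := hunique f' hf' hne (h1'.dvd_of_le hMs.1 hgM.le).1 (h1.dvd_of_le h1' hle').1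
    (h1.dvd_of_le h1' hle').2 ⟨g₀⁻¹ * g, mul_mem (inv_mem hg₀) hg, by
      rw [← conjSubgroup_conjSubgroup, ← conjSubgroup_le_iff]; exact hle'⟩
  rw [hm, he] at h1'
  rw [h1.eq_of_le F h1' hle' (hgM.le.trans hMs.2.2.le)]
  exact hKg

end AffineFrame

/-! ### Orbit lengths -/

section Lengths

variable {Ω : Type*} [Finite Ω]

/-- Counting points instead of orbits: each orbit of length l accounts for l points. -/
lemma count_orbitLengths_mul (H : Subgroup (Perm Ω)) (l : ℕ) :
    (orbitLengths H).count l * l = {p : Ω | (orbit H p).ncard = l}.ncard := by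
  classical
  have : Fintype Ω := Fintype.ofFinite Ω
  set T := (Set.toFinite (orbitSets H)).toFinset with hT
  have h1 : (orbitLengths H).count l = (T.filter fun O => l = O.ncard).card := by
    rw [orbitLengths, Multiset.count_map]; rfl
  have h2 : {p : Ω | (orbit H p).ncard = l}.ncard =
      (Finset.univ.filter fun p : Ω => (orbit H p).ncard = l).card := by
    rw [← Set.ncard_coe_finset]; simp
  rw [h1, h2, Finset.card_eq_sum_card_fiberwise (f := fun p => orbit H p)
    (t := T.filter fun O => l = O.ncard)]
  · rw [Finset.sum_const_nat (m := l)]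
    intro O hO
    obtain ⟨hOT, hOl⟩ := Finset.mem_filter.1 hO
    obtain ⟨q, rfl⟩ : O ∈ orbitSets H := by simpa [hT] using hOT
    rw [Finset.filter_filter, hOl, ← Set.ncard_coe_finset]
    congr 1
    ext p
    simp only [Finset.coe_filter, Finset.mem_univ, true_and, Set.mem_ofPred_eq]
    rw [orbit_eq_iff]
    exact ⟨fun h => h.2, fun h => ⟨by rw [orbit_eq_iff.2 h], h⟩⟩
  · intro p hp
    simp only [Finset.coe_filter, Finset.mem_univ, true_and, Set.mem_ofPred_eq] at hp ⊢
    exact ⟨by simp [hT, orbitSets], hp.symm⟩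

/-- The multiset of orbit lengths, from a classification of the points by orbit length. -/
lemma orbitLengths_eq_sum (H : Subgroup (Perm Ω)) {ι : Type*} [Fintype ι] (cl : Ω → ι)
    (ℓ c : ι → ℕ) (hℓ : ∀ i, 0 < ℓ i) (horb : ∀ p, (orbit H p).ncard = ℓ (cl p))
    (hcard : ∀ i, {p | cl p = i}.ncard = c i * ℓ i) :
    orbitLengths H = ∑ i, Multiset.replicate (c i) (ℓ i) := by
  classical
  have : Fintype Ω := Fintype.ofFinite Ω
  ext l
  rcases Nat.eq_zero_or_pos l with rfl | hl
  · rw [Multiset.count_sum', Finset.sum_eq_zero fun i _ => by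
      rw [Multiset.count_replicate, if_neg (hℓ i).ne'], Multiset.count_eq_zero]
    intro h
    obtain ⟨O, hO, hO0⟩ := Multiset.mem_map.1 h
    obtain ⟨p, rfl⟩ : O ∈ orbitSets H := by simpa using hO
    exact (hℓ (cl p)).ne' ((horb p).symm.trans hO0)
  · apply Nat.eq_of_mul_eq_mul_right hl
    rw [count_orbitLengths_mul, Multiset.count_sum', Finset.sum_mul]
    have h1 : ∀ i, Multiset.count l (Multiset.replicate (c i) (ℓ i)) * l =
        (Finset.univ.filter fun p : Ω => ℓ (cl p) = l ∧ cl p = i).card := by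
      intro i
      rw [Multiset.count_replicate]
      split_ifs with h
      · rw [← h, ← hcard, ← Set.ncard_coe_finset]
        congr 1
        ext p
        simp only [Set.mem_ofPred_eq, Finset.coe_filter, Finset.mem_univ, true_and]
        exact ⟨fun hp => ⟨by rw [hp], hp⟩, fun hp => hp.2⟩
      · rw [zero_mul, eq_comm, Finset.card_eq_zero, Finset.filter_eq_empty_iff]
        rintro p - ⟨hp, rfl⟩
        exact h hp
    simp only [h1, horb]
    have h2 : {p : Ω | ℓ (cl p) = l}.ncard =
        (Finset.univ.filter fun p : Ω => ℓ (cl p) = l).card := by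
      rw [← Set.ncard_coe_finset]; simp
    rw [h2, Finset.card_eq_sum_card_fiberwise (f := cl) (t := Finset.univ) (by simp)]
    simp only [Finset.filter_filter]

lemma orbitLengths_eq_four (H : Subgroup (Perm Ω)) (A B : Set Ω) (ℓ c : Bool → Bool → ℕ)
    (hℓ : ∀ i j, 0 < ℓ i j)
    (h₁₁ : ∀ p ∈ A ∩ B, (orbit H p).ncard = ℓ true true)
    (h₁₀ : ∀ p ∈ A \ B, (orbit H p).ncard = ℓ true false)
    (h₀₁ : ∀ p ∈ B \ A, (orbit H p).ncard = ℓ false true)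
    (h₀₀ : ∀ p ∈ (A ∪ B)ᶜ, (orbit H p).ncard = ℓ false false)
    (c₁₁ : (A ∩ B).ncard = c true true * ℓ true true)
    (c₁₀ : (A \ B).ncard = c true false * ℓ true false)
    (c₀₁ : (B \ A).ncard = c false true * ℓ false true)
    (c₀₀ : (A ∪ B)ᶜ.ncard = c false false * ℓ false false) :
    orbitLengths H = Multiset.replicate (c true true) (ℓ true true) +
      Multiset.replicate (c true false) (ℓ true false) +
      Multiset.replicate (c false true) (ℓ false true) +
      Multiset.replicate (c false false) (ℓ false false) := by
  classical
  rw [orbitLengths_eq_sum H (fun p => (decide (p ∈ A), decide (p ∈ B)))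
    (fun i => ℓ i.1 i.2) (fun i => c i.1 i.2) (fun i => hℓ _ _)]
  · simp only [Fintype.sum_prod_type, Fintype.sum_bool]
    abel
  · intro p
    by_cases hA : p ∈ A <;> by_cases hB : p ∈ B <;> simp only [hA, hB, decide_true, decide_false]
    · exact h₁₁ p ⟨hA, hB⟩
    · exact h₁₀ p ⟨hA, hB⟩
    · exact h₀₁ p ⟨hB, hA⟩
    · exact h₀₀ p (by simp [hA, hB])
  · rintro ⟨_ | _, _ | _⟩
    · rw [← c₀₀]; congr 1; ext p; simp
    · rw [← c₀₁]; congr 1; ext p; simp [and_comm]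
    · rw [← c₁₀]; congr 1; ext p; simp
    · rw [← c₁₁]; congr 1; ext p; simp

lemma orbitLengths_eq_two (H : Subgroup (Perm Ω)) (A : Set Ω) (ℓ₁ ℓ₀ c₁ c₀ : ℕ)
    (hℓ₁ : 0 < ℓ₁) (hℓ₀ : 0 < ℓ₀) (h₁ : ∀ p ∈ A, (orbit H p).ncard = ℓ₁)
    (h₀ : ∀ p ∉ A, (orbit H p).ncard = ℓ₀) (hc₁ : A.ncard = c₁ * ℓ₁) (hc₀ : Aᶜ.ncard = c₀ * ℓ₀) :
    orbitLengths H = Multiset.replicate c₁ ℓ₁ + Multiset.replicate c₀ ℓ₀ := by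
  classical
  rw [orbitLengths_eq_sum H (fun p => decide (p ∈ A)) (fun i => if i then ℓ₁ else ℓ₀)
    (fun i => if i then c₁ else c₀)]
  · simp
  · rintro (_ | _) <;> simp [hℓ₁, hℓ₀]
  · intro p
    by_cases hA : p ∈ A <;> simp only [hA, decide_true, decide_false]
    · simpa using h₁ p hA
    · simpa using h₀ p hA
  · rintro (_ | _)
    · rw [if_neg Bool.false_ne_true, if_neg Bool.false_ne_true, ← hc₀]
      congr 1; ext p; simp
    · rw [if_pos rfl, if_pos rfl, ← hc₁]
      congr 1; ext p; simp

lemma orbitLengths_eq_replicate (H : Subgroup (Perm Ω)) (ℓ c : ℕ) (hℓ : 0 < ℓ)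
    (h : ∀ p : Ω, (orbit H p).ncard = ℓ) (hc : Nat.card Ω = c * ℓ) :
    orbitLengths H = Multiset.replicate c ℓ := by
  rw [orbitLengths_eq_sum H (fun _ => ()) (fun _ => ℓ) (fun _ => c) (fun _ => hℓ) h]
  · simp
  · intro i
    rw [← hc, ← Set.ncard_univ]
    congr 1
    ext p
    simp

end Lengths

namespace AffineFrame

variable {Ω : Type*} [Finite Ω] {a w : Perm Ω} {ω : Ω} {n : ℕ} {α : ℤ}

/-- P is the period of x modulo m under the affine generator. The orbit meets P classes modulo m,
and each contributes its n/m points. -/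
lemma ncard_orbit (F : AffineFrame a w ω n α) {i : ℕ} {c : ℤ} {m : ℕ} (hm : m ∣ n) {x : ℤ}
    {P : ℕ} (hP : 0 < P) (h : ∀ k, affIter (α ^ i) c k x ≡ x [ZMOD m] ↔ P ∣ k) :
    (orbit (metaSub a w i c m) ((w ^ x) ω)).ncard = n / m * P := by
  classical
  have hm0 : 0 < m := Nat.pos_of_dvd_of_pos hm F.pos
  have hper : ∀ k l, affIter (α ^ i) c k x ≡ affIter (α ^ i) c l x [ZMOD m] ↔
      k ≡ l [MOD P] := by
    have hle : ∀ k d, affIter (α ^ i) c k x ≡ affIter (α ^ i) c (k + d) x [ZMOD m] ↔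
        k ≡ k + d [MOD P] := by
      intro k d
      have h1 : k ≡ k + d [MOD P] ↔ P ∣ d := by
        rw [Nat.modEq_iff_dvd' (Nat.le_add_right k d), Nat.add_sub_cancel_left]
      rw [h1, ← h d, affIter_add, Int.modEq_comm, Int.modEq_iff_dvd, Int.modEq_iff_dvd]
      have h2 : affIter (α ^ i) c k x - affIter (α ^ i) c k (affIter (α ^ i) c d x) =
          (α ^ i) ^ k * (x - affIter (α ^ i) c d x) := by
        simp only [affIter]; ring
      rw [h2]
      have hco : IsCoprime (m : ℤ) ((α ^ i) ^ k) := (F.isCoprime_of_dvd hm).symm.pow_right.pow_right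
      exact ⟨fun h => hco.dvd_of_dvd_mul_left h, fun h => h.mul_left _⟩
    intro k l
    rcases le_total k l with hkl | hkl
    · obtain ⟨d, rfl⟩ := Nat.exists_eq_add_of_le hkl
      exact hle k d
    · obtain ⟨d, rfl⟩ := Nat.exists_eq_add_of_le hkl
      rw [Int.modEq_comm, Nat.ModEq.comm]
      exact hle l d
  obtain ⟨N, rfl⟩ := hm
  rw [Nat.mul_div_cancel_left _ hm0]
  let f : ℕ × ℕ → Ω := fun kt => (w ^ (affIter (α ^ i) c kt.1 x + m * kt.2)) ω
  have himg : orbit (metaSub a w i c m) ((w ^ x) ω) =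
      ((Finset.range P ×ˢ Finset.range N).image f : Finset Ω) := by
    ext p
    obtain ⟨y, rfl⟩ := F.surj p
    rw [F.orbit_metaSub (dvd_mul_right m N)]
    simp only [Finset.coe_image, Finset.coe_product, Finset.coe_range, Set.mem_image,
      Set.mem_prod, Set.mem_Iio, Prod.exists]
    constructor
    · rintro ⟨k, hk⟩
      have hk' := hk.trans ((hper k (k % P)).2 (Nat.mod_modEq k P).symm)
      obtain ⟨z, hz⟩ := Int.modEq_iff_dvd.1 hk'
      have hN : (N : ℤ) ≠ 0 := by
        have := F.pos; rintro h; simp [Int.natCast_eq_zero.1 h] at this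
      refine ⟨k % P, ((-z) % N).toNat, ⟨Nat.mod_lt k hP, ?_⟩, ?_⟩
      · have := Int.emod_lt_of_pos (-z) (by omega : (0 : ℤ) < N)
        have := Int.emod_nonneg (-z) hN
        omega
      · change (w ^ (affIter (α ^ i) c (k % P) x + m * (((-z) % N).toNat : ℕ))) ω = _
        rw [F.inj, Int.toNat_of_nonneg (Int.emod_nonneg _ hN)]
        have h1 : (m : ℤ) * ((-z) % N) ≡ m * (-z) [ZMOD (m * N)] :=
          (Int.mod_modEq (-z) N).mul_left'
        have h2 : y = affIter (α ^ i) c (k % P) x + m * (-z) := by linear_combination -hz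
        rw [h2]
        push_cast
        exact h1.add_left _
    · rintro ⟨k, t, -, ht⟩
      refine ⟨k, ?_⟩
      have h1 := ((F.inj _ _).1 ht).of_dvd (Int.natCast_dvd_natCast.2 (dvd_mul_right m N))
      refine h1.symm.trans (Int.modEq_iff_dvd.2 ⟨-t, by ring⟩)
  rw [himg, Set.ncard_coe_finset, Finset.card_image_of_injOn, Finset.card_product,
    Finset.card_range, Finset.card_range, mul_comm]
  rintro ⟨k, t⟩ hk ⟨k', t'⟩ hk' heq
  simp only [Finset.coe_product, Finset.coe_range, Set.mem_prod, Set.mem_Iio] at hk hk'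
  have h0 := (F.inj _ _).1 heq
  have h1 := h0.of_dvd (Int.natCast_dvd_natCast.2 (dvd_mul_right m N))
  have h2 : affIter (α ^ i) c k x ≡ affIter (α ^ i) c k' x [ZMOD m] := by
    have e : ∀ y t : ℤ, y + m * t ≡ y [ZMOD m] := fun y t =>
      Int.modEq_iff_dvd.2 ⟨-t, by ring⟩
    exact ((e _ _).symm.trans h1).trans (e _ _)
  have h3 : k = k' := by
    have := (hper k k').1 h2
    rwa [Nat.ModEq, Nat.mod_eq_of_lt hk.1, Nat.mod_eq_of_lt hk'.1] at this
  subst h3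
  have h4 : (m : ℤ) * t ≡ m * t' [ZMOD (m * N)] := by
    have := Int.ModEq.add_left_cancel' _ h0
    push_cast at this; exact this
  have h5 : (t : ℤ) ≡ t' [ZMOD N] := by
    obtain ⟨z, hz⟩ := Int.modEq_iff_dvd.1 h4
    refine Int.modEq_iff_dvd.2 ⟨z, ?_⟩
    have hm' : (m : ℤ) ≠ 0 := by exact_mod_cast hm0.ne'
    apply mul_left_cancel₀ hm'
    linear_combination hz
  have h6 := Int.natCast_modEq_iff.1 h5
  rw [Nat.ModEq, Nat.mod_eq_of_lt hk.2, Nat.mod_eq_of_lt hk'.2] at h6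
  rw [h6]

/-- Orbit lengths for `⟨a ^ s, w ^ m⟩`. -/
lemma ncard_orbit_zero (F : AffineFrame a w ω n α) {s g m' P : ℕ} {x' : ℤ} {m : ℕ} {x : ℤ}
    (hm : m ∣ n) (hgm : m = g * m') (hx : x = g * x') (hco : IsCoprime x' m') (hP : 0 < P)
    (h : ∀ k, ordMod m' α ∣ s * k ↔ P ∣ k) :
    (orbit (metaSub a w s 0 m) ((w ^ x) ω)).ncard = n / m * P := by
  refine F.ncard_orbit hm hP fun k => ?_
  subst hgm hx
  have hg : (g : ℤ) ≠ 0 := by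
    rintro h0
    have := F.pos
    rw [Int.natCast_eq_zero.1 h0, zero_mul, zero_dvd_iff] at hm
    omega
  have hαm := F.isCoprime_of_dvd ((dvd_mul_left m' g).trans hm)
  -- After cancelling g, fixing gx' modulo gm' means α^(sk) ≡ 1 modulo m', since x' is a unit there.
  rw [← h, ordMod_dvd_iff hαm, affIter, zero_mul, add_zero, Int.modEq_comm, Int.modEq_iff_dvd,
    ← pow_mul, show α ^ (s * k) * (g * x') - g * x' = g * ((α ^ (s * k) - 1) * x') by ring]
  push_cast
  rw [mul_dvd_mul_iff_left hg]
  exact ⟨fun h => hco.symm.dvd_of_dvd_mul_right h, fun h => h.mul_right _⟩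

lemma card_eq (F : AffineFrame a w ω n α) : Nat.card Ω = n := by
  have h := F.ncard_orbit (i := 1) (c := 1) (m := 1) (x := 0) (one_dvd n) one_pos
    (fun k => by simp [Int.modEq_one])
  rw [Nat.div_one, mul_one] at h
  rw [← h, ← Set.ncard_univ]
  congr 1
  ext p
  obtain ⟨x, rfl⟩ := F.surj p
  simp only [Set.mem_univ, true_iff]
  exact (F.orbit_metaSub (one_dvd n)).2 ⟨0, by simp [Int.modEq_one]⟩

end AffineFrame

/-- The points with coordinate divisible by `q`. -/
def multiplesOf {Ω : Type*} (w : Perm Ω) (ω : Ω) (q : ℕ) : Set Ω :=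
  {p | ∃ x : ℤ, p = (w ^ (q * x)) ω}

namespace AffineFrame

variable {Ω : Type*} {a w : Perm Ω} {ω : Ω} {n : ℕ} {α : ℤ}

lemma mem_multiplesOf (F : AffineFrame a w ω n α) {q : ℕ} (hq : q ∣ n) (x : ℤ) :
    (w ^ x) ω ∈ multiplesOf w ω q ↔ (q : ℤ) ∣ x := by
  constructor
  · rintro ⟨y, hy⟩
    have h := ((F.inj _ _).1 hy).of_dvd (Int.natCast_dvd_natCast.2 hq)
    exact (Int.ModEq.dvd_iff h).2 (dvd_mul_right _ _)
  · rintro ⟨y, rfl⟩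
    exact ⟨y, rfl⟩

lemma ncard_multiplesOf [Finite Ω] (F : AffineFrame a w ω n α) {q : ℕ} (hq : q ∣ n) :
    (multiplesOf w ω q).ncard = n / q := by
  have h := F.ncard_orbit (i := 1) (c := 0) (x := 0) hq one_pos (fun k => by simp [affIter])
  rw [mul_one] at h
  rw [← h]
  congr 1
  ext p
  obtain ⟨x, rfl⟩ := F.surj p
  rw [F.mem_multiplesOf hq, F.orbit_metaSub hq]
  simp [affIter, Int.modEq_zero_iff_dvd]

lemma ncard_compl_multiplesOf [Finite Ω] (F : AffineFrame a w ω n α) {q : ℕ} (hq : q ∣ n) :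
    (multiplesOf w ω q)ᶜ.ncard = n - n / q := by
  rw [Set.ncard_compl, F.card_eq, F.ncard_multiplesOf hq]

end AffineFrame

lemma ordMod_dvd_totient {m : ℕ} (hm : 0 < m) {α : ℤ} (h : IsCoprime α m) :
    ordMod m α ∣ m.totient := by
  have : NeZero m := ⟨hm.ne'⟩
  obtain ⟨v, hv⟩ := (ZMod.coe_int_isUnit_iff_isCoprime α m).2 h.symm
  rw [ordMod, ← hv, orderOf_units, ← ZMod.card_units_eq_totient]
  exact orderOf_dvd_card

lemma ordMod_one_left (α : ℤ) : ordMod 1 α = 1 := by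
  rw [← Nat.dvd_one, ordMod_dvd_iff (by simpa using isCoprime_one_right)]; simp

lemma ordMod_dvd_sub_one {r : ℕ} (hr : r.Prime) {α : ℤ} (h : IsCoprime α r) :
    ordMod r α ∣ r - 1 := Nat.totient_prime hr ▸ ordMod_dvd_totient hr.pos h

lemma isCoprime_of_not_dvd {r : ℕ} (hr : r.Prime) {x : ℤ} (h : ¬ (r : ℤ) ∣ x) : IsCoprime x r :=
  ((Nat.prime_iff_prime_int.1 hr).irreducible.coprime_iff_not_dvd.2 h).symm

lemma affIter_modEq_self_iff_of_prime {r : ℕ} (hr : r.Prime) {α c : ℤ} (hα : IsCoprime α r)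
    (hc : (r : ℤ) ∣ c) (i k : ℕ) (x : ℤ) :
    affIter (α ^ i) c k x ≡ x [ZMOD r] ↔ (r : ℤ) ∣ x ∨ ordMod r α ∣ i * k := by
  have h1 : affIter (α ^ i) c k x ≡ α ^ (i * k) * x [ZMOD r] := by
    rw [affIter, pow_mul]
    simpa using ((Int.modEq_zero_iff_dvd.2 (hc.mul_right (geomSum (α ^ i) k))).add_left
      ((α ^ i) ^ k * x))
  have h2 : affIter (α ^ i) c k x ≡ x [ZMOD r] ↔ α ^ (i * k) * x ≡ x [ZMOD r] :=
    ⟨fun h => h1.symm.trans h, fun h => h1.trans h⟩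
  rw [h2, ordMod_dvd_iff hα, Int.modEq_comm, Int.modEq_iff_dvd,
    show α ^ (i * k) * x - x = x * (α ^ (i * k) - 1) by ring,
    (Nat.prime_iff_prime_int.1 hr).dvd_mul]

lemma affIter_modEq_self_iff_of_neg_one {m α c : ℤ} (hm : 2 ∣ m) (hα : m ∣ α + 1)
    (hc : ¬ 2 ∣ c) (k : ℕ) (x : ℤ) : affIter (α ^ 1) c k x ≡ x [ZMOD m] ↔ 2 ∣ k := by
  have h1 : affIter (α ^ 1) c k x ≡ (-1) ^ k * x + c * (k % 2 : ℕ) [ZMOD m] := by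
    rw [affIter, pow_one]
    refine Int.ModEq.add (Int.ModEq.mul_right x (Int.ModEq.pow k ?_))
      (AffineFrame.mul_geomSum_modEq (hα.mul_left c) k)
    exact (Int.modEq_iff_dvd.2 (by simpa using hα)).symm
  constructor
  · intro h
    by_contra hk
    have h2 := ((h1.symm.trans h).of_dvd hm)
    have hk1 : k % 2 = 1 := by omega
    rw [hk1, (Nat.odd_iff.2 hk1).neg_one_pow] at h2
    simp only [Int.ModEq] at h2
    omega
  · intro h
    have hk0 : k % 2 = 0 := by omega
    rw [hk0, (Nat.even_iff.2 hk0).neg_one_pow] at h1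
    simpa using h1

namespace AffineFrame

variable {Ω : Type*} [Finite Ω] {a w : Perm Ω} {ω : Ω} {n : ℕ} {α : ℤ}

lemma orbitLengths_fam1 (F : AffineFrame a w ω n α) {s r : ℕ}
    (hf : (FamilyMember.fam1 s r).Valid n α) :
    orbitLengths ((FamilyMember.fam1 s r).subgroup a w α) =
      (FamilyMember.fam1 s r).lengths n α := by
  obtain ⟨hr, hrn, hs, hso⟩ := hf
  have hα := F.isCoprime_of_dvd hrn
  have hor := ordMod_pos hr.pos hα
  obtain ⟨q, hq⟩ := ordMod_dvd_sub_one hr hα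
  rw [FamilyMember.subgroup_eq]
  change orbitLengths (metaSub a w s 0 r) = {n / r} + Multiset.replicate
    (s * (r - 1) / ordMod r α) (n / r * (ordMod r α / s))
  obtain ⟨o', ho'⟩ := hso
  have ho'0 : 0 < o' := Nat.pos_of_ne_zero (by rintro rfl; simp [ho'] at hor)
  have h1 : ordMod r α / s = o' := by rw [ho', Nat.mul_div_cancel_left _ hs.pos]
  have h2 : s * (r - 1) / ordMod r α = s * q := by
    rw [hq, mul_left_comm, Nat.mul_div_cancel_left _ hor]
  have hN : 0 < n / r := Nat.div_pos (Nat.le_of_dvd F.pos hrn) hr.pos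
  rw [h1, h2, ← Multiset.replicate_one]
  refine orbitLengths_eq_two _ (multiplesOf w ω r) _ _ _ _ hN (Nat.mul_pos hN ho'0)
    (fun p hp => ?_) (fun p hp => ?_) ?_ ?_
  · obtain ⟨x, rfl⟩ := F.surj p
    obtain ⟨x', rfl⟩ := (F.mem_multiplesOf hrn x).1 hp
    rw [F.ncard_orbit_zero (g := r) (m' := 1) hrn (mul_one r).symm rfl (by simpa using isCoprime_one_right) one_pos
      (by simp [ordMod_one_left]), mul_one]
  · obtain ⟨x, rfl⟩ := F.surj p
    rw [F.mem_multiplesOf hrn] at hp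
    refine F.ncard_orbit_zero (g := 1) (x' := x) hrn (one_mul r).symm (by simp)
      (isCoprime_of_not_dvd hr hp) ho'0 fun k => ?_
    rw [ho', Nat.mul_dvd_mul_iff_left hs.pos]
  · rw [F.ncard_multiplesOf hrn, one_mul]
  · rw [F.ncard_compl_multiplesOf hrn]
    obtain ⟨N, rfl⟩ := hrn
    rw [Nat.mul_div_cancel_left _ hr.pos, ← Nat.sub_one_mul, hq, ho']
    ring

lemma orbitLengths_fam2_same (F : AffineFrame a w ω n α) {r : ℕ} (hr : r.Prime)
    (hrn : r * r ∣ n) : orbitLengths (metaSub a w 1 0 (r * r)) =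
      {n / r ^ 2} + Multiset.replicate ((r - 1) / ordMod r α) (n / r ^ 2 * ordMod r α) +
        Multiset.replicate (r * (r - 1) / ordMod (r ^ 2) α) (n / r ^ 2 * ordMod (r ^ 2) α) := by
  have hrn' : r ∣ n := (dvd_mul_left r r).trans hrn
  have hα := F.isCoprime_of_dvd hrn'
  have hα2 : IsCoprime α (r ^ 2 : ℕ) := F.isCoprime_of_dvd (by rwa [sq])
  have hor := ordMod_pos hr.pos hα
  have hor2 := ordMod_pos (pow_pos hr.pos 2) hα2
  obtain ⟨q, hq⟩ := ordMod_dvd_sub_one hr hα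
  obtain ⟨q', hq'⟩ := ordMod_dvd_totient (pow_pos hr.pos 2) hα2
  have ht : (r ^ 2).totient = r * (r - 1) := by
    rw [Nat.totient_prime_pow hr two_pos]; simp
  rw [ht] at hq'
  have hN : 0 < n / (r * r) := Nat.div_pos (Nat.le_of_dvd F.pos hrn) (Nat.mul_pos hr.pos hr.pos)
  rw [hq', hq, Nat.mul_div_cancel_left _ hor, Nat.mul_div_cancel_left _ hor2,
    ← Multiset.replicate_one]
  set o := ordMod r α with ho
  set o₂ := ordMod (r ^ 2) α with ho₂
  rw [sq]
  -- Multiples of r² are multiples of r, so one of the four classes is empty; it gets multiplicity 0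
  -- and the dummy length 1, which must be positive.
  have h := orbitLengths_eq_four (metaSub a w 1 0 (r * r)) (multiplesOf w ω (r * r))
    (multiplesOf w ω r)
    (fun i j => if i then (if j then n / (r * r) else 1) else
      (if j then n / (r * r) * o else n / (r * r) * o₂))
    (fun i j => if i then (if j then 1 else 0) else (if j then q else q'))
    (by rintro (_ | _) (_ | _) <;> simp [hN, hor, hor2]) ?_ ?_ ?_ ?_ ?_ ?_ ?_ ?_
  · rw [h]; simp
  · rintro p ⟨hp, -⟩
    obtain ⟨x, rfl⟩ := F.surj p
    obtain ⟨x', rfl⟩ := (F.mem_multiplesOf hrn x).1 hp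
    rw [F.ncard_orbit_zero (g := r * r) (m' := 1) hrn (mul_one _).symm rfl
      (by simpa using isCoprime_one_right) one_pos (by simp [ordMod_one_left]), mul_one]
    simp
  · rintro p ⟨hp, hp'⟩
    obtain ⟨x, rfl⟩ := F.surj p
    rw [F.mem_multiplesOf hrn] at hp
    rw [F.mem_multiplesOf hrn'] at hp'
    exact absurd (Dvd.dvd.trans (by push_cast; exact dvd_mul_left _ _) hp) hp'
  · rintro p ⟨hp, hp'⟩
    obtain ⟨x, rfl⟩ := F.surj p
    rw [F.mem_multiplesOf hrn] at hp'
    obtain ⟨x', rfl⟩ := (F.mem_multiplesOf hrn' x).1 hp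
    have hx' : ¬ (r : ℤ) ∣ x' := fun h => hp' (by push_cast; exact mul_dvd_mul_left _ h)
    rw [F.ncard_orbit_zero (g := r) (m' := r) hrn rfl rfl (isCoprime_of_not_dvd hr hx') hor
      (by simp [ho])]
    simp
  · intro p hp
    obtain ⟨x, rfl⟩ := F.surj p
    have hx : ¬ (r : ℤ) ∣ x := fun h => hp (Or.inr ((F.mem_multiplesOf hrn' x).2 h))
    rw [F.ncard_orbit_zero (g := 1) (m' := r ^ 2) (x' := x) hrn (by ring) (by simp)
      (by push_cast; exact (isCoprime_of_not_dvd hr hx).pow_right) hor2 (by simp [ho₂])]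
    simp
  all_goals
    have hsub : multiplesOf w ω (r * r) ⊆ multiplesOf w ω r := by
      intro p hp
      obtain ⟨x, rfl⟩ := F.surj p
      rw [F.mem_multiplesOf hrn] at hp
      rw [F.mem_multiplesOf hrn']
      exact Dvd.dvd.trans (by push_cast; exact dvd_mul_left _ _) hp
  · rw [Set.inter_eq_left.2 hsub, F.ncard_multiplesOf hrn]; simp
  · rw [Set.sdiff_eq_empty.2 hsub]; simp
  · rw [Set.ncard_sdiff hsub, F.ncard_multiplesOf hrn, F.ncard_multiplesOf hrn']
    simp only [Bool.false_eq_true, if_false, if_true]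
    obtain ⟨N, rfl⟩ := hrn
    rw [Nat.mul_div_cancel_left _ (Nat.mul_pos hr.pos hr.pos), mul_assoc,
      Nat.mul_div_cancel_left _ hr.pos, ← Nat.sub_one_mul, hq]
    ring
  · rw [Set.union_eq_right.2 hsub, F.ncard_compl_multiplesOf hrn']
    simp only [Bool.false_eq_true, if_false]
    obtain ⟨N, rfl⟩ := hrn
    rw [Nat.mul_div_cancel_left _ (Nat.mul_pos hr.pos hr.pos), mul_assoc r r N,
      Nat.mul_div_cancel_left _ hr.pos, ← Nat.sub_one_mul,
      show (r - 1) * (r * N) = r * (r - 1) * N by ring, hq']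
    ring

lemma orbitLengths_fam2_ne (F : AffineFrame a w ω n α) {s r : ℕ} (hs : s.Prime) (hr : r.Prime)
    (hsr : s ≠ r) (hsrn : s * r ∣ n) : orbitLengths (metaSub a w 1 0 (s * r)) =
      {n / (s * r)} + Multiset.replicate ((r - 1) / ordMod r α) (n / (s * r) * ordMod r α) +
        Multiset.replicate ((s - 1) / ordMod s α) (n / (s * r) * ordMod s α) +
        Multiset.replicate ((s - 1) * (r - 1) / ordMod (s * r) α)
          (n / (s * r) * ordMod (s * r) α) := by
  have hrn : r ∣ n := (dvd_mul_left r s).trans hsrn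
  have hsn : s ∣ n := (dvd_mul_right s r).trans hsrn
  have hco : s.Coprime r := (Nat.coprime_primes hs hr).2 hsr
  have hαr := F.isCoprime_of_dvd hrn
  have hαs := F.isCoprime_of_dvd hsn
  have hαsr := F.isCoprime_of_dvd hsrn
  have hor := ordMod_pos hr.pos hαr
  have hos := ordMod_pos hs.pos hαs
  have hosr := ordMod_pos (Nat.mul_pos hs.pos hr.pos) hαsr
  obtain ⟨q, hq⟩ := ordMod_dvd_sub_one hr hαr
  obtain ⟨q', hq'⟩ := ordMod_dvd_sub_one hs hαs
  obtain ⟨q₂, hq₂⟩ := ordMod_dvd_totient (Nat.mul_pos hs.pos hr.pos) hαsr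
  rw [Nat.totient_mul hco, Nat.totient_prime hs, Nat.totient_prime hr] at hq₂
  have hN : 0 < n / (s * r) :=
    Nat.div_pos (Nat.le_of_dvd F.pos hsrn) (Nat.mul_pos hs.pos hr.pos)
  rw [hq₂, hq, hq', Nat.mul_div_cancel_left _ hor, Nat.mul_div_cancel_left _ hos,
    Nat.mul_div_cancel_left _ hosr, ← Multiset.replicate_one]
  set o := ordMod r α with ho
  set o' := ordMod s α with ho'
  set o₂ := ordMod (s * r) α with ho₂
  have hboth : ∀ {x : ℤ}, (s : ℤ) ∣ x → (r : ℤ) ∣ x → ((s * r : ℕ) : ℤ) ∣ x := fun h h' => by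
    push_cast; exact (Nat.isCoprime_iff_coprime.2 hco).mul_dvd h h'
  have hinter : multiplesOf w ω s ∩ multiplesOf w ω r = multiplesOf w ω (s * r) := by
    ext p
    obtain ⟨x, rfl⟩ := F.surj p
    rw [Set.mem_inter_iff, F.mem_multiplesOf hsn, F.mem_multiplesOf hrn, F.mem_multiplesOf hsrn]
    refine ⟨fun h => hboth h.1 h.2, fun h => ?_⟩
    push_cast at h
    exact ⟨(dvd_mul_right _ _).trans h, (dvd_mul_left _ _).trans h⟩
  have h := orbitLengths_eq_four (metaSub a w 1 0 (s * r)) (multiplesOf w ω s)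
    (multiplesOf w ω r)
    (fun i j => if i then (if j then n / (s * r) else n / (s * r) * o) else
      (if j then n / (s * r) * o' else n / (s * r) * o₂))
    (fun i j => if i then (if j then 1 else q) else (if j then q' else q₂))
    (by rintro (_ | _) (_ | _) <;> simp [hN, hor, hos, hosr]) ?_ ?_ ?_ ?_ ?_ ?_ ?_ ?_
  · rw [h]; simp
  · intro p hp
    rw [hinter] at hp
    obtain ⟨x, rfl⟩ := F.surj p
    obtain ⟨x', rfl⟩ := (F.mem_multiplesOf hsrn x).1 hp
    rw [F.ncard_orbit_zero (g := s * r) (m' := 1) hsrn (mul_one _).symm rfl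
      (by simpa using isCoprime_one_right) one_pos (by simp [ordMod_one_left]), mul_one]
    simp
  · rintro p ⟨hp, hp'⟩
    obtain ⟨x, rfl⟩ := F.surj p
    rw [F.mem_multiplesOf hrn] at hp'
    obtain ⟨x', rfl⟩ := (F.mem_multiplesOf hsn x).1 hp
    have hx' : ¬ (r : ℤ) ∣ x' := fun h => hp' (h.mul_left _)
    rw [F.ncard_orbit_zero (g := s) (m' := r) hsrn rfl rfl (isCoprime_of_not_dvd hr hx') hor
      (by simp [ho])]
    simp
  · rintro p ⟨hp, hp'⟩
    obtain ⟨x, rfl⟩ := F.surj p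
    rw [F.mem_multiplesOf hsn] at hp'
    obtain ⟨x', rfl⟩ := (F.mem_multiplesOf hrn x).1 hp
    have hx' : ¬ (s : ℤ) ∣ x' := fun h => hp' (h.mul_left _)
    rw [F.ncard_orbit_zero (g := r) (m' := s) hsrn (mul_comm s r) rfl
      (isCoprime_of_not_dvd hs hx') hos (by simp [ho'])]
    simp
  · intro p hp
    obtain ⟨x, rfl⟩ := F.surj p
    have hx : ¬ (r : ℤ) ∣ x := fun h => hp (Or.inr ((F.mem_multiplesOf hrn x).2 h))
    have hx' : ¬ (s : ℤ) ∣ x := fun h => hp (Or.inl ((F.mem_multiplesOf hsn x).2 h))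
    rw [F.ncard_orbit_zero (g := 1) (m' := s * r) (x' := x) hsrn (one_mul _).symm (by simp)
      (by push_cast; exact (isCoprime_of_not_dvd hs hx').mul_right (isCoprime_of_not_dvd hr hx))
      hosr (by simp [ho₂])]
    simp
  -- The four counts come from inclusion–exclusion; writing s = s' + 1 and r = r' + 1 avoids
  -- truncated subtraction.
  all_goals
    have e := F.ncard_multiplesOf (a := a) hsrn
    have es := F.ncard_multiplesOf (a := a) hsn
    have er := F.ncard_multiplesOf (a := a) hrn
    have hd := Set.ncard_inter_add_ncard_sdiff_eq_ncard (multiplesOf w ω s) (multiplesOf w ω r)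
    have hd' := Set.ncard_inter_add_ncard_sdiff_eq_ncard (multiplesOf w ω r) (multiplesOf w ω s)
    have hu := Set.ncard_add_ncard_compl (multiplesOf w ω s ∪ multiplesOf w ω r)
    have hui := Set.ncard_union_add_ncard_inter (multiplesOf w ω s) (multiplesOf w ω r)
    rw [Set.inter_comm] at hd'
    rw [hinter] at hd hd' hui
    rw [F.card_eq] at hu
    simp only [Bool.false_eq_true, if_false, if_true]
    obtain ⟨s', rfl⟩ : ∃ s', s = s' + 1 := ⟨s - 1, by have := hs.pos; omega⟩
    obtain ⟨r', rfl⟩ : ∃ r', r = r' + 1 := ⟨r - 1, by have := hr.pos; omega⟩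
    simp only [Nat.add_sub_cancel] at hq hq' hq₂
    obtain ⟨N, rfl⟩ := hsrn
    have e1 : (s' + 1) * (r' + 1) * N / ((s' + 1) * (r' + 1)) = N :=
      Nat.mul_div_cancel_left _ (by positivity)
    have e2 : (s' + 1) * (r' + 1) * N / (s' + 1) = (r' + 1) * N := by
      rw [mul_assoc]; exact Nat.mul_div_cancel_left _ (by positivity)
    have e3 : (s' + 1) * (r' + 1) * N / (r' + 1) = (s' + 1) * N := by
      rw [mul_comm (s' + 1), mul_assoc]; exact Nat.mul_div_cancel_left _ (by positivity)
    rw [e1] at e ⊢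
    rw [e2] at es
    rw [e3] at er
  · rw [hinter, e, one_mul]
  · have : r' * N = q * (N * o) := by rw [hq]; ring
    linarith
  · have : s' * N = q' * (N * o') := by rw [hq']; ring
    linarith
  · have : s' * r' * N = q₂ * (N * o₂) := by rw [hq₂]; ring
    linarith

lemma orbitLengths_fam3 (F : AffineFrame a w ω n α) {s r : ℕ}
    (hf : (FamilyMember.fam3 s r).Valid n α) :
    orbitLengths ((FamilyMember.fam3 s r).subgroup a w α) =
      (FamilyMember.fam3 s r).lengths n α := by
  have hsrn : s * r ∣ n := F.modulus_dvd hf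
  have hlt := F.family_lt hf
  obtain ⟨hr, hrn, hs, hsn, hso, hcop⟩ := hf
  have hco : s.Coprime r := (Nat.coprime_primes hs hr).2 hlt.ne
  have hα := F.isCoprime_of_dvd hrn
  have hor := ordMod_pos hr.pos hα
  obtain ⟨q, hq⟩ := ordMod_dvd_sub_one hr hα
  rw [FamilyMember.subgroup_eq]
  change orbitLengths (metaSub a w (ordMod s α) r (s * r)) = {n / r} + Multiset.replicate
    (s * (r - 1) / ordMod r α) (n / r * (ordMod r α / s))
  -- Modulo s the generator is a translation of order s, modulo r it is multiplication by an element
  -- of order ord_r(α). As s ∣ ord_r(α), the period is s on multiples of r and ord_r(α) elsewhere.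
  have hiff : ∀ (k : ℕ) (x : ℤ), affIter (α ^ ordMod s α) r k x ≡ x [ZMOD ((s * r : ℕ) : ℤ)] ↔
      s ∣ k ∧ ((r : ℤ) ∣ x ∨ ordMod r α ∣ k) := by
    intro k x
    push_cast
    rw [← Int.modEq_and_modEq_iff_modEq_mul (by simpa using hco),
      affIter_modEq_self_iff_of_prime hr hα dvd_rfl, hcop.dvd_mul_left]
    refine and_congr_left fun _ => ?_
    have h : (s : ℤ) ∣ α ^ ordMod s α - 1 := (ordMod_dvd_iff (F.isCoprime_of_dvd hsn) _).1 dvd_rfl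
    have h1 : affIter (α ^ ordMod s α) r k x ≡ x + r * k [ZMOD s] := by
      refine Int.ModEq.add ?_ ((geomSum_modEq_natCast h k).mul_left _)
      simpa using ((Int.modEq_iff_dvd.2 h).symm.pow k).mul_right x
    have h2 : affIter (α ^ ordMod s α) r k x ≡ x [ZMOD s] ↔ x ≡ x + r * k [ZMOD s] :=
      ⟨fun h => h.symm.trans h1, fun h => h1.trans h.symm⟩
    rw [h2, Int.modEq_iff_dvd, add_sub_cancel_left, ← Nat.cast_mul, Int.natCast_dvd_natCast,
      hco.dvd_mul_left]
  obtain ⟨o', ho'⟩ := id hso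
  have ho'0 : 0 < o' := Nat.pos_of_ne_zero (by rintro rfl; simp [ho'] at hor)
  have h1 : ordMod r α / s = o' := by rw [ho', Nat.mul_div_cancel_left _ hs.pos]
  have h2 : s * (r - 1) / ordMod r α = s * q := by
    rw [hq, mul_left_comm, Nat.mul_div_cancel_left _ hor]
  have hN : 0 < n / r := Nat.div_pos (Nat.le_of_dvd F.pos hrn) hr.pos
  have hNs : n / r = n / (s * r) * s := by
    obtain ⟨N, rfl⟩ := hsrn
    rw [Nat.mul_div_cancel_left _ (Nat.mul_pos hs.pos hr.pos), mul_comm s, mul_assoc,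
      Nat.mul_div_cancel_left _ hr.pos, mul_comm]
  rw [h1, h2, ← Multiset.replicate_one]
  refine orbitLengths_eq_two _ (multiplesOf w ω r) _ _ _ _ hN (Nat.mul_pos hN ho'0)
    (fun p hp => ?_) (fun p hp => ?_) ?_ ?_
  · obtain ⟨x, rfl⟩ := F.surj p
    rw [F.mem_multiplesOf hrn] at hp
    rw [hNs]
    exact F.ncard_orbit hsrn hs.pos fun k => by rw [hiff]; simp [hp]
  · obtain ⟨x, rfl⟩ := F.surj p
    rw [F.mem_multiplesOf hrn] at hp
    rw [hNs, mul_assoc, ← ho']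
    refine F.ncard_orbit hsrn hor fun k => ?_
    rw [hiff]
    exact ⟨fun h => h.2.resolve_left hp, fun h => ⟨hso.trans h, Or.inr h⟩⟩
  · rw [F.ncard_multiplesOf hrn, one_mul]
  · rw [F.ncard_compl_multiplesOf hrn]
    obtain ⟨N, rfl⟩ := hrn
    rw [Nat.mul_div_cancel_left _ hr.pos, ← Nat.sub_one_mul, hq, ho']
    ring

lemma orbitLengths_fam4 (F : AffineFrame a w ω n α) {r : ℕ}
    (hf : (FamilyMember.fam4 r).Valid n α) :
    orbitLengths ((FamilyMember.fam4 r).subgroup a w α) = (FamilyMember.fam4 r).lengths n α := by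
  have hm : 4 * r ∣ n := F.modulus_dvd hf
  obtain ⟨hr, hrn, hr2, h4, hα4⟩ := hf
  have hα := F.isCoprime_of_dvd hrn
  have hor := ordMod_pos hr.pos hα
  obtain ⟨q, hq⟩ := ordMod_dvd_sub_one hr hα
  have hco : Nat.Coprime 4 r := by
    rw [show 4 = 2 ^ 2 by norm_num]
    exact Nat.Coprime.pow_left 2 ((Nat.coprime_primes Nat.prime_two hr).2 (Ne.symm hr2))
  have hrodd : ¬ (2 : ℤ) ∣ r := fun h => hr2
    ((Nat.prime_dvd_prime_iff_eq Nat.prime_two hr).1 (Int.natCast_dvd_natCast.1 h)).symm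
  have h41 : (4 : ℤ) ∣ α + 1 := by
    have := Int.modEq_iff_dvd.1 hα4.symm; simpa using this
  rw [FamilyMember.subgroup_eq]
  change orbitLengths (metaSub a w 1 r (4 * r)) = Multiset.replicate 2 (n / (2 * r)) +
    Multiset.replicate (2 * (r - 1) * Nat.gcd 2 (ordMod r α) / ordMod r α)
      (n / (2 * r) * (ordMod r α / Nat.gcd 2 (ordMod r α)))
  -- Modulo 4 every point has period 2, so the period is 2 on multiples of r and lcm(2, ord_r(α))
  -- elsewhere.
  have hiff : ∀ (k : ℕ) (x : ℤ), affIter (α ^ 1) r k x ≡ x [ZMOD ((4 * r : ℕ) : ℤ)] ↔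
      2 ∣ k ∧ ((r : ℤ) ∣ x ∨ ordMod r α ∣ k) := by
    intro k x
    push_cast
    rw [← Int.modEq_and_modEq_iff_modEq_mul (by simpa using hco),
      affIter_modEq_self_iff_of_prime hr hα dvd_rfl, one_mul,
      affIter_modEq_self_iff_of_neg_one (by norm_num) h41 hrodd]
  have hlcm := Nat.gcd_mul_lcm 2 (ordMod r α)
  have hg0 : 0 < Nat.gcd 2 (ordMod r α) := Nat.gcd_pos_of_pos_left _ two_pos
  obtain ⟨o', ho'⟩ := Nat.gcd_dvd_right 2 (ordMod r α)
  set g := Nat.gcd 2 (ordMod r α) with hg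
  have ho'0 : 0 < o' := Nat.pos_of_ne_zero (by rintro rfl; rw [mul_zero] at ho'; omega)
  have hl : Nat.lcm 2 (ordMod r α) = 2 * o' := by
    apply Nat.eq_of_mul_eq_mul_left hg0
    rw [hlcm]; conv_lhs => rw [ho']
    ring
  have h1 : ordMod r α / g = o' := by rw [ho', Nat.mul_div_cancel_left _ hg0]
  have h2 : 2 * (r - 1) * g / ordMod r α = 2 * q * g := by
    rw [hq, show 2 * (ordMod r α * q) * g = ordMod r α * (2 * q * g) by ring,
      Nat.mul_div_cancel_left _ hor]
  rw [h1, h2]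
  have hMn : n / (2 * r) = n / (4 * r) * 2 := by
    obtain ⟨N, rfl⟩ := hm
    rw [Nat.mul_div_cancel_left _ (by have := hr.pos; omega),
      show 4 * r * N = 2 * r * (N * 2) by ring,
      Nat.mul_div_cancel_left _ (by have := hr.pos; omega)]
  have hM : 0 < n / (2 * r) := by
    rw [hMn]
    exact Nat.mul_pos (Nat.div_pos (Nat.le_of_dvd F.pos hm) (by have := hr.pos; omega)) two_pos
  refine orbitLengths_eq_two _ (multiplesOf w ω r) _ _ _ _ hM (Nat.mul_pos hM ho'0)
    (fun p hp => ?_) (fun p hp => ?_) ?_ ?_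
  · obtain ⟨x, rfl⟩ := F.surj p
    rw [F.mem_multiplesOf hrn] at hp
    rw [hMn]
    exact F.ncard_orbit hm two_pos fun k => by rw [hiff]; simp [hp]
  · obtain ⟨x, rfl⟩ := F.surj p
    rw [F.mem_multiplesOf hrn] at hp
    rw [hMn, mul_assoc, ← hl]
    refine F.ncard_orbit hm (by rw [hl]; omega) fun k => ?_
    rw [hiff, Nat.lcm_dvd_iff]
    exact and_congr_right fun _ => ⟨fun h => h.resolve_left hp, Or.inr⟩
  · rw [F.ncard_multiplesOf hrn, hMn]
    obtain ⟨N, rfl⟩ := hm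
    rw [Nat.mul_div_cancel_left _ (by have := hr.pos; omega),
      show 4 * r * N = r * (2 * (N * 2)) by ring, Nat.mul_div_cancel_left _ hr.pos]
  · rw [F.ncard_compl_multiplesOf hrn, hMn]
    obtain ⟨N, rfl⟩ := hm
    rw [Nat.mul_div_cancel_left _ (by have := hr.pos; omega),
      show 4 * r * N = r * (4 * N) by ring, Nat.mul_div_cancel_left _ hr.pos,
      ← Nat.sub_one_mul, hq]
    conv_lhs => rw [ho']
    ring

lemma orbitLengths_family (F : AffineFrame a w ω n α) {f : FamilyMember} (hf : f.Valid n α) :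
    orbitLengths (f.subgroup a w α) = f.lengths n α := by
  cases f with
  | fam1 s r => exact F.orbitLengths_fam1 hf
  | fam2 s r =>
    obtain ⟨hs, -, hr, -, hsr⟩ := hf
    rw [FamilyMember.subgroup_eq, FamilyMember.lengths]
    split_ifs with h
    · subst h
      exact F.orbitLengths_fam2_same hs hsr
    · exact F.orbitLengths_fam2_ne hs hr h hsr
  | fam3 s r => exact F.orbitLengths_fam3 hf
  | fam4 r => exact F.orbitLengths_fam4 hf
  | fam5 =>
    obtain ⟨h4, hα⟩ := hf
    rw [FamilyMember.subgroup_eq]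
    change orbitLengths (metaSub a w 2 0 4) = Multiset.replicate 4 (n / 4)
    refine orbitLengths_eq_replicate _ _ _ (Nat.div_pos (Nat.le_of_dvd F.pos h4) (by norm_num))
      (fun p => ?_) (by rw [F.card_eq, Nat.mul_div_cancel' h4])
    obtain ⟨x, rfl⟩ := F.surj p
    rw [F.ncard_orbit h4 one_pos, mul_one]
    intro k
    have h2 : α ^ 2 ≡ 1 [ZMOD 4] := hα.pow 2
    simpa [affIter] using (h2.pow k).mul_right x
  | fam6 =>
    obtain ⟨h8, hα⟩ := hf
    have h81 : (8 : ℤ) ∣ α + 1 := by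
      have := Int.modEq_iff_dvd.1 hα.symm; simpa using this
    have h4 : n / 4 = n / 8 * 2 := by omega
    rw [FamilyMember.subgroup_eq]
    change orbitLengths (metaSub a w 1 1 8) = Multiset.replicate 4 (n / 4)
    refine orbitLengths_eq_replicate _ _ _ ?_ (fun p => ?_) (by rw [F.card_eq]; omega)
    · have := Nat.le_of_dvd F.pos h8
      omega
    · obtain ⟨x, rfl⟩ := F.surj p
      rw [h4]
      exact F.ncard_orbit h8 two_pos fun k =>
        affIter_modEq_self_iff_of_neg_one (by norm_num) h81 (by norm_num) k x

end AffineFrame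

end

theorem theoremt {Ω : Type*} [Finite Ω] (G W : Subgroup (Perm Ω)) (a w : Perm Ω) (ω : Ω)
    (n : ℕ) (α : ℤ)
    (hWG : W ≤ G) (hWnormal : (W.subgroupOf G).Normal) (hWregular : IsRegularGroup W)
    (hw : W = Subgroup.zpowers w) (hn : Nat.card W = n)
    (ha : stabilizer (Perm Ω) ω ⊓ G = Subgroup.zpowers a)
    (hG : G = Subgroup.closure {a, w})
    (hα : a * w * a⁻¹ = w ^ α) :
    (∀ H : Subgroup (Perm Ω), IsSecondMaximalRelClosed G H →
      ∃! i : FamilyMember, i.Valid n α ∧ i.Ordered ∧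
        AreConjugateIn (holomorph W ω) H (i.subgroup a w α)) ∧
    (∀ i : FamilyMember, i.Valid n α → IsSecondMaximalRelClosed G (i.subgroup a w α)) ∧
    (∀ i : FamilyMember, i.Valid n α →
      orbitLengths (i.subgroup a w α) = i.lengths n α) := by
  have F : AffineFrame a w ω n α :=
    AffineFrame.of_isRegularGroup hWG hWnormal hWregular hw hn ha hα
  subst hw hG
  refine ⟨fun H hH => ?_, fun i hi => F.isSecondMaximalRelClosed_family hi,
    fun i hi => F.orbitLengths_family hi⟩
  obtain ⟨f, hf, hford, g, hg, hfg⟩ := F.exists_family_of_isSecondMaximalRelClosed hH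
  refine ⟨f, ⟨hf, hford, g, hg, hfg.symm⟩, ?_⟩
  rintro f' ⟨hf', hford', g', hg', hfg'⟩
  refine F.family_injective hf' hf hford' hford (mul_mem hg' (inv_mem hg)) ?_
  rw [hfg, conjSubgroup_conjSubgroup, inv_mul_cancel_right]
  exact hfg'.symm
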